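/- **Proposition (Beale–Kato–Majda type criterion).** Let $a, g > 0$ and let $C^\infty(\mathbb{T})$ denote the smooth $2\pi$-periodic functions on $\mathbb{R}$. For $f \in C^\infty(\mathbb{T})$ put $$H_a f(x) := \mathrm{P.V.}\int_{\mathbb{R}} f(x-y)\,K_a(y)\,dy = \lim_{\varepsilon\to 0^+}\int_{|y|>\varepsilon} f(x-y)\,K_a(y)\,dy, \qquad K_a(y) := \frac{1}{\pi y}\,\frac{a^2}{y^2+a^2}.$$ Let $\rho_0 \in C^\infty(\mathbb{T})$, let $0 < T_* < \infty$, and let $\rho \in C^\infty(\mathbb{T}\times[0,T_*))$ (smooth up to and including $t = 0$) be a solution of the one-dimensional IPM model $$\partial_t \rho + u\,\partial_x\rho = 0, \qquad u = g\,H_a\rho, \qquad \rho(\cdot,0) = \rho_0$$ on $\mathbb{T}\times[0,T_*)$. Suppose that $\rho$ cannot be continued smoothly past $T_*$, that is, for no $T' > T_*$ is there a solution $\rho' \in C^\infty(\mathbb{T}\times[0,T'))$ of the model with initial data $\rho_0$ such that $\rho' = \rho$ on $\mathbb{T}\times[0,T_*)$. Then $s \mapsto \|\partial_x\rho(\cdot,s)\|_\infty$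 is integrable on $[0,t]$ for every $0 \le t < T_*$, and $$\lim_{t\to T_*^-}\int_0^t \|\partial_x\rho(\cdot,s)\|_\infty\,ds = \infty.$$ -/

import Mathlib

open Set Filter Topology MeasureTheory
open scoped ContDiff

namespace IPM1D

/-- The kernel `K_a(y) = (1 / (π y)) * a² / (y² + a²)`. -/
noncomputable def kernel (a y : ℝ) : ℝ := 1 / (Real.pi * y) * (a ^ 2 / (y ^ 2 + a ^ 2))

/-- The truncated integral `∫_{|y| > ε} f (x - y) K_a(y) dy`. -/
noncomputable def truncHa (a : ℝ) (f : ℝ → ℝ) (x ε : ℝ) : ℝ :=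
  ∫ y in {y : ℝ | ε < |y|}, f (x - y) * kernel a y

/-- `H_a f (x) = P.V. ∫_ℝ f (x - y) K_a(y) dy`, the limit of the truncated integrals as `ε → 0+`.
The limit exists for every `C¹` function of period `2π`; see `tendsto_truncHa` below. -/
noncomputable def Ha (a : ℝ) (f : ℝ → ℝ) (x : ℝ) : ℝ :=
  limUnder (𝓝[>] (0 : ℝ)) (truncHa a f x)

/-- The sup norm `‖f‖_∞` of a (bounded) function on the real line. -/
noncomputable def supNorm (f : ℝ → ℝ) : ℝ := ⨆ x : ℝ, |f x|

/-- `f ∈ C^∞(𝕋)`: smooth functions on the real line of period `2π`. -/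
def SmoothPeriodic (f : ℝ → ℝ) : Prop :=
  ContDiff ℝ ∞ f ∧ Function.Periodic f (2 * Real.pi)

/-- `ρ x t` is a solution in `C^∞(𝕋 × [0, T))` of
`∂ₜρ + u ∂ₓρ = 0`, `u = g H_a ρ`, `ρ(·, 0) = ρ₀`.
Smoothness is up to and including the initial time; at `t = 0` the time derivative is one-sided. -/
structure IsSmoothSolution (a g : ℝ) (ρ₀ : ℝ → ℝ) (T : ℝ) (ρ : ℝ → ℝ → ℝ) : Prop where
  smooth : ContDiffOn ℝ ∞ (fun p : ℝ × ℝ => ρ p.1 p.2) (univ ×ˢ Ico 0 T)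
  periodic : ∀ t ∈ Ico 0 T, Function.Periodic (fun x => ρ x t) (2 * Real.pi)
  initial : ∀ x, ρ x 0 = ρ₀ x
  equation : ∀ t ∈ Ico 0 T, ∀ x,
    derivWithin (fun s => ρ x s) (Ico 0 T) t
      + (g * Ha a (fun y => ρ y t) x) * deriv (fun y => ρ y t) x = 0

/-- The solution `ρ` on `[0, T)` can be continued smoothly past time `T`: for some `T' > T` there
is a solution in `C^∞(𝕋 × [0, T'))` with the same data which agrees with `ρ` on `[0, T)`. -/
def CanBeContinued (a g : ℝ) (ρ₀ : ℝ → ℝ) (T : ℝ) (ρ : ℝ → ℝ → ℝ) : Prop :=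
  ∃ T' > T, ∃ ρ' : ℝ → ℝ → ℝ, IsSmoothSolution a g ρ₀ T' ρ' ∧
    ∀ t ∈ Ico 0 T, ∀ x, ρ' x t = ρ x t

theorem integrable_lorentz {a : ℝ} (ha : 0 < a) :
    Integrable (fun y : ℝ => a ^ 2 / (y ^ 2 + a ^ 2)) := by
  have h := integrable_inv_one_add_sq.comp_div ha.ne'
  refine h.congr (Eventually.of_forall fun y => ?_)
  have : y ^ 2 + a ^ 2 ≠ 0 := by positivity
  simp only
  field_simp
  ring

theorem measurable_kernel (a : ℝ) : Measurable (kernel a) := by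
  unfold kernel; fun_prop

theorem abs_kernel_mul (a y : ℝ) (hy : y ≠ 0) :
    |kernel a y| * |y| = 1 / Real.pi * (a ^ 2 / (y ^ 2 + a ^ 2)) := by
  have h : kernel a y * y = 1 / Real.pi * (a ^ 2 / (y ^ 2 + a ^ 2)) := by
    unfold kernel
    rw [show 1 / (Real.pi * y) = 1 / Real.pi * y⁻¹ by rw [one_div, mul_inv, one_div]]
    have := inv_mul_cancel₀ hy
    linear_combination (1 / Real.pi * (a ^ 2 / (y ^ 2 + a ^ 2))) * this
  rw [← abs_mul, h, abs_of_nonneg (by have := Real.pi_pos; positivity)]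

theorem measurableSet_trunc (ε : ℝ) : MeasurableSet {y : ℝ | ε < |y|} :=
  measurableSet_lt measurable_const measurable_id.abs

theorem integrableOn_kernel {a ε : ℝ} (ha : 0 < a) (hε : 0 < ε) :
    IntegrableOn (kernel a) {y : ℝ | ε < |y|} := by
  refine Integrable.mono' (((integrable_lorentz ha).const_mul (1 / Real.pi / ε)).integrableOn)
    (measurable_kernel a).aestronglyMeasurable ?_
  refine (ae_restrict_iff' (measurableSet_trunc ε)).2 (Eventually.of_forall fun y hy => ?_)
  have hy' : ε < |y| := hy
  have h := abs_kernel_mul a y (abs_pos.1 (hε.trans hy'))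
  rw [Real.norm_eq_abs, div_mul_eq_mul_div, le_div_iff₀ hε, ← h]
  exact mul_le_mul_of_nonneg_left hy'.le (abs_nonneg _)

theorem integral_kernel_trunc (a ε : ℝ) : ∫ y in {y : ℝ | ε < |y|}, kernel a y = 0 := by
  rw [← integral_indicator (measurableSet_trunc ε)]
  set F := indicator {y : ℝ | ε < |y|} (kernel a) with hF
  have hodd : ∀ y, F (-y) = - F y := by
    intro y
    by_cases h : ε < |y|
    · simp [hF, h, kernel]
    · simp [hF, h]
  have h1 : ∫ y, F (-y) = ∫ y, F y := integral_neg_eq_self F volume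
  simp only [hodd, integral_neg] at h1
  linarith

theorem exists_lipschitz {f : ℝ → ℝ} (hf : ContDiff ℝ 1 f)
    (hp : Function.Periodic f (2 * Real.pi)) : ∃ L : ℝ, ∀ x y, |f x - f y| ≤ L * |x - y| := by
  have hc : Continuous (deriv f) := hf.continuous_deriv le_rfl
  have hp' : Function.Periodic (deriv f) (2 * Real.pi) := by
    intro x
    rw [← deriv_comp_add_const]
    congr 1
    exact funext hp
  obtain ⟨L, hL⟩ := (isCompact_Icc (a := (0 : ℝ)) (b := 2 * Real.pi)).exists_bound_of_continuousOn
    hc.continuousOn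
  refine ⟨L, fun x y => ?_⟩
  refine Convex.norm_image_sub_le_of_norm_deriv_le (s := univ) (C := L)
    (fun z _ => (hf.differentiable one_ne_zero) z) (fun z _ => ?_) convex_univ
    (mem_univ y) (mem_univ x)
  obtain ⟨w, hw, hzw⟩ := hp'.exists_mem_Ico₀ Real.two_pi_pos z
  rw [hzw]
  exact hL w ⟨hw.1, hw.2.le⟩

/-- The truncated integrals of a `C¹` function of period `2π` are absolutely convergent. -/
theorem integrableOn_trunc {a ε : ℝ} (ha : 0 < a) (hε : 0 < ε) {f : ℝ → ℝ} (hf : ContDiff ℝ 1 f)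
    (hp : Function.Periodic f (2 * Real.pi)) (x : ℝ) :
    IntegrableOn (fun y => f (x - y) * kernel a y) {y : ℝ | ε < |y|} := by
  obtain ⟨M, hM⟩ := (isCompact_Icc (a := (0 : ℝ)) (b := 2 * Real.pi)).exists_bound_of_continuousOn
    hf.continuous.continuousOn
  have hfc := hf.continuous
  refine (integrableOn_kernel ha hε).bdd_mul (c := M)
    (by fun_prop : Continuous fun y => f (x - y)).aestronglyMeasurable
    (Eventually.of_forall fun y => ?_)
  obtain ⟨w, hw, hzw⟩ := hp.exists_mem_Ico₀ Real.two_pi_pos (x - y)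
  rw [hzw]
  exact hM w ⟨hw.1, hw.2.le⟩

/-- The principal value defining `H_a f (x)` exists for `C¹` functions of period `2π`. -/
theorem tendsto_truncHa {a : ℝ} (ha : 0 < a) {f : ℝ → ℝ} (hf : ContDiff ℝ 1 f)
    (hp : Function.Periodic f (2 * Real.pi)) (x : ℝ) :
    Tendsto (truncHa a f x) (𝓝[>] (0 : ℝ)) (𝓝 (Ha a f x)) := by
  apply tendsto_nhds_limUnder
  obtain ⟨L, hL⟩ := exists_lipschitz hf hp
  have hfc := hf.continuous
  have hk := measurable_kernel a
  have hmeas : Measurable (fun y => (f (x - y) - f x) * kernel a y) :=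
    ((by fun_prop : Continuous fun y => f (x - y) - f x).measurable).mul hk
  refine ⟨∫ y, (f (x - y) - f x) * kernel a y, ?_⟩
  have key : ∀ ε > 0, ∫ y, indicator {y : ℝ | ε < |y|} (fun y => (f (x - y) - f x) * kernel a y) y
      = truncHa a f x ε := by
    intro ε hε
    rw [integral_indicator (measurableSet_trunc ε)]
    simp only [sub_mul]
    rw [integral_sub (integrableOn_trunc ha hε hf hp x)
      ((integrableOn_kernel ha hε).const_mul (f x)), integral_const_mul,
      integral_kernel_trunc, mul_zero, sub_zero, truncHa]
  refine Tendsto.congr' (eventually_nhdsWithin_of_forall fun ε hε => key ε hε) ?_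
  refine tendsto_integral_filter_of_dominated_convergence
    (fun y => L * (1 / Real.pi * (a ^ 2 / (y ^ 2 + a ^ 2)))) ?_ ?_ ?_ ?_
  · exact Eventually.of_forall fun ε =>
      (hmeas.indicator (measurableSet_trunc ε)).aestronglyMeasurable
  · refine eventually_nhdsWithin_of_forall fun ε hε => Eventually.of_forall fun y => ?_
    have hL0 : 0 ≤ L := by simpa using (abs_nonneg _).trans (hL 1 0)
    by_cases h : ε < |y|
    · have hy : y ≠ 0 := abs_pos.1 (lt_trans hε h)
      rw [indicator_of_mem (show y ∈ {y : ℝ | ε < |y|} from h), Real.norm_eq_abs, abs_mul,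
        ← abs_kernel_mul a y hy]
      have := hL (x - y) x
      rw [show x - y - x = -y by ring, abs_neg] at this
      calc |f (x - y) - f x| * |kernel a y| ≤ L * |y| * |kernel a y| :=
            mul_le_mul_of_nonneg_right this (abs_nonneg _)
        _ = L * (|kernel a y| * |y|) := by ring
    · rw [indicator_of_notMem (show y ∉ {y : ℝ | ε < |y|} from h), norm_zero]
      have := Real.pi_pos
      positivity
  · exact ((integrable_lorentz ha).const_mul _).const_mul _
  · refine Eventually.of_forall fun y => ?_
    refine tendsto_const_nhds.congr'
      (f₁ := fun _ : ℝ => (f (x - y) - f x) * kernel a y) ?_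
    by_cases hy : y = 0
    · refine Eventually.of_forall fun ε => ?_
      simp only [hy, indicator_apply]
      split_ifs <;> simp
    · filter_upwards [nhdsWithin_le_nhds (Iio_mem_nhds (abs_pos.2 hy))] with ε hε
      have hε' : ε < |y| := hε
      simp [indicator_apply, hε']

end IPM1D

/-!
Expanding the kernel shows that `H_a` is a Fourier multiplier with bounded odd purely imaginary
symbol, so the nonlinearity loses one derivative in form but not in energy: pairing
`u ∂ₓρ` with `ρ` in `H²` leaves only terms controlled by the `H²` norm. Galerkin truncations of the
equation for the Fourier coefficients therefore converge to a smooth solution on a time interval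
whose length depends only on `∫ (∂ₓ²ρ)²`, and the `L²` energy of a difference gives uniqueness.

Consequently it suffices to bound `∫ (∂ₓ²ρ)²` up to time `T` when `∫₀ᵀ ‖∂ₓρ‖_∞` is finite. The
energy identity for `∂ₓ²ρ` involves `‖H_a ∂ₓρ‖_∞`, and splitting the singular integral at distance
`1 / E`, where `E = 1 + ∫ (∂ₓ²ρ)²`, bounds it by a multiple of `1 + ‖∂ₓρ‖_∞ (1 + log E)`. Hence
`1 + log E` satisfies a linear Grönwall inequality with rate a multiple of `1 + ‖∂ₓρ‖_∞`.
-/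

namespace IPM1D

open scoped ComplexConjugate Real

/-! ### Fourier series of smooth periodic functions -/

/-- The Fourier mode `e^{ikx}`, as a function on the line. -/
noncomputable def mode (k : ℤ) (x : ℝ) : ℂ := fourier k (x : AddCircle (2 * π))

theorem mode_eq_exp (k : ℤ) (x : ℝ) : mode k x = Complex.exp (Complex.I * k * x) := by
  have hπ : (π : ℂ) ≠ 0 := by exact_mod_cast Real.pi_ne_zero
  rw [mode, fourier_coe_apply]
  congr 1
  push_cast
  field_simp

theorem norm_mode (k : ℤ) (x : ℝ) : ‖mode k x‖ = 1 := Circle.norm_coe _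

theorem mode_zero (x : ℝ) : mode 0 x = 1 := fourier_zero

theorem mode_add (j k : ℤ) (x : ℝ) : mode (j + k) x = mode j x * mode k x := fourier_add

theorem conj_mode (k : ℤ) (x : ℝ) : conj (mode k x) = mode (-k) x := fourier_neg.symm

theorem mode_add_arg (k : ℤ) (x y : ℝ) : mode k (x + y) = mode k x * mode k y := by
  simp only [mode_eq_exp, ← Complex.exp_add]
  push_cast
  ring_nf

theorem mode_apply_zero (k : ℤ) : mode k 0 = 1 := by simp [mode_eq_exp]

theorem mode_periodic (k : ℤ) : Function.Periodic (mode k) (2 * π) := fun x => by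
  simp only [mode, AddCircle.coe_add_period]

theorem mode_two_pi (k : ℤ) : mode k (2 * π) = 1 := by
  rw [(mode_periodic k).eq, mode_apply_zero]

theorem hasDerivAt_mode (k : ℤ) (x : ℝ) : HasDerivAt (mode k) (Complex.I * k * mode k x) x := by
  have hphase : HasDerivAt (fun y : ℝ => Complex.I * k * (y : ℂ)) (Complex.I * k) x := by
    simpa using (Complex.ofRealCLM.hasDerivAt (x := x)).const_mul (Complex.I * k)
  rw [funext (mode_eq_exp k)]
  exact hphase.cexp.congr_deriv (mul_comm _ _)

theorem continuous_mode (k : ℤ) : Continuous (mode k) :=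
  continuous_iff_continuousAt.2 fun x => (hasDerivAt_mode k x).continuousAt

theorem integral_mode (k : ℤ) :
    ∫ x in (0 : ℝ)..2 * π, mode k x = if k = 0 then 2 * (π : ℂ) else 0 := by
  split_ifs with hk
  · subst hk
    simp [mode_zero]
  · have hIk : Complex.I * (k : ℂ) ≠ 0 := mul_ne_zero Complex.I_ne_zero (by exact_mod_cast hk)
    rw [funext (mode_eq_exp k), integral_exp_mul_complex hIk, ← mode_eq_exp, ← mode_eq_exp,
      mode_two_pi, mode_apply_zero, sub_self, zero_div]

/-- The `k`-th Fourier coefficient `(2π)⁻¹ ∫₀^{2π} f(x) e^{-ikx} dx`. -/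
noncomputable def coef (f : ℝ → ℝ) (k : ℤ) : ℂ :=
  fourierCoeffOn Real.two_pi_pos (fun x => (f x : ℂ)) k

theorem coef_eq_integral (f : ℝ → ℝ) (k : ℤ) :
    coef f k = (2 * π : ℂ)⁻¹ * ∫ x in (0 : ℝ)..2 * π, mode (-k) x * f x := by
  have hperiod : (2 * π - 0 : ℝ) = 2 * π := sub_zero _
  rw [coef, fourierCoeffOn_eq_integral, hperiod]
  simp only [smul_eq_mul, Complex.real_smul, one_div, mode]
  push_cast
  rfl

theorem hasSum_sq_coef {f : ℝ → ℝ} (hf : Continuous f) :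
    HasSum (fun k => ‖coef f k‖ ^ 2) ((2 * π)⁻¹ * ∫ x in (0 : ℝ)..2 * π, f x ^ 2) := by
  have hL2 : MemLp (fun x => (f x : ℂ)) 2 (volume.restrict (Ioc 0 (2 * π))) :=
    (memLp_two_iff_integrable_sq_norm
      (Complex.continuous_ofReal.comp hf).aestronglyMeasurable).2
      ((Complex.continuous_ofReal.comp hf).norm.pow 2).integrableOn_Ioc
  simpa [coef] using hasSum_sq_fourierCoeffOn Real.two_pi_pos hL2

theorem hasSum_coef {f : ℝ → ℝ} (hf : Continuous f) (hp : Function.Periodic f (2 * π))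
    (hs : Summable (coef f)) (x : ℝ) : HasSum (fun k => coef f k * mode k x) (f x : ℂ) := by
  have : Fact (0 < 2 * π) := ⟨Real.two_pi_pos⟩
  have hp' : Function.Periodic (fun x => (f x : ℂ)) (2 * π) := fun x => by
    simp only [hp x]
  let F : C(AddCircle (2 * π), ℂ) :=
    ⟨hp'.lift, continuous_coinduced_dom.2 (Complex.continuous_ofReal.comp hf)⟩
  have hF : fourierCoeff F = coef f := by
    ext k
    rw [fourierCoeff_eq_intervalIntegral F k 0, coef_eq_integral, zero_add, Complex.real_smul]
    push_cast
    rw [one_div]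
    rfl
  have h := has_pointwise_sum_fourier_series_of_summable (hF ▸ hs) (x : AddCircle (2 * π))
  rw [hF] at h
  exact h

theorem norm_coef_le {f : ℝ → ℝ} {M : ℝ} (hM : ∀ x, |f x| ≤ M) (k : ℤ) : ‖coef f k‖ ≤ M := by
  have hint : ‖∫ x in (0 : ℝ)..2 * π, mode (-k) x * f x‖ ≤ M * |2 * π - 0| :=
    intervalIntegral.norm_integral_le_of_norm_le_const fun x _ => by
      simpa [norm_mode] using hM x
  rw [sub_zero, abs_of_pos Real.two_pi_pos, mul_comm M] at hint
  rw [coef_eq_integral, norm_mul, norm_inv,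
    show ‖(2 * π : ℂ)‖ = 2 * π by simp [abs_of_pos Real.pi_pos]]
  exact inv_mul_le_of_le_mul₀ Real.two_pi_pos.le ((abs_nonneg _).trans (hM 0)) hint

theorem coef_deriv {f : ℝ → ℝ} (hf : ContDiff ℝ 1 f) (hp : Function.Periodic f (2 * π))
    (k : ℤ) : coef (deriv f) k = Complex.I * k * coef f k := by
  have hparts := intervalIntegral.integral_mul_deriv_eq_deriv_mul (a := 0) (b := 2 * π)
    (fun x _ => hasDerivAt_mode (-k) x)
    (fun x _ => (hf.differentiable one_ne_zero x).hasDerivAt.ofReal_comp)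
    ((continuous_const.mul (continuous_mode _)).intervalIntegrable _ _)
    ((Complex.continuous_ofReal.comp (hf.continuous_deriv le_rfl)).intervalIntegrable _ _)
  simp only [mode_two_pi, mode_apply_zero, hp.eq, sub_self, zero_sub, mul_assoc,
    intervalIntegral.integral_const_mul] at hparts
  rw [coef_eq_integral, coef_eq_integral, hparts]
  push_cast
  ring

theorem conj_coef (f : ℝ → ℝ) (k : ℤ) : conj (coef f k) = coef f (-k) := by
  simp only [coef_eq_integral, map_mul, intervalIntegral.integral_of_le Real.two_pi_pos.le,
    ← integral_conj, conj_mode, Complex.conj_ofReal, map_inv₀, map_ofNat]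

theorem coef_eq_of_hasSum {f : ℝ → ℝ} {b : ℤ → ℂ} (hb : Summable fun k => ‖b k‖)
    (h : ∀ x, HasSum (fun k => b k * mode k x) (f x : ℂ)) : coef f = b := by
  ext j
  have htermwise : HasSum (fun k => ∫ x in (0 : ℝ)..2 * π, b k * mode (k - j) x)
      (∫ x in (0 : ℝ)..2 * π, mode (-j) x * f x) := by
    refine intervalIntegral.hasSum_integral_of_dominated_convergence (fun k _ => ‖b k‖)
      (fun k => (continuous_const.mul (continuous_mode _)).aestronglyMeasurable)
      (fun k => Eventually.of_forall fun x _ => by rw [norm_mul, norm_mode, mul_one])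
      (Eventually.of_forall fun x _ => hb) (continuous_const.intervalIntegrable _ _)
      (Eventually.of_forall fun x _ => ?_)
    refine ((h x).mul_left (mode (-j) x)).congr_fun fun k => ?_
    rw [sub_eq_add_neg, mode_add]
    ring
  have horthogonal : HasSum (fun k => ∫ x in (0 : ℝ)..2 * π, b k * mode (k - j) x)
      (2 * π * b j) := by
    convert hasSum_ite_eq j (2 * (π : ℂ) * b j) using 2 with k
    rw [intervalIntegral.integral_const_mul, integral_mode]
    by_cases hk : k = j
    · subst hk; simp [mul_comm]
    · simp [hk, sub_eq_zero]
  have hπ : (2 * π : ℂ) ≠ 0 := by exact_mod_cast Real.two_pi_pos.ne'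
  rw [coef_eq_integral, htermwise.unique horthogonal, inv_mul_cancel_left₀ hπ]

namespace SmoothPeriodic

variable {f : ℝ → ℝ}

theorem deriv (hf : SmoothPeriodic f) : SmoothPeriodic (deriv f) :=
  ⟨(contDiff_infty_iff_deriv.1 hf.1).2, fun x => by
    rw [← deriv_comp_add_const, funext hf.2]⟩

theorem contDiff_one (hf : SmoothPeriodic f) : ContDiff ℝ 1 f :=
  hf.1.of_le (by exact_mod_cast le_top)

theorem continuous (hf : SmoothPeriodic f) : Continuous f :=
  hf.1.continuous

theorem hasDerivAt (hf : SmoothPeriodic f) (x : ℝ) : HasDerivAt f (_root_.deriv f x) x :=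
  (hf.contDiff_one.differentiable one_ne_zero x).hasDerivAt

theorem exists_abs_le (hf : SmoothPeriodic f) : ∃ M, ∀ x, |f x| ≤ M := by
  obtain ⟨M, hM⟩ := isBounded_iff_forall_norm_le.1
    (hf.2.isBounded_of_continuous Real.two_pi_pos.ne' hf.continuous)
  exact ⟨M, fun x => hM _ (mem_range_self x)⟩

theorem exists_pow_mul_norm_coef_le (hf : SmoothPeriodic f) (s : ℕ) :
    ∃ B, ∀ k : ℤ, |(k : ℝ)| ^ s * ‖coef f k‖ ≤ B := by
  induction s generalizing f with
  | zero =>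
    obtain ⟨M, hM⟩ := hf.exists_abs_le
    exact ⟨M, fun k => by simpa using norm_coef_le hM k⟩
  | succ s ih =>
    obtain ⟨B, hB⟩ := ih hf.deriv
    refine ⟨B, fun k => (le_of_eq ?_).trans (hB k)⟩
    rw [coef_deriv hf.contDiff_one hf.2, norm_mul, norm_mul, Complex.norm_I, one_mul,
      Complex.norm_intCast, ← mul_assoc, pow_succ]

end SmoothPeriodic

/-- The summable weight `(1 + k²)⁻¹` on the frequencies. -/
noncomputable def weight (k : ℤ) : ℝ := 1 / (1 + (k : ℝ) ^ 2)

theorem weight_pos (k : ℤ) : 0 < weight k := by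
  unfold weight
  positivity

theorem summable_weight : Summable weight := by
  refine Summable.of_norm_bounded_eventually
    ((Real.summable_one_div_int_pow (p := 2)).2 one_lt_two) ?_
  filter_upwards [eventually_cofinite_ne (0 : ℤ)] with k hk
  have hk' : (0 : ℝ) < (k : ℝ) ^ 2 := by positivity
  rw [Real.norm_eq_abs, abs_of_pos (weight_pos k), weight]
  exact one_div_le_one_div_of_le hk' (by linarith)

/-- The total mass `∑ₖ (1 + k²)⁻¹` of the weight. -/
noncomputable def weightSum : ℝ := ∑' k, weight k

theorem weightSum_nonneg : 0 ≤ weightSum := tsum_nonneg fun k => (weight_pos k).le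

/-- Rapid decay of a family of Fourier coefficients, with explicit constants: `B s` bounds
`|k|ˢ ‖b k‖` uniformly in `k`. Keeping the constants visible lets one speak of decay that is uniform
in a parameter such as time. -/
def Decay (B : ℕ → ℝ) (b : ℤ → ℂ) : Prop := ∀ (s : ℕ) (k : ℤ), |(k : ℝ)| ^ s * ‖b k‖ ≤ B s

theorem SmoothPeriodic.exists_decay {f : ℝ → ℝ} (hf : SmoothPeriodic f) :
    ∃ B, Decay B (coef f) := by
  choose B hB using hf.exists_pow_mul_norm_coef_le
  exact ⟨B, hB⟩

namespace Decay

variable {B D : ℕ → ℝ} {b d : ℤ → ℂ}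

theorem le_weight (h : Decay B b) (s : ℕ) (k : ℤ) :
    |(k : ℝ)| ^ s * ‖b k‖ ≤ (B s + B (s + 2)) * weight k := by
  have h1 := h s k
  have h2 := h (s + 2) k
  rw [pow_add, sq_abs] at h2
  rw [weight, mul_one_div, le_div_iff₀ (by positivity)]
  linarith

theorem norm_le_weight (h : Decay B b) (k : ℤ) : ‖b k‖ ≤ (B 0 + B 2) * weight k := by
  simpa using h.le_weight 0 k

theorem summable_norm (h : Decay B b) : Summable fun k : ℤ => ‖b k‖ :=
  (summable_weight.mul_left _).of_nonneg_of_le (fun _ => norm_nonneg _) h.norm_le_weight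

theorem summable_mode (h : Decay B b) (x : ℝ) : Summable fun k : ℤ => b k * mode k x :=
  Summable.of_norm (by simpa only [norm_mul, norm_mode, mul_one] using h.summable_norm)

theorem mul_left (h : Decay B b) {m : ℤ → ℂ} {C : ℝ} (hm : ∀ k, ‖m k‖ ≤ C) :
    Decay (fun s => C * B s) fun k => m k * b k := by
  intro s k
  calc |(k : ℝ)| ^ s * ‖m k * b k‖ = ‖m k‖ * (|(k : ℝ)| ^ s * ‖b k‖) := by
        rw [norm_mul]
        ring
    _ ≤ C * B s := mul_le_mul (hm k) (h s k) (by positivity) ((norm_nonneg _).trans (hm k))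

theorem deriv (h : Decay B b) : Decay (fun s => B (s + 1)) fun k => Complex.I * k * b k := by
  intro s k
  rw [norm_mul, norm_mul, Complex.norm_I, one_mul, Complex.norm_intCast, ← mul_assoc, ← pow_succ]
  exact h (s + 1) k

theorem add (hb : Decay B b) (hd : Decay D d) :
    Decay (fun s => B s + D s) fun k => b k + d k := by
  intro s k
  calc |(k : ℝ)| ^ s * ‖b k + d k‖ ≤ |(k : ℝ)| ^ s * (‖b k‖ + ‖d k‖) := by
        gcongr
        exact norm_add_le _ _
    _ ≤ B s + D s := by
        rw [mul_add]
        exact add_le_add (hb s k) (hd s k)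

theorem hasDerivAt_tsum (h : Decay B b) (x : ℝ) :
    HasDerivAt (fun x => ∑' k, b k * mode k x) (∑' k : ℤ, (Complex.I * k * b k) * mode k x) x :=
  _root_.hasDerivAt_tsum (u := fun k => ‖Complex.I * k * b k‖)
    (g' := fun k y => (Complex.I * k * b k) * mode k y) h.deriv.summable_norm
    (fun k y => ((hasDerivAt_mode k y).const_mul (b k)).congr_deriv (by ring))
    (fun k y => by rw [norm_mul _ (mode k y), norm_mode, mul_one]) (y₀ := 0) (h.summable_mode 0) x

theorem contDiff_tsum (h : Decay B b) : ContDiff ℝ ∞ (fun x => ∑' k, b k * mode k x) := by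
  refine contDiff_infty.2 fun n => ?_
  induction n generalizing B b with
  | zero =>
    exact contDiff_zero.2 (continuous_iff_continuousAt.2 fun x =>
      (h.hasDerivAt_tsum x).continuousAt)
  | succ n ih =>
    rw [Nat.cast_add, Nat.cast_one, contDiff_succ_iff_deriv]
    refine ⟨fun x => (h.hasDerivAt_tsum x).differentiableAt, by simp, ?_⟩
    rw [show _root_.deriv (fun x => ∑' k, b k * mode k x) = _ from
      funext fun x => (h.hasDerivAt_tsum x).deriv]
    exact ih h.deriv

theorem smoothPeriodic_of_hasSum (h : Decay B b) {f : ℝ → ℝ}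
    (hf : ∀ x, HasSum (fun k => b k * mode k x) (f x : ℂ)) : SmoothPeriodic f := by
  have hre : f = fun x => Complex.reCLM (∑' k, b k * mode k x) := by
    ext x
    rw [(hf x).tsum_eq, Complex.reCLM_apply, Complex.ofReal_re]
  rw [hre]
  exact ⟨Complex.reCLM.contDiff.comp h.contDiff_tsum, fun x => by simp only [mode_periodic _ x]⟩

theorem hasSum_deriv (h : Decay B b) {f : ℝ → ℝ}
    (hf : ∀ x, HasSum (fun k => b k * mode k x) (f x : ℂ)) (x : ℝ) :
    HasSum (fun k : ℤ => (Complex.I * k * b k) * mode k x) ((_root_.deriv f x : ℝ) : ℂ) := by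
  have hseries := h.hasDerivAt_tsum x
  rw [show (fun x => ∑' k, b k * mode k x) = fun x => (f x : ℂ) from
    funext fun x => (hf x).tsum_eq] at hseries
  rw [((h.smoothPeriodic_of_hasSum hf).hasDerivAt x).ofReal_comp.unique hseries]
  exact (h.deriv.summable_mode x).hasSum

end Decay

theorem SmoothPeriodic.hasSum_coef {f : ℝ → ℝ} (hf : SmoothPeriodic f) (x : ℝ) :
    HasSum (fun k => coef f k * mode k x) (f x : ℂ) := by
  obtain ⟨B, hB⟩ := hf.exists_decay
  exact IPM1D.hasSum_coef hf.continuous hf.2 hB.summable_norm.of_norm x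

/-! ### The Fourier multiplier of `H_a` -/

section Kernel

variable {a y : ℝ}

theorem kernel_pos (ha : 0 < a) (hy : 0 < y) : 0 < kernel a y := by
  unfold kernel
  positivity

theorem mul_kernel (a : ℝ) (hy : y ≠ 0) : y * kernel a y = 1 / π * (a ^ 2 / (y ^ 2 + a ^ 2)) := by
  unfold kernel
  field_simp

theorem mul_kernel_le (ha : 0 < a) (hy : 0 < y) : y * kernel a y ≤ 1 / π := by
  rw [mul_kernel a hy.ne']
  refine mul_le_of_le_one_right (by positivity) ?_
  rw [div_le_one (by positivity)]
  nlinarith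

theorem hasDerivAt_kernel (ha : 0 < a) (hy : 0 < y) :
    HasDerivAt (kernel a) (-(a ^ 2 * (3 * y ^ 2 + a ^ 2) / (π * (y * (y ^ 2 + a ^ 2)) ^ 2))) y := by
  have hden : HasDerivAt (fun y : ℝ => π * (y * (y ^ 2 + a ^ 2))) (π * (3 * y ^ 2 + a ^ 2)) y := by
    refine (((hasDerivAt_id y).mul (((hasDerivAt_id y).pow 2).add_const (a ^ 2))).const_mul
      π).congr_deriv ?_
    simp
    ring
  have hkernel : kernel a = (fun _ => a ^ 2) / fun y : ℝ => π * (y * (y ^ 2 + a ^ 2)) := by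
    ext z
    simp only [kernel, Pi.div_apply]
    rw [div_mul_div_comm, one_mul, mul_assoc]
  rw [hkernel]
  refine ((hasDerivAt_const y (a ^ 2)).div hden (by positivity)).congr_deriv ?_
  field_simp
  ring

theorem tendsto_kernel_atTop (ha : 0 < a) : Tendsto (kernel a) atTop (𝓝 0) := by
  refine squeeze_zero' (g := fun y => 1 / π * y⁻¹) ?_ ?_ ?_
  · filter_upwards [eventually_gt_atTop 0] with y hy using (kernel_pos ha hy).le
  · filter_upwards [eventually_gt_atTop 0] with y hy
    rw [← div_eq_mul_inv, le_div_iff₀ hy, mul_comm]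
    exact mul_kernel_le ha hy
  · simpa using (tendsto_inv_atTop_zero (𝕜 := ℝ)).const_mul (1 / π)

theorem mul_kernel_le_of_le_mul (ha : 0 < a) (hy : 0 < y) {r C : ℝ} (hr : r ≤ C * y) :
    r * kernel a y ≤ C * (1 / π) * (a ^ 2 / (y ^ 2 + a ^ 2)) :=
  calc r * kernel a y ≤ C * y * kernel a y :=
        mul_le_mul_of_nonneg_right hr (kernel_pos ha hy).le
    _ = C * (1 / π) * (a ^ 2 / (y ^ 2 + a ^ 2)) := by
        rw [mul_assoc, mul_kernel a hy.ne', mul_assoc]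

theorem integrableOn_mul_kernel (ha : 0 < a) {h : ℝ → ℝ} {C : ℝ} (hh : Continuous h)
    (hC : ∀ y > 0, |h y| ≤ C * y) : IntegrableOn (fun y => h y * kernel a y) (Ioi 0) := by
  refine Integrable.mono' (((integrable_lorentz ha).const_mul (C * (1 / π))).integrableOn)
    (hh.measurable.mul (measurable_kernel a)).aestronglyMeasurable ?_
  refine ae_restrict_of_forall_mem measurableSet_Ioi fun y (hy : 0 < y) => ?_
  rw [Real.norm_eq_abs, abs_mul, abs_of_pos (kernel_pos ha hy)]
  exact mul_kernel_le_of_le_mul ha hy (hC y hy)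

theorem abs_sin_mul_le {κ : ℝ} (hκ : 0 < κ) (hy : 0 < y) : |Real.sin (κ * y)| ≤ κ * y :=
  Real.abs_sin_le_abs.trans_eq (abs_of_pos (mul_pos hκ hy))

theorem integrableOn_sin_mul_kernel {κ : ℝ} (ha : 0 < a) (hκ : 0 < κ) :
    IntegrableOn (fun y => Real.sin (κ * y) * kernel a y) (Ioi 0) :=
  integrableOn_mul_kernel ha (by fun_prop) fun _ hy => abs_sin_mul_le hκ hy

end Kernel

theorem abs_cos_mul_div_le {κ : ℝ} (hκ : 0 < κ) (y : ℝ) : |-Real.cos (κ * y) / κ| ≤ 1 / κ := by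
  rw [abs_div, abs_neg, abs_of_pos hκ]
  exact div_le_div_of_nonneg_right (Real.abs_cos_le_one _) hκ.le

theorem hasDerivAt_neg_cos_mul_div {κ : ℝ} (hκ : κ ≠ 0) (y : ℝ) :
    HasDerivAt (fun y => -Real.cos (κ * y) / κ) (Real.sin (κ * y)) y := by
  refine ((((hasDerivAt_id y).const_mul κ).cos.neg).div_const κ).congr_deriv ?_
  simp only [mul_one, neg_mul, neg_neg, id]
  field_simp

/-- Integrate by parts against the monotone amplitude `K`. -/
theorem abs_integral_Ioi_sin_mul_le {K K' : ℝ → ℝ} {c κ : ℝ} (hκ : 0 < κ)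
    (hK : ∀ y ∈ Ici c, HasDerivAt K (K' y) y) (hK' : ∀ y ∈ Ioi c, K' y ≤ 0)
    (hlim : Tendsto K atTop (𝓝 0))
    (hint : IntegrableOn (fun y => Real.sin (κ * y) * K y) (Ioi c)) :
    |∫ y in Ioi c, Real.sin (κ * y) * K y| ≤ 2 * (K c * (1 / κ)) := by
  set v : ℝ → ℝ := fun y => -Real.cos (κ * y) / κ
  have hv_le (y : ℝ) : |v y| ≤ 1 / κ := abs_cos_mul_div_le hκ y
  have hv_cont : Continuous v := by fun_prop
  have hK'_int : IntegrableOn K' (Ioi c) := integrableOn_Ioi_deriv_of_nonpos' hK hK' hlim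
  have hK'_integral : ∫ y in Ioi c, K' y = 0 - K c :=
    integral_Ioi_of_hasDerivAt_of_nonpos' hK hK' hlim
  have hK'v : |∫ y in Ioi c, K' y * v y| ≤ K c * (1 / κ) := by
    have h := norm_integral_le_of_norm_le (μ := volume.restrict (Ioi c)) (f := fun y => K' y * v y)
      (hK'_int.neg.mul_const (1 / κ)) (ae_restrict_of_forall_mem measurableSet_Ioi fun y hy => by
        rw [Real.norm_eq_abs, abs_mul, abs_of_nonpos (hK' y hy)]
        exact mul_le_mul_of_nonneg_left (hv_le y) (neg_nonneg.2 (hK' y hy)))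
    simpa only [Pi.neg_apply, integral_mul_const, integral_neg, hK'_integral, zero_sub, neg_neg,
      Real.norm_eq_abs] using h
  have hKc : 0 ≤ K c := by
    have h := setIntegral_nonpos (μ := volume) measurableSet_Ioi hK'
    linarith
  have hboundary : |K c * v c| ≤ K c * (1 / κ) := by
    rw [abs_mul, abs_of_nonneg hKc]
    exact mul_le_mul_of_nonneg_left (hv_le c) hKc
  have hlim_v : Tendsto (K * v) atTop (𝓝 0) := by
    refine squeeze_zero_norm (a := fun y => |K y| * (1 / κ)) (fun y => ?_)
      (by simpa using hlim.abs.mul_const (1 / κ))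
    rw [Pi.mul_apply, norm_mul]
    exact mul_le_mul_of_nonneg_left (hv_le y) (abs_nonneg _)
  have hparts : ∫ y in Ioi c, K y * Real.sin (κ * y) = 0 - K c * v c - ∫ y in Ioi c, K' y * v y :=
    integral_Ioi_mul_deriv_eq_deriv_mul (fun y hy => hK y (Ioi_subset_Ici_self hy))
      (fun y _ => hasDerivAt_neg_cos_mul_div hκ.ne' y)
      (hint.congr_fun (fun y _ => mul_comm _ _) measurableSet_Ioi)
      (hK'_int.mul_bdd hv_cont.aestronglyMeasurable (Eventually.of_forall hv_le))
      (((hK c self_mem_Ici).continuousAt.mul hv_cont.continuousAt).tendsto.mono_left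
        nhdsWithin_le_nhds) hlim_v
  simp only [mul_comm (Real.sin _)]
  rw [hparts, zero_sub, ← neg_add', abs_neg, two_mul]
  exact (abs_add_le _ _).trans (add_le_add hboundary hK'v)

theorem abs_integral_Ioc_sin_mul_kernel_le {a κ : ℝ} (ha : 0 < a) (hκ : 0 < κ) :
    |∫ y in Ioc 0 (1 / κ), Real.sin (κ * y) * kernel a y| ≤ 1 / π := by
  have h := norm_setIntegral_le_of_norm_le_const (μ := volume) (s := Ioc 0 (1 / κ))
    (f := fun y => Real.sin (κ * y) * kernel a y) (C := κ * (1 / π)) (by simp) fun y hy => by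
      rw [Real.norm_eq_abs, abs_mul, abs_of_pos (kernel_pos ha hy.1)]
      calc |Real.sin (κ * y)| * kernel a y ≤ κ * y * kernel a y :=
            mul_le_mul_of_nonneg_right (abs_sin_mul_le hκ hy.1) (kernel_pos ha hy.1).le
        _ = κ * (y * kernel a y) := mul_assoc _ _ _
        _ ≤ κ * (1 / π) := mul_le_mul_of_nonneg_left (mul_kernel_le ha hy.1) hκ.le
  refine h.trans_eq ?_
  rw [Real.volume_real_Ioc_of_le (by positivity)]
  field_simp
  ring

/-- Split at `y = 1 / κ`: below, the sine cancels the singularity; above, it oscillates. -/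
theorem abs_integral_sin_mul_kernel_le {a κ : ℝ} (ha : 0 < a) (hκ : 0 < κ) :
    |∫ y in Ioi 0, Real.sin (κ * y) * kernel a y| ≤ 3 / π := by
  have hκ' : 0 < 1 / κ := by positivity
  have hint := integrableOn_sin_mul_kernel ha hκ
  have hint_far := hint.mono_set (Ioi_subset_Ioi hκ'.le)
  have hfar := abs_integral_Ioi_sin_mul_le hκ (fun y hy => hasDerivAt_kernel ha (hκ'.trans_le hy))
    (fun y _ => neg_nonpos.2 (by positivity)) (tendsto_kernel_atTop ha) hint_far
  have hend : kernel a (1 / κ) * (1 / κ) ≤ 1 / π := by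
    rw [mul_comm]
    exact mul_kernel_le ha hκ'
  rw [← Ioc_union_Ioi_eq_Ioi hκ'.le, setIntegral_union (Ioc_disjoint_Ioi_same) measurableSet_Ioi
    (hint.mono_set Ioc_subset_Ioi_self) hint_far]
  calc _ ≤ _ := abs_add_le _ _
    _ ≤ 1 / π + 2 * (1 / π) := add_le_add (abs_integral_Ioc_sin_mul_kernel_le ha hκ)
        (hfar.trans (mul_le_mul_of_nonneg_left hend two_pos.le))
    _ = 3 / π := by ring

/-- The Fourier multiplier of `H_a`, i.e. `H_a e^{ikx} = multiplier a k * e^{ikx}`. -/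
noncomputable def multiplier (a : ℝ) (k : ℤ) : ℂ :=
  ∫ y in Ioi (0 : ℝ), (mode k (-y) - mode k y) * kernel a y

theorem mode_neg_sub_mode (k : ℤ) (y : ℝ) :
    mode k (-y) - mode k y = -2 * Complex.I * Real.sin (k * y) := by
  have hneg : Complex.I * k * ((-y : ℝ) : ℂ) = -((k * y : ℝ) : ℂ) * Complex.I := by
    push_cast
    ring
  have hpos : Complex.I * k * (y : ℂ) = ((k * y : ℝ) : ℂ) * Complex.I := by
    push_cast
    ring
  rw [mode_eq_exp, mode_eq_exp, hneg, hpos, Complex.exp_mul_I, Complex.exp_mul_I, Complex.cos_neg,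
    Complex.sin_neg, Complex.ofReal_sin]
  ring

theorem multiplier_eq (a : ℝ) (k : ℤ) : multiplier a k =
    -2 * Complex.I * ((∫ y in Ioi (0 : ℝ), Real.sin (k * y) * kernel a y : ℝ) : ℂ) := by
  rw [multiplier, ← integral_complex_ofReal, ← integral_const_mul]
  simp only [mode_neg_sub_mode, Complex.ofReal_mul, mul_assoc]

theorem norm_multiplier_le {a : ℝ} (ha : 0 < a) (k : ℤ) : ‖multiplier a k‖ ≤ 2 := by
  have hsine : |∫ y in Ioi (0 : ℝ), Real.sin (k * y) * kernel a y| ≤ 3 / π := by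
    rcases lt_trichotomy k 0 with hk | hk | hk
    · have hk' : (0 : ℝ) < -k := by simpa using hk
      simpa only [neg_mul, Real.sin_neg, integral_neg, abs_neg]
        using abs_integral_sin_mul_kernel_le ha hk'
    · subst hk
      simpa using by positivity
    · exact abs_integral_sin_mul_kernel_le ha (by exact_mod_cast hk)
  have hπ : 3 / π ≤ 1 := (div_le_one Real.pi_pos).2 Real.pi_gt_three.le
  rw [multiplier_eq, norm_mul, norm_mul, norm_neg, Complex.norm_I, Complex.norm_real,
    Real.norm_eq_abs, Complex.norm_ofNat]
  linarith

section HaIntegral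

variable {a : ℝ} {f : ℝ → ℝ}

theorem integrableOn_sub_mul_kernel (ha : 0 < a) (hf : ContDiff ℝ 1 f)
    (hp : Function.Periodic f (2 * π)) (x : ℝ) :
    IntegrableOn (fun y => (f (x - y) - f (x + y)) * kernel a y) (Ioi 0) := by
  obtain ⟨L, hL⟩ := exists_lipschitz hf hp
  have hfc := hf.continuous
  refine integrableOn_mul_kernel (C := 2 * L) ha (by fun_prop) fun y hy => ?_
  calc |f (x - y) - f (x + y)| ≤ L * |(x - y) - (x + y)| := hL _ _
    _ = 2 * L * y := by
        rw [show x - y - (x + y) = -(2 * y) by ring, abs_neg, abs_of_pos (by positivity)]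
        ring

theorem setOf_lt_abs_eq_union (ε : ℝ) : {y : ℝ | ε < |y|} = Iio (-ε) ∪ Ioi ε := by
  ext y
  simp only [mem_ofPred_eq, mem_union, mem_Iio, mem_Ioi, lt_abs, lt_neg, or_comm]

theorem truncHa_eq_setIntegral (ha : 0 < a) (hf : ContDiff ℝ 1 f)
    (hp : Function.Periodic f (2 * π)) (x : ℝ) {ε : ℝ} (hε : 0 < ε) :
    truncHa a f x ε = ∫ y in Ioi ε, (f (x - y) - f (x + y)) * kernel a y := by
  have hint := integrableOn_trunc ha hε hf hp x
  rw [setOf_lt_abs_eq_union] at hint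
  have hdisjoint : Disjoint (Iio (-ε)) (Ioi ε) :=
    (Iio_disjoint_Ici (by linarith)).mono_right Ioi_subset_Ici_self
  have hsub : IntegrableOn (fun y => (f (x - y) - f (x + y)) * kernel a y) (Ioi ε) :=
    (integrableOn_sub_mul_kernel ha hf hp x).mono_set (Ioi_subset_Ioi hε.le)
  have hadd : IntegrableOn (fun y => f (x + y) * kernel a y) (Ioi ε) :=
    (hint.right_of_union.sub hsub).congr_fun (fun y _ => by simp only [Pi.sub_apply]; ring)
      measurableSet_Ioi
  have hreflect : ∫ y in Iio (-ε), f (x - y) * kernel a y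
      = ∫ y in Ioi ε, -(f (x + y) * kernel a y) := by
    rw [← integral_Iic_eq_integral_Iio, ← integral_comp_neg_Ioi]
    simp [kernel]
  rw [truncHa, setOf_lt_abs_eq_union, setIntegral_union hdisjoint measurableSet_Ioi
    hint.left_of_union hint.right_of_union, hreflect, add_comm, integral_neg, ← sub_eq_add_neg,
    ← integral_sub hint.right_of_union hadd]
  simp only [sub_mul]

theorem Ha_eq_integral (ha : 0 < a) (hf : ContDiff ℝ 1 f) (hp : Function.Periodic f (2 * π))
    (x : ℝ) : Ha a f x = ∫ y in Ioi 0, (f (x - y) - f (x + y)) * kernel a y := by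
  refine tendsto_nhds_unique (tendsto_truncHa ha hf hp x) ?_
  have hcover : AECover (volume.restrict (Ioi (0 : ℝ))) (𝓝[>] 0) fun ε : ℝ => Ioi ε :=
    aecover_Ioi_of_Ioi (tendsto_id.mono_left nhdsWithin_le_nhds)
  refine (hcover.integral_tendsto_of_countably_generated
    (integrableOn_sub_mul_kernel ha hf hp x)).congr'
      (eventually_nhdsWithin_of_forall fun ε (hε : 0 < ε) => ?_)
  rw [Measure.restrict_restrict measurableSet_Ioi, inter_eq_left.2 (Ioi_subset_Ioi hε.le),
    truncHa_eq_setIntegral ha hf hp x hε]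

end HaIntegral

theorem mode_sub_arg_sub_mode_add_arg (k : ℤ) (x y : ℝ) :
    mode k (x - y) - mode k (x + y) = mode k x * (mode k (-y) - mode k y) := by
  rw [sub_eq_add_neg x, mode_add_arg, mode_add_arg, mul_sub]

theorem norm_mode_sub_mode_le (k : ℤ) (x y : ℝ) :
    ‖mode k (x - y) - mode k (x + y)‖ ≤ 2 * |(k : ℝ)| * |y| := by
  rw [mode_sub_arg_sub_mode_add_arg, norm_mul, norm_mode, one_mul, mode_neg_sub_mode, norm_mul,
    norm_mul, norm_neg, Complex.norm_I, Complex.norm_real, Real.norm_eq_abs, Complex.norm_ofNat,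
    mul_one, mul_assoc, ← abs_mul]
  exact mul_le_mul_of_nonneg_left Real.abs_sin_le_abs two_pos.le

theorem norm_coeff_mul_mode_sub_mul_kernel_le {a : ℝ} (ha : 0 < a) (c : ℂ) (k : ℤ) (x : ℝ) {y : ℝ}
    (hy : 0 < y) : ‖c * (mode k (x - y) - mode k (x + y)) * kernel a y‖
      ≤ 2 / π * ‖Complex.I * k * c‖ * (a ^ 2 / (y ^ 2 + a ^ 2)) := by
  have hosc : ‖c‖ * ‖mode k (x - y) - mode k (x + y)‖ ≤ ‖c‖ * (2 * |(k : ℝ)|) * y := by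
    rw [mul_assoc ‖c‖]
    refine mul_le_mul_of_nonneg_left ?_ (norm_nonneg c)
    simpa only [abs_of_pos hy] using norm_mode_sub_mode_le k x y
  rw [norm_mul, norm_mul, Complex.norm_real, Real.norm_eq_abs, abs_of_pos (kernel_pos ha hy)]
  refine (mul_kernel_le_of_le_mul ha hy hosc).trans_eq ?_
  rw [norm_mul, norm_mul, Complex.norm_I, Complex.norm_intCast]
  ring

theorem Decay.hasSum_Ha {a : ℝ} (ha : 0 < a) {B : ℕ → ℝ} {b : ℤ → ℂ} (h : Decay B b) {f : ℝ → ℝ}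
    (hf : ∀ x, HasSum (fun k => b k * mode k x) (f x : ℂ)) (x : ℝ) :
    HasSum (fun k => (multiplier a k * b k) * mode k x) (Ha a f x : ℂ) := by
  have hfs := h.smoothPeriodic_of_hasSum hf
  let F (k : ℤ) (y : ℝ) : ℂ := b k * (mode k (x - y) - mode k (x + y)) * kernel a y
  have hlor : Integrable (fun y : ℝ => a ^ 2 / (y ^ 2 + a ^ 2)) (volume.restrict (Ioi 0)) :=
    (integrable_lorentz ha).integrableOn
  have hF_le (k : ℤ) : ∀ᵐ y ∂volume.restrict (Ioi (0 : ℝ)),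
      ‖F k y‖ ≤ 2 / π * ‖Complex.I * k * b k‖ * (a ^ 2 / (y ^ 2 + a ^ 2)) :=
    ae_restrict_of_forall_mem measurableSet_Ioi fun y hy =>
      norm_coeff_mul_mode_sub_mul_kernel_le ha (b k) k x hy
  have hF_int (k : ℤ) : Integrable (F k) (volume.restrict (Ioi 0)) := by
    have hcont : Continuous fun y : ℝ => b k * (mode k (x - y) - mode k (x + y)) := by
      have := continuous_mode k
      fun_prop
    exact (hlor.const_mul _).mono' (hcont.measurable.mul (Complex.measurable_ofReal.comp
      (measurable_kernel a))).aestronglyMeasurable (hF_le k)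
  have hsummable : Summable fun k => ∫ y in Ioi (0 : ℝ), ‖F k y‖ := by
    refine ((h.deriv.summable_norm.mul_left (2 / π)).mul_right
      (∫ y in Ioi (0 : ℝ), a ^ 2 / (y ^ 2 + a ^ 2))).of_nonneg_of_le
        (fun k => integral_nonneg fun y => norm_nonneg _) fun k => ?_
    rw [← integral_const_mul]
    exact integral_mono_ae (hF_int k).norm (hlor.const_mul _) (hF_le k)
  have hterm (k : ℤ) : ∫ y in Ioi (0 : ℝ), F k y = (multiplier a k * b k) * mode k x := by
    rw [multiplier, mul_assoc, mul_comm _ (b k * mode k x), ← integral_const_mul]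
    simp only [F, mode_sub_arg_sub_mode_add_arg, mul_assoc]
  have htotal : ∫ y in Ioi (0 : ℝ), ∑' k, F k y = (Ha a f x : ℂ) := by
    rw [Ha_eq_integral ha hfs.contDiff_one hfs.2 x, ← integral_complex_ofReal]
    refine integral_congr_ae (Eventually.of_forall fun y => ?_)
    have hF := ((hf (x - y)).sub (hf (x + y))).mul_right (kernel a y : ℂ)
    simp only [← mul_sub] at hF
    simp only [F, hF.tsum_eq, Complex.ofReal_mul, Complex.ofReal_sub]
  simpa only [hterm, htotal] using hasSum_integral_of_summable_integral_norm hF_int hsummable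

namespace SmoothPeriodic

variable {a : ℝ} {f : ℝ → ℝ}

theorem hasSum_Ha (ha : 0 < a) (hf : SmoothPeriodic f) (x : ℝ) :
    HasSum (fun k => (multiplier a k * coef f k) * mode k x) (Ha a f x : ℂ) := by
  obtain ⟨B, hB⟩ := hf.exists_decay
  exact hB.hasSum_Ha ha hf.hasSum_coef x

theorem Ha (ha : 0 < a) (hf : SmoothPeriodic f) : SmoothPeriodic (Ha a f) := by
  obtain ⟨B, hB⟩ := hf.exists_decay
  exact (hB.mul_left (norm_multiplier_le ha)).smoothPeriodic_of_hasSum (hf.hasSum_Ha ha)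

theorem coef_Ha (ha : 0 < a) (hf : SmoothPeriodic f) :
    coef (IPM1D.Ha a f) = fun k => multiplier a k * coef f k := by
  obtain ⟨B, hB⟩ := hf.exists_decay
  exact coef_eq_of_hasSum (hB.mul_left (norm_multiplier_le ha)).summable_norm (hf.hasSum_Ha ha)

theorem deriv_Ha (ha : 0 < a) (hf : SmoothPeriodic f) :
    _root_.deriv (IPM1D.Ha a f) = IPM1D.Ha a (_root_.deriv f) := by
  ext x
  obtain ⟨B, hB⟩ := hf.exists_decay
  have hleft := (hB.mul_left (norm_multiplier_le ha)).hasSum_deriv (hf.hasSum_Ha ha) x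
  have hright := hf.deriv.hasSum_Ha ha x
  simp only [coef_deriv hf.contDiff_one hf.2, mul_left_comm (multiplier a _)] at hright
  exact_mod_cast hleft.unique hright

theorem integral_Ha_sq_le (ha : 0 < a) (hf : SmoothPeriodic f) :
    ∫ x in (0 : ℝ)..2 * π, IPM1D.Ha a f x ^ 2 ≤ 4 * ∫ x in (0 : ℝ)..2 * π, f x ^ 2 := by
  have hparseval_Ha := hasSum_sq_coef (hf.Ha ha).continuous
  have hparseval := (hasSum_sq_coef hf.continuous).mul_left 4
  rw [hf.coef_Ha ha] at hparseval_Ha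
  rw [mul_left_comm] at hparseval
  refine le_of_mul_le_mul_left (hasSum_le (fun k => ?_) hparseval_Ha hparseval)
    (inv_pos.2 Real.two_pi_pos)
  rw [norm_mul, mul_pow]
  refine mul_le_mul_of_nonneg_right ?_ (by positivity)
  exact (pow_le_pow_left₀ (norm_nonneg _) (norm_multiplier_le ha k) 2).trans_eq (by norm_num)

theorem sub {f₁ f₂ : ℝ → ℝ} (h₁ : SmoothPeriodic f₁) (h₂ : SmoothPeriodic f₂) :
    SmoothPeriodic fun x => f₁ x - f₂ x :=
  ⟨h₁.1.sub h₂.1, fun x => by simp only [h₁.2 x, h₂.2 x]⟩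

theorem Ha_sub (ha : 0 < a) {f₁ f₂ : ℝ → ℝ} (h₁ : SmoothPeriodic f₁) (h₂ : SmoothPeriodic f₂)
    (x : ℝ) : IPM1D.Ha a (fun x => f₁ x - f₂ x) x = IPM1D.Ha a f₁ x - IPM1D.Ha a f₂ x := by
  rw [Ha_eq_integral ha h₁.contDiff_one h₁.2, Ha_eq_integral ha h₂.contDiff_one h₂.2,
    Ha_eq_integral ha (h₁.sub h₂).contDiff_one (h₁.sub h₂).2,
    ← integral_sub (integrableOn_sub_mul_kernel ha h₁.contDiff_one h₁.2 x)
      (integrableOn_sub_mul_kernel ha h₂.contDiff_one h₂.2 x)]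
  exact integral_congr_ae (Eventually.of_forall fun y => by ring)

end SmoothPeriodic

section LogarithmicBound

variable {G : ℝ → ℝ} {M Q δ : ℝ}

theorem abs_integral_le_of_le_inv_sqrt (hδ : 0 ≤ δ) (hG : ∀ y ∈ Ioc 0 δ, |G y| ≤ Q * (√y)⁻¹) :
    |∫ y in (0 : ℝ)..δ, G y| ≤ 2 * Q * √δ := by
  have hint : IntervalIntegrable (fun y : ℝ => Q * y ^ (-(1 / 2) : ℝ)) volume 0 δ :=
    (intervalIntegral.intervalIntegrable_rpow' (by norm_num)).const_mul _
  refine (intervalIntegral.norm_integral_le_of_norm_le (f := G) hδ (ae_of_all _ fun y hy => ?_)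
    hint).trans_eq ?_
  · rw [Real.rpow_neg hy.1.le, ← Real.sqrt_eq_rpow]
    exact hG y hy
  · rw [intervalIntegral.integral_const_mul, integral_rpow (Or.inl (by norm_num)),
      Real.sqrt_eq_rpow]
    norm_num
    ring

theorem abs_integral_le_of_le_inv (hδ : 0 < δ) (hδ1 : δ ≤ 1)
    (hG : ∀ y ∈ Ioc δ 1, |G y| ≤ M * (1 / y)) : |∫ y in δ..1, G y| ≤ M * -Real.log δ := by
  have hzero : (0 : ℝ) ∉ uIcc δ 1 := by
    rw [uIcc_of_le hδ1]
    exact fun h => not_le.2 hδ h.1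
  have hint : IntervalIntegrable (fun y : ℝ => M * (1 / y)) volume δ 1 :=
    (continuousOn_const.mul (continuousOn_const.div continuousOn_id fun y hy =>
      ne_of_mem_of_not_mem hy hzero)).intervalIntegrable
  refine (intervalIntegral.norm_integral_le_of_norm_le (f := G) hδ1 (ae_of_all _ hG)
    hint).trans_eq ?_
  rw [intervalIntegral.integral_const_mul, integral_one_div hzero, one_div, Real.log_inv]

theorem abs_integral_le_of_le_lorentz {a : ℝ} (ha : 0 < a) (hM : 0 ≤ M)
    (hG : ∀ y ∈ Ioi 1, |G y| ≤ M * (a ^ 2 / (y ^ 2 + a ^ 2))) :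
    |∫ y in Ioi 1, G y| ≤ M * ∫ y : ℝ, a ^ 2 / (y ^ 2 + a ^ 2) := by
  refine (norm_integral_le_of_norm_le (f := G) ((integrable_lorentz ha).const_mul M).integrableOn
    (ae_restrict_of_forall_mem measurableSet_Ioi hG)).trans ?_
  rw [integral_const_mul]
  exact mul_le_mul_of_nonneg_left (setIntegral_le_integral (integrable_lorentz ha)
    (Eventually.of_forall fun y => div_nonneg (sq_nonneg a) (by positivity))) hM

end LogarithmicBound

theorem kernel_le_half_inv {a y : ℝ} (ha : 0 < a) (hy : 0 < y) : kernel a y ≤ 1 / 2 * y⁻¹ := by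
  rw [← div_eq_mul_inv, le_div_iff₀ hy, mul_comm]
  exact (mul_kernel_le ha hy).trans
    (one_div_le_one_div_of_le two_pos (by linarith [Real.pi_gt_three]))

theorem kernel_le_half_lorentz {a y : ℝ} (ha : 0 < a) (hy : 1 ≤ y) :
    kernel a y ≤ 1 / 2 * (a ^ 2 / (y ^ 2 + a ^ 2)) := by
  have hy0 : 0 < y := one_pos.trans_le hy
  refine (le_mul_of_one_le_left (kernel_pos ha hy0).le hy).trans ?_
  rw [mul_kernel a hy0.ne']
  exact mul_le_mul_of_nonneg_right
    (one_div_le_one_div_of_le two_pos (by linarith [Real.pi_gt_three])) (by positivity)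

theorem abs_sub_mul_kernel_le_inv_sqrt {a : ℝ} {f : ℝ → ℝ} (ha : 0 < a) {Q : ℝ}
    (hQ : ∀ x y, |x - y| ≤ 2 → |f x - f y| ≤ Q * √|x - y|) (x : ℝ) {y : ℝ} (hy : 0 < y)
    (hy1 : y ≤ 1) : |(f (x - y) - f (x + y)) * kernel a y| ≤ Q * (√y)⁻¹ := by
  have hQ0 : 0 ≤ Q := by simpa using (abs_nonneg _).trans (hQ 1 0 (by norm_num))
  have hosc : |f (x - y) - f (x + y)| ≤ Q * (2 * √y) := by
    have hdist : |x - y - (x + y)| = 2 * y := by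
      rw [show x - y - (x + y) = -(2 * y) by ring, abs_neg, abs_of_pos (by positivity)]
    refine (hQ _ _ (by linarith)).trans (mul_le_mul_of_nonneg_left ?_ hQ0)
    rw [hdist, Real.sqrt_le_left (by positivity), mul_pow, Real.sq_sqrt hy.le]
    linarith
  calc |(f (x - y) - f (x + y)) * kernel a y|
      = |f (x - y) - f (x + y)| * kernel a y := by rw [abs_mul, abs_of_pos (kernel_pos ha hy)]
    _ ≤ Q * (2 * √y) * (1 / 2 * y⁻¹) :=
        mul_le_mul hosc (kernel_le_half_inv ha hy) (kernel_pos ha hy).le (by positivity)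
    _ = Q * (√y / y) := by ring
    _ = Q * (√y)⁻¹ := by rw [Real.sqrt_div_self]

/-- The three terms come from the ranges `y ≤ δ`, `δ ≤ y ≤ 1` and `1 ≤ y` of the integral. -/
theorem SmoothPeriodic.abs_Ha_le {a : ℝ} {f : ℝ → ℝ} (ha : 0 < a) (hf : SmoothPeriodic f)
    {M Q δ : ℝ} (hM : ∀ x, |f x| ≤ M) (hQ : ∀ x y, |x - y| ≤ 2 → |f x - f y| ≤ Q * √|x - y|)
    (hδ : 0 < δ) (hδ1 : δ ≤ 1) (x : ℝ) : |IPM1D.Ha a f x| ≤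
      2 * Q * √δ + M * -Real.log δ + M * ∫ y : ℝ, a ^ 2 / (y ^ 2 + a ^ 2) := by
  have hM0 : 0 ≤ M := (abs_nonneg _).trans (hM 0)
  let G (y : ℝ) : ℝ := (f (x - y) - f (x + y)) * kernel a y
  have hG_le {y : ℝ} (hy : 0 < y) : |G y| ≤ 2 * M * kernel a y := by
    rw [abs_mul, abs_of_pos (kernel_pos ha hy)]
    refine mul_le_mul_of_nonneg_right ?_ (kernel_pos ha hy).le
    linarith [abs_sub (f (x - y)) (f (x + y)), hM (x - y), hM (x + y)]
  have hnear : ∀ y ∈ Ioc 0 δ, |G y| ≤ Q * (√y)⁻¹ := fun y ⟨hy, hyδ⟩ =>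
    abs_sub_mul_kernel_le_inv_sqrt ha hQ x hy (hyδ.trans hδ1)
  have hmiddle : ∀ y ∈ Ioc δ 1, |G y| ≤ M * (1 / y) := fun y ⟨hy, _⟩ =>
    (hG_le (hδ.trans hy)).trans ((mul_le_mul_of_nonneg_left (kernel_le_half_inv ha (hδ.trans hy))
      (by positivity)).trans_eq (by ring))
  have hfar : ∀ y ∈ Ioi 1, |G y| ≤ M * (a ^ 2 / (y ^ 2 + a ^ 2)) := fun y (hy : 1 < y) =>
    (hG_le (one_pos.trans hy)).trans ((mul_le_mul_of_nonneg_left (kernel_le_half_lorentz ha hy.le)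
      (by positivity)).trans_eq (by ring))
  have hint : IntegrableOn G (Ioi 0) := integrableOn_sub_mul_kernel ha hf.contDiff_one hf.2 x
  have hsplit : IPM1D.Ha a f x =
      (∫ y in (0 : ℝ)..δ, G y) + (∫ y in δ..1, G y) + ∫ y in Ioi 1, G y := by
    rw [Ha_eq_integral ha hf.contDiff_one hf.2,
      ← intervalIntegral.integral_Ioi_sub_Ioi hint hδ.le,
      ← intervalIntegral.integral_Ioi_sub_Ioi (hint.mono_set (Ioi_subset_Ioi hδ.le)) hδ1]
    ring
  rw [hsplit]
  exact (abs_add_three _ _ _).trans (add_le_add (add_le_add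
    (abs_integral_le_of_le_inv_sqrt hδ.le hnear) (abs_integral_le_of_le_inv hδ hδ1 hmiddle))
    (abs_integral_le_of_le_lorentz ha hM0 hfar))

/-! ### Products of Fourier series and dependence on time -/

/-- The convolution of two families of Fourier coefficients: the coefficients of the product. -/
noncomputable def conv (b d : ℤ → ℂ) (k : ℤ) : ℂ := ∑' m, b m * d (k - m)

theorem abs_intCast_pow_le (s : ℕ) (k m : ℤ) :
    |(k : ℝ)| ^ s ≤ 2 ^ s * (|(m : ℝ)| ^ s + |((k - m : ℤ) : ℝ)| ^ s) := by
  have htriangle : |(k : ℝ)| ≤ |(m : ℝ)| + |((k - m : ℤ) : ℝ)| := by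
    simpa using abs_add_le (m : ℝ) ((k - m : ℤ) : ℝ)
  refine (pow_le_pow_left₀ (abs_nonneg _) htriangle s).trans
    ((add_pow_le (abs_nonneg _) (abs_nonneg _) s).trans ?_)
  exact mul_le_mul_of_nonneg_right (pow_le_pow_right₀ one_le_two (Nat.sub_le _ _)) (by positivity)

namespace Decay

variable {B D : ℕ → ℝ} {b d : ℤ → ℂ}

theorem norm_le (h : Decay B b) (k : ℤ) : ‖b k‖ ≤ B 0 := by simpa using h 0 k

theorem norm_conv_term_le (hb : Decay B b) (hd : Decay D d) (k m : ℤ) :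
    ‖b m * d (k - m)‖ ≤ (B 0 + B 2) * weight m * D 0 := by
  rw [norm_mul]
  exact mul_le_mul (hb.norm_le_weight m) (hd.norm_le _) (norm_nonneg _)
    ((norm_nonneg _).trans (hb.norm_le_weight m))

theorem summable_conv (hb : Decay B b) (hd : Decay D d) (k : ℤ) :
    Summable fun m => b m * d (k - m) :=
  Summable.of_norm_bounded ((summable_weight.mul_left _).mul_right _) (hb.norm_conv_term_le hd k)

theorem pow_mul_norm_conv_term_le (hb : Decay B b) (hd : Decay D d) (s : ℕ) (k m : ℤ) :
    |(k : ℝ)| ^ s * ‖b m * d (k - m)‖ ≤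
      2 ^ s * (((B s + B (s + 2)) * weight m) * D 0 + ((B 0 + B 2) * weight m) * D s) := by
  rw [norm_mul]
  calc |(k : ℝ)| ^ s * (‖b m‖ * ‖d (k - m)‖)
      ≤ (2 ^ s * (|(m : ℝ)| ^ s + |((k - m : ℤ) : ℝ)| ^ s)) * (‖b m‖ * ‖d (k - m)‖) :=
        mul_le_mul_of_nonneg_right (abs_intCast_pow_le s k m) (by positivity)
    _ = 2 ^ s * ((|(m : ℝ)| ^ s * ‖b m‖) * ‖d (k - m)‖
          + ‖b m‖ * (|((k - m : ℤ) : ℝ)| ^ s * ‖d (k - m)‖)) := by ring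
    _ ≤ _ := by
        have hs := hb.le_weight s m
        have h0 := hb.norm_le_weight m
        refine mul_le_mul_of_nonneg_left (add_le_add ?_ ?_) (by positivity)
        · exact mul_le_mul hs (hd.norm_le _) (norm_nonneg _) (le_trans (by positivity) hs)
        · exact mul_le_mul h0 (hd s _) (by positivity) ((norm_nonneg _).trans h0)

theorem conv (hb : Decay B b) (hd : Decay D d) :
    Decay (fun s => 2 ^ s *
      (((B s + B (s + 2)) * weightSum) * D 0 + ((B 0 + B 2) * weightSum) * D s)) (conv b d) := by
  intro s k
  have hw := summable_weight.hasSum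
  have hmajorant := ((((hw.mul_left (B s + B (s + 2))).mul_right (D 0)).add
    ((hw.mul_left (B 0 + B 2)).mul_right (D s)))).mul_left (2 ^ s : ℝ)
  have hbound := tsum_of_norm_bounded (f := fun m => (|(k : ℝ)| ^ s : ℝ) • (b m * d (k - m)))
    hmajorant fun m => by
      rw [norm_smul, Real.norm_of_nonneg (by positivity)]
      exact hb.pow_mul_norm_conv_term_le hd s k m
  rwa [tsum_const_smul'', norm_smul, Real.norm_of_nonneg (by positivity)] at hbound

theorem hasSum_conv (hb : Decay B b) (hd : Decay D d) (x : ℝ) :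
    HasSum (fun k => IPM1D.conv b d k * mode k x)
      ((∑' k, b k * mode k x) * ∑' k, d k * mode k x) := by
  have hb_norm : Summable fun k => ‖b k * mode k x‖ := by simpa [norm_mode] using hb.summable_norm
  have hd_norm : Summable fun k => ‖d k * mode k x‖ := by simpa [norm_mode] using hd.summable_norm
  have hprod := (summable_mul_of_summable_norm hb_norm hd_norm).hasSum
  rw [← tsum_mul_tsum_of_summable_norm hb_norm hd_norm] at hprod
  let e : ℤ × ℤ ≃ ℤ × ℤ :=
    { toFun := fun p => (p.2, p.1 - p.2)
      invFun := fun p => (p.1 + p.2, p.1)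
      left_inv := fun p => by simp
      right_inv := fun p => by simp }
  refine (e.hasSum_iff.2 hprod).prod_fiberwise fun k =>
    ((hb.summable_conv hd k).hasSum.mul_right (mode k x)).congr_fun fun m => ?_
  have hmode : mode m x * mode (k - m) x = mode k x := by rw [← mode_add, add_sub_cancel]
  simp only [e, Equiv.coe_fn_mk, Function.comp, ← hmode]
  ring

end Decay

/-- Families of Fourier coefficients depending on time which, together with `n` time derivatives,
decay rapidly, uniformly in `t ∈ J`. -/
def TimeContDiff (J : Set ℝ) : ℕ → (ℤ → ℝ → ℂ) → Prop
  | 0, c => (∃ B, ∀ t ∈ J, Decay B fun k => c k t) ∧ ∀ k, ContinuousOn (c k) J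
  | n + 1, c => (∃ B, ∀ t ∈ J, Decay B fun k => c k t) ∧
      ∃ d, TimeContDiff J n d ∧ ∀ k, ∀ t ∈ J, HasDerivAt (c k) (d k t) t

namespace TimeContDiff

variable {J : Set ℝ} {n : ℕ} {c e : ℤ → ℝ → ℂ}

theorem decay (h : TimeContDiff J n c) : ∃ B, ∀ t ∈ J, Decay B fun k => c k t := by
  cases n <;> exact h.1

theorem continuousOn (h : TimeContDiff J n c) (k : ℤ) : ContinuousOn (c k) J := by
  cases n with
  | zero => exact h.2 k
  | succ n =>
    obtain ⟨_, d, _, hd⟩ := h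
    exact fun t ht => (hd k t ht).continuousAt.continuousWithinAt

theorem of_succ (h : TimeContDiff J (n + 1) c) : TimeContDiff J n c := by
  induction n generalizing c with
  | zero => exact ⟨h.decay, h.continuousOn⟩
  | succ n ih =>
    obtain ⟨hB, d, hd, hcd⟩ := h
    exact ⟨hB, d, ih hd, hcd⟩

theorem deriv (h : TimeContDiff J n c) : TimeContDiff J n fun k t => Complex.I * k * c k t := by
  induction n generalizing c with
  | zero =>
    obtain ⟨⟨B, hB⟩, hc⟩ := h
    exact ⟨⟨_, fun t ht => (hB t ht).deriv⟩, fun k => continuousOn_const.mul (hc k)⟩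
  | succ n ih =>
    obtain ⟨⟨B, hB⟩, d, hd, hcd⟩ := h
    exact ⟨⟨_, fun t ht => (hB t ht).deriv⟩, _, ih hd, fun k t ht => (hcd k t ht).const_mul _⟩

theorem mul_left (h : TimeContDiff J n c) {m : ℤ → ℂ} {C : ℝ} (hm : ∀ k, ‖m k‖ ≤ C) :
    TimeContDiff J n fun k t => m k * c k t := by
  induction n generalizing c with
  | zero =>
    obtain ⟨⟨B, hB⟩, hc⟩ := h
    exact ⟨⟨_, fun t ht => (hB t ht).mul_left hm⟩, fun k => continuousOn_const.mul (hc k)⟩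
  | succ n ih =>
    obtain ⟨⟨B, hB⟩, d, hd, hcd⟩ := h
    exact ⟨⟨_, fun t ht => (hB t ht).mul_left hm⟩, _, ih hd, fun k t ht => (hcd k t ht).const_mul _⟩

theorem add (hc : TimeContDiff J n c) (he : TimeContDiff J n e) :
    TimeContDiff J n fun k t => c k t + e k t := by
  induction n generalizing c e with
  | zero =>
    obtain ⟨⟨B, hB⟩, hc⟩ := hc
    obtain ⟨⟨D, hD⟩, he⟩ := he
    exact ⟨⟨_, fun t ht => (hB t ht).add (hD t ht)⟩, fun k => (hc k).add (he k)⟩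
  | succ n ih =>
    obtain ⟨⟨B, hB⟩, c', hc', hcc'⟩ := hc
    obtain ⟨⟨D, hD⟩, e', he', hee'⟩ := he
    exact ⟨⟨_, fun t ht => (hB t ht).add (hD t ht)⟩, _, ih hc' he',
      fun k t ht => (hcc' k t ht).add (hee' k t ht)⟩

theorem conv (hJ : IsOpen J) (hJ' : IsPreconnected J) (hc : TimeContDiff J n c)
    (he : TimeContDiff J n e) :
    TimeContDiff J n fun k t => conv (fun m => c m t) (fun m => e m t) k := by
  induction n generalizing c e with
  | zero =>
    obtain ⟨⟨B, hB⟩, hc⟩ := hc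
    obtain ⟨⟨D, hD⟩, he⟩ := he
    exact ⟨⟨_, fun t ht => (hB t ht).conv (hD t ht)⟩, fun k =>
      continuousOn_tsum (fun m => (hc m).mul (he (k - m)))
        ((summable_weight.mul_left (B 0 + B 2)).mul_right (D 0))
        fun m t ht => (hB t ht).norm_conv_term_le (hD t ht) k m⟩
  | succ n ih =>
    have hc₀ := hc.of_succ
    have he₀ := he.of_succ
    obtain ⟨⟨B, hB⟩, c', hc', hcc'⟩ := hc
    obtain ⟨⟨D, hD⟩, e', he', hee'⟩ := he
    refine ⟨⟨_, fun t ht => (hB t ht).conv (hD t ht)⟩, _, (ih hc' he₀).add (ih hc₀ he'), ?_⟩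
    obtain ⟨B', hB'⟩ := hc'.decay
    obtain ⟨D', hD'⟩ := he'.decay
    intro k t ht
    refine (hasDerivAt_tsum_of_isPreconnected
      (g := fun m t => c m t * e (k - m) t)
      (g' := fun m t => c' m t * e (k - m) t + c m t * e' (k - m) t)
      (((summable_weight.mul_left (B' 0 + B' 2)).mul_right (D 0)).add
        ((summable_weight.mul_left (B 0 + B 2)).mul_right (D' 0)))
      hJ hJ' (fun m s hs => (hcc' m s hs).mul (hee' (k - m) s hs))
      (fun m s hs => (norm_add_le _ _).trans (add_le_add
        ((hB' s hs).norm_conv_term_le (hD s hs) k m) ((hB s hs).norm_conv_term_le (hD' s hs) k m)))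
      ht ((hB t ht).summable_conv (hD t ht) k) ht).congr_deriv ?_
    exact ((hB' t ht).summable_conv (hD t ht) k).tsum_add ((hB t ht).summable_conv (hD' t ht) k)

end TimeContDiff

section TimeSeries

variable {J : Set ℝ} {c d : ℤ → ℝ → ℂ} {B D : ℕ → ℝ}

theorem hasDerivAt_tsum_time (hJ : IsOpen J) (hJ' : IsPreconnected J)
    (hB : ∀ t ∈ J, Decay B fun k => c k t) (hD : ∀ t ∈ J, Decay D fun k => d k t)
    (hcd : ∀ k, ∀ t ∈ J, HasDerivAt (c k) (d k t) t) (x : ℝ) {t : ℝ} (ht : t ∈ J) :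
    HasDerivAt (fun t => ∑' k, c k t * mode k x) (∑' k, d k t * mode k x) t :=
  hasDerivAt_tsum_of_isPreconnected (g' := fun k t => d k t * mode k x)
    (u := fun k => (D 0 + D 2) * weight k) (summable_weight.mul_left _) hJ hJ'
    (fun k s hs => (hcd k s hs).mul_const _)
    (fun k s hs => by
      rw [norm_mul, norm_mode, mul_one]
      exact (hD s hs).norm_le_weight k)
    ht ((hB t ht).summable_mode x) ht

theorem hasFDerivAt_mul_mode {c : ℝ → ℂ} {d : ℂ} (k : ℤ) {p : ℝ × ℝ} (hc : HasDerivAt c d p.2) :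
    HasFDerivAt (fun p : ℝ × ℝ => c p.2 * mode k p.1)
      ((ContinuousLinearMap.fst ℝ ℝ ℝ).smulRight (Complex.I * k * c p.2 * mode k p.1)
        + (ContinuousLinearMap.snd ℝ ℝ ℝ).smulRight (d * mode k p.1)) p := by
  have hcoef : HasFDerivAt (fun q : ℝ × ℝ => c q.2) _ p := hc.hasFDerivAt.comp p hasFDerivAt_snd
  have hmode : HasFDerivAt (fun q : ℝ × ℝ => mode k q.1) _ p :=
    (hasDerivAt_mode k p.1).hasFDerivAt.comp p hasFDerivAt_fst
  refine (hcoef.mul hmode).congr_fderiv ?_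
  ext <;> simp <;> ring

theorem hasFDerivAt_tsum_mode (hJ : IsOpen J) (hJ' : IsPreconnected J)
    (hB : ∀ t ∈ J, Decay B fun k => c k t) (hD : ∀ t ∈ J, Decay D fun k => d k t)
    (hcd : ∀ k, ∀ t ∈ J, HasDerivAt (c k) (d k t) t) {p : ℝ × ℝ} (hp : p.2 ∈ J) :
    HasFDerivAt (fun p : ℝ × ℝ => ∑' k, c k p.2 * mode k p.1)
      ((ContinuousLinearMap.fst ℝ ℝ ℝ).smulRight (∑' k : ℤ, Complex.I * k * c k p.2 * mode k p.1)
        + (ContinuousLinearMap.snd ℝ ℝ ℝ).smulRight (∑' k, d k p.2 * mode k p.1)) p := by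
  have hp' : p ∈ (univ : Set ℝ) ×ˢ J := ⟨mem_univ _, hp⟩
  let Φ := ContinuousLinearMap.smulRightL ℝ (ℝ × ℝ) ℂ (ContinuousLinearMap.fst ℝ ℝ ℝ)
  let Ψ := ContinuousLinearMap.smulRightL ℝ (ℝ × ℝ) ℂ (ContinuousLinearMap.snd ℝ ℝ ℝ)
  have hΦ := (hB p.2 hp).deriv.summable_mode p.1
  have hΨ := (hD p.2 hp).summable_mode p.1
  have hnorm (k : ℤ) (q : ℝ × ℝ) (hq : q ∈ (univ : Set ℝ) ×ˢ J) :
      ‖Φ (Complex.I * k * c k q.2 * mode k q.1) + Ψ (d k q.2 * mode k q.1)‖ ≤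
        ‖Φ‖ * ((B 1 + B 3) * weight k) + ‖Ψ‖ * ((D 0 + D 2) * weight k) := by
    refine (norm_add_le _ _).trans (add_le_add (Φ.le_opNorm_of_le ?_) (Ψ.le_opNorm_of_le ?_))
    · rw [norm_mul, norm_mode, mul_one]
      exact (hB q.2 hq.2).deriv.norm_le_weight k
    · rw [norm_mul, norm_mode, mul_one]
      exact (hD q.2 hq.2).norm_le_weight k
  refine (hasFDerivAt_tsum_of_isPreconnected (𝕜 := ℝ)
    (f := fun k (p : ℝ × ℝ) => c k p.2 * mode k p.1)
    (((summable_weight.mul_left _).mul_left _).add ((summable_weight.mul_left _).mul_left _))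
    (isOpen_univ.prod hJ) (isPreconnected_univ.prod hJ')
    (fun k q hq => hasFDerivAt_mul_mode k (hcd k q.2 hq.2)) hnorm hp'
    ((hB p.2 hp).summable_mode p.1) hp').congr_fderiv ?_
  exact ((Φ.summable hΦ).tsum_add (Ψ.summable hΨ)).trans
    (congrArg₂ _ (Φ.map_tsum hΦ).symm (Ψ.map_tsum hΨ).symm)

end TimeSeries

theorem TimeContDiff.contDiffOn {J : Set ℝ} (hJ : IsOpen J) (hJ' : IsPreconnected J) {n : ℕ}
    {c : ℤ → ℝ → ℂ} (h : TimeContDiff J n c) :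
    ContDiffOn ℝ n (fun p : ℝ × ℝ => ∑' k, c k p.2 * mode k p.1) (univ ×ˢ J) := by
  induction n generalizing c with
  | zero =>
    obtain ⟨⟨B, hB⟩, hc⟩ := h
    refine contDiffOn_zero.2 (continuousOn_tsum (u := fun k => (B 0 + B 2) * weight k) (fun k => ?_)
      (summable_weight.mul_left _) fun k p hp => ?_)
    · exact ((hc k).comp continuousOn_snd fun p hp => hp.2).mul
        ((continuous_mode k).comp continuous_fst).continuousOn
    · rw [norm_mul, norm_mode, mul_one]
      exact (hB p.2 hp.2).norm_le_weight k
  | succ n ih =>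
    have h₀ := h.of_succ
    obtain ⟨⟨B, hB⟩, d, hd, hcd⟩ := h
    obtain ⟨D, hD⟩ := hd.decay
    have hfderiv (p : ℝ × ℝ) (hp : p ∈ (univ : Set ℝ) ×ˢ J) :=
      hasFDerivAt_tsum_mode hJ hJ' hB hD hcd hp.2
    rw [Nat.cast_add, Nat.cast_one, contDiffOn_succ_iff_fderiv_of_isOpen (isOpen_univ.prod hJ)]
    refine ⟨fun p hp => (hfderiv p hp).differentiableAt.differentiableWithinAt, by simp, ?_⟩
    refine ContDiffOn.congr ?_ fun p hp => (hfderiv p hp).fderiv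
    exact (contDiffOn_const.smulRight (ih h₀.deriv)).add (contDiffOn_const.smulRight (ih hd))

/-! ### The energy estimate for the advection term -/

/-- The Fourier coefficients of `(H_a f) f'`, where `c` are those of `f`. -/
noncomputable def advection (a : ℝ) (c : ℤ → ℂ) (k : ℤ) : ℂ :=
  conv (fun m => multiplier a m * c m) (fun n => Complex.I * n * c n) k

theorem multiplier_zero (a : ℝ) : multiplier a 0 = 0 := by simp [multiplier_eq]

theorem conj_multiplier_neg (a : ℝ) (k : ℤ) : conj (multiplier a (-k)) = multiplier a k := by
  simp only [multiplier_eq, Int.cast_neg, neg_mul, Real.sin_neg, integral_neg, map_mul, map_neg,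
    Complex.conj_ofReal, Complex.conj_I, Complex.ofReal_neg, map_ofNat]
  ring

theorem conj_conv_neg (b d : ℤ → ℂ) (k : ℤ) :
    conj (conv b d (-k)) = conv (fun m => conj (b (-m))) (fun m => conj (d (-m))) k := by
  rw [conv, conv, Complex.conj_tsum, ← (Equiv.neg ℤ).tsum_eq]
  refine tsum_congr fun m => ?_
  rw [map_mul, Equiv.neg_apply, neg_sub_neg, neg_sub]

theorem conj_advection_neg (a : ℝ) (c : ℤ → ℂ) (k : ℤ) :
    conj (advection a c (-k)) = advection a (fun m => conj (c (-m))) k := by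
  rw [advection, conj_conv_neg, advection]
  congr 1 <;> ext m
  · rw [map_mul, conj_multiplier_neg]
  · simp

section SymmetrizedWeight

theorem abs_pow_mul_add_pow_mul_le_of_abs_le (r : ℕ) {x y : ℝ} (hxy : |y| ≤ |x|) :
    |x ^ (2 * (r + 1)) * y + y ^ (2 * (r + 1)) * x| ≤ ((2 * (r + 1) + 1 : ℕ) * 2 ^ (r + 1) : ℝ) *
      (|x + y| * |y| ^ (r + 1) * |x| ^ (r + 1) + |x + y| ^ (r + 1) * |y| * |x| ^ (r + 1)) := by
  have hfactor : x ^ (2 * (r + 1)) * y + y ^ (2 * (r + 1)) * x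
      = x * y * (x ^ (2 * r + 1) - (-y) ^ (2 * r + 1)) := by
    rw [Odd.neg_pow ⟨r, rfl⟩]
    ring
  have hdiff := abs_pow_sub_pow_le x (-y) (2 * r + 1)
  rw [sub_neg_eq_add, abs_neg, max_eq_left hxy, Nat.add_sub_cancel] at hdiff
  have hpow : |x| ^ r ≤ 2 ^ r * (|x + y| ^ r + |y| ^ r) := by
    have htriangle : |x| ≤ |x + y| + |y| := by simpa using abs_sub (x + y) y
    refine (pow_le_pow_left₀ (abs_nonneg _) htriangle r).trans
      ((add_pow_le (abs_nonneg _) (abs_nonneg _) r).trans ?_)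
    exact mul_le_mul_of_nonneg_right (pow_le_pow_right₀ one_le_two (Nat.sub_le _ _)) (by positivity)
  have hconst : ((2 * r + 1 : ℕ) : ℝ) * 2 ^ r ≤ (2 * (r + 1) + 1 : ℕ) * 2 ^ (r + 1) := by
    gcongr <;> norm_num
  rw [hfactor, abs_mul, abs_mul]
  calc |x| * |y| * |x ^ (2 * r + 1) - (-y) ^ (2 * r + 1)|
      ≤ |x| * |y| * (|x + y| * (2 * r + 1 : ℕ) * |x| ^ (2 * r)) := by gcongr
    _ = (|x| ^ (r + 1) * |y| * |x + y| * (2 * r + 1 : ℕ)) * |x| ^ r := by ring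
    _ ≤ (|x| ^ (r + 1) * |y| * |x + y| * (2 * r + 1 : ℕ)) *
          (2 ^ r * (|x + y| ^ r + |y| ^ r)) := by gcongr
    _ = (((2 * r + 1 : ℕ) : ℝ) * 2 ^ r) * (|x + y| * |y| ^ (r + 1) * |x| ^ (r + 1)
          + |x + y| ^ (r + 1) * |y| * |x| ^ (r + 1)) := by ring
    _ ≤ _ := by gcongr

/-- The left-hand side has degree `2 s + 1` in `x`, `y`; on the right no factor carries more than
`s` powers: this is the commutator cancellation behind the energy estimate. -/
theorem abs_pow_mul_add_pow_mul_le (s : ℕ) (x y : ℝ) :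
    |x ^ (2 * s) * y + y ^ (2 * s) * x| ≤ ((2 * s + 1 : ℕ) * 2 ^ s : ℝ) *
      (|x + y| * |y| ^ s * |x| ^ s + |x + y| ^ s * |y| * |x| ^ s +
        |x + y| ^ s * |y| ^ s * |x|) := by
  rcases s with _ | r
  · simp only [mul_zero, pow_zero, one_mul, mul_one, zero_add, Nat.cast_one]
    rw [add_comm y x]
    linarith [abs_nonneg x, abs_nonneg y]
  · rcases le_total |y| |x| with h | h
    · refine (abs_pow_mul_add_pow_mul_le_of_abs_le r h).trans
        (mul_le_mul_of_nonneg_left ?_ (by positivity))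
      exact le_add_of_nonneg_right (by positivity)
    · have hswap := abs_pow_mul_add_pow_mul_le_of_abs_le r h
      rw [add_comm y x] at hswap
      rw [add_comm (x ^ _ * y)]
      refine hswap.trans (mul_le_mul_of_nonneg_left ?_ (by positivity))
      linarith [show 0 ≤ |x + y| ^ (r + 1) * |y| * |x| ^ (r + 1) by positivity]

end SymmetrizedWeight

section Trilinear

variable {G : Type*} [AddCommGroup G] {S : Finset G}

theorem sum_comp_sub_left {F : G → ℂ} (g : G) (hF : ∀ l ∉ S, F l = 0)
    (hF' : ∀ l ∉ S, F (g - l) = 0) : ∑ l ∈ S, F (g - l) = ∑ l ∈ S, F l := by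
  have hleft : ∑' l, F (g - l) = ∑ l ∈ S, F (g - l) := tsum_eq_sum hF'
  have hright : ∑' l, F l = ∑ l ∈ S, F l := tsum_eq_sum hF
  rw [← hleft, ← hright]
  exact (Equiv.subLeft g).tsum_eq F

theorem sum_comp_sub_left_le {q : G → ℝ} (hq : ∀ k, 0 ≤ q k) (hS : ∀ k ∉ S, q k = 0) (g : G) :
    ∑ l ∈ S, q (g - l) ≤ ∑ k ∈ S, q k := by
  have hsummable : Summable q := summable_of_ne_finset_zero hS
  have hle := ((Equiv.subLeft g).summable_iff.2 hsummable).sum_le_tsum S fun l _ => hq _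
  rwa [(Equiv.subLeft g).tsum_eq, tsum_eq_sum hS] at hle

theorem sum_trilinear_left_le {w v : G → ℝ} (hw : ∀ k, 0 ≤ w k) (hv : ∀ k ∉ S, v k = 0) :
    ∑ m ∈ S, ∑ l ∈ S, w m * v (-m - l) * v l ≤ (∑ k ∈ S, w k) * ∑ k ∈ S, v k ^ 2 := by
  rw [Finset.sum_mul]
  refine Finset.sum_le_sum fun m _ => ?_
  have hshift : ∑ l ∈ S, v (-m - l) ^ 2 ≤ ∑ k ∈ S, v k ^ 2 :=
    sum_comp_sub_left_le (q := fun k => v k ^ 2) (fun k => sq_nonneg _)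
      (fun k hk => by simp [hv k hk]) (-m)
  calc ∑ l ∈ S, w m * v (-m - l) * v l
      ≤ ∑ l ∈ S, w m * ((1 / 2) * v (-m - l) ^ 2 + (1 / 2) * v l ^ 2) := by
        refine Finset.sum_le_sum fun l _ => ?_
        rw [mul_assoc]
        refine mul_le_mul_of_nonneg_left ?_ (hw m)
        linarith [two_mul_le_add_sq (v (-m - l)) (v l)]
    _ = w m * ((1 / 2) * ∑ l ∈ S, v (-m - l) ^ 2 + (1 / 2) * ∑ l ∈ S, v l ^ 2) := by
        rw [← Finset.mul_sum, Finset.sum_add_distrib, Finset.mul_sum, Finset.mul_sum]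
    _ ≤ _ := mul_le_mul_of_nonneg_left (by linarith) (hw m)

theorem sum_trilinear_right_le {w v : G → ℝ} (hw : ∀ k, 0 ≤ w k) (hv : ∀ k ∉ S, v k = 0) :
    ∑ m ∈ S, ∑ l ∈ S, v m * v (-m - l) * w l ≤ (∑ k ∈ S, w k) * ∑ k ∈ S, v k ^ 2 := by
  rw [Finset.sum_comm]
  refine le_of_eq_of_le ?_ (sum_trilinear_left_le hw hv)
  refine Finset.sum_congr rfl fun m _ => Finset.sum_congr rfl fun l _ => ?_
  rw [neg_sub_comm]
  ring

theorem sum_trilinear_mid_le {w v : G → ℝ} (hw : ∀ k, 0 ≤ w k) (hwS : ∀ k ∉ S, w k = 0) :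
    ∑ m ∈ S, ∑ l ∈ S, v m * w (-m - l) * v l ≤ (∑ k ∈ S, w k) * ∑ k ∈ S, v k ^ 2 := by
  calc ∑ m ∈ S, ∑ l ∈ S, v m * w (-m - l) * v l
      ≤ ∑ m ∈ S, ∑ l ∈ S, ((1 / 2) * (w (-m - l) * v m ^ 2) +
          (1 / 2) * (w (-m - l) * v l ^ 2)) := by
        refine Finset.sum_le_sum fun m _ => Finset.sum_le_sum fun l _ => ?_
        nlinarith [mul_nonneg (hw (-m - l)) (sq_nonneg (v m - v l))]
    _ = (1 / 2) * (∑ m ∈ S, (∑ l ∈ S, w (-m - l)) * v m ^ 2)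
        + (1 / 2) * (∑ l ∈ S, (∑ m ∈ S, w (-l - m)) * v l ^ 2) := by
        simp only [Finset.sum_add_distrib, ← Finset.mul_sum, Finset.sum_mul]
        congr 2
        rw [Finset.sum_comm]
        refine Finset.sum_congr rfl fun m _ => Finset.sum_congr rfl fun l _ => ?_
        rw [neg_sub_comm]
    _ ≤ (1 / 2) * ((∑ k ∈ S, w k) * ∑ k ∈ S, v k ^ 2)
        + (1 / 2) * ((∑ k ∈ S, w k) * ∑ k ∈ S, v k ^ 2) := by
        have hle : ∑ m ∈ S, (∑ l ∈ S, w (-m - l)) * v m ^ 2 ≤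
            (∑ k ∈ S, w k) * ∑ k ∈ S, v k ^ 2 := by
          rw [Finset.mul_sum]
          exact Finset.sum_le_sum fun m _ =>
            mul_le_mul_of_nonneg_right (sum_comp_sub_left_le hw hwS (-m)) (sq_nonneg _)
        linarith
    _ = _ := by ring

end Trilinear

section EnergyEstimate

variable {S : Finset ℤ} {c : ℤ → ℂ}

theorem advection_eq_sum (a : ℝ) (hc : ∀ k ∉ S, c k = 0) (k : ℤ) :
    advection a c k =
      ∑ m ∈ S, (multiplier a m * c m) * (Complex.I * ((k - m : ℤ) : ℂ) * c (k - m)) :=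
  tsum_eq_sum fun m hm => by simp [hc m hm]

theorem sum_pow_mul_conj_mul_advection_eq (a : ℝ) (hc : ∀ k ∉ S, c k = 0)
    (hconj : ∀ k, conj (c k) = c (-k)) (s : ℕ) :
    ∑ k ∈ S, (k : ℂ) ^ (2 * s) * conj (c k) * advection a c k =
      ∑ m ∈ S, ∑ l ∈ S, (l : ℂ) ^ (2 * s) * c l * (multiplier a m * c m) *
        (Complex.I * ((-m - l : ℤ) : ℂ) * c (-m - l)) := by
  simp only [advection_eq_sum a hc, Finset.mul_sum]
  rw [Finset.sum_comm]
  refine Finset.sum_congr rfl fun m _ => ?_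
  rw [← sum_comp_sub_left 0 (fun k hk => by simp [hc k hk])
    fun k hk => by simp [← hconj, hc k hk]]
  refine Finset.sum_congr rfl fun k _ => ?_
  rw [zero_sub, hconj, neg_neg, show -k - m = -m - k by ring, Int.cast_neg,
    (even_two_mul s).neg_pow]
  ring

theorem sum_pow_mul_conj_mul_advection_eq_symmetrized (a : ℝ) (hc : ∀ k ∉ S, c k = 0)
    (hconj : ∀ k, conj (c k) = c (-k)) (s : ℕ) :
    ∑ k ∈ S, (k : ℂ) ^ (2 * s) * conj (c k) * advection a c k =
      ∑ m ∈ S, ∑ l ∈ S, (1 / 2) * (Complex.I * multiplier a m * c m * c (-m - l) * c l) *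
        (((l : ℝ) ^ (2 * s) * ((-m - l : ℤ) : ℝ) + ((-m - l : ℤ) : ℝ) ^ (2 * s) * l : ℝ) : ℂ) := by
  rw [sum_pow_mul_conj_mul_advection_eq a hc hconj s]
  refine Finset.sum_congr rfl fun m _ => ?_
  let T (l : ℤ) : ℂ := (l : ℂ) ^ (2 * s) * c l * (multiplier a m * c m) *
    (Complex.I * ((-m - l : ℤ) : ℂ) * c (-m - l))
  have hreflect : ∑ l ∈ S, T (-m - l) = ∑ l ∈ S, T l :=
    sum_comp_sub_left (-m) (fun l hl => by simp [T, hc l hl]) fun l hl => by simp [T, hc l hl]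
  calc ∑ l ∈ S, T l = (1 / 2) * (∑ l ∈ S, T l + ∑ l ∈ S, T (-m - l)) := by rw [hreflect]; ring
    _ = ∑ l ∈ S, (1 / 2) * (T l + T (-m - l)) := by rw [← Finset.sum_add_distrib, Finset.mul_sum]
    _ = _ := Finset.sum_congr rfl fun l _ => by
        simp only [T, sub_sub_cancel]
        push_cast
        ring

theorem norm_symmetrized_term_le {a : ℝ} (ha : 0 < a) (c : ℤ → ℂ) (s : ℕ) (m l : ℤ) :
    ‖(1 / 2) * (Complex.I * multiplier a m * c m * c (-m - l) * c l) *
      (((l : ℝ) ^ (2 * s) * ((-m - l : ℤ) : ℝ) + ((-m - l : ℤ) : ℝ) ^ (2 * s) * l : ℝ) : ℂ)‖ ≤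
      ((2 * s + 1 : ℕ) * 2 ^ s : ℝ) *
        (|(m : ℝ)| * ‖c m‖ * (|((-m - l : ℤ) : ℝ)| ^ s * ‖c (-m - l)‖) * (|(l : ℝ)| ^ s * ‖c l‖)
        + |(m : ℝ)| ^ s * ‖c m‖ * (|((-m - l : ℤ) : ℝ)| * ‖c (-m - l)‖) * (|(l : ℝ)| ^ s * ‖c l‖)
        + |(m : ℝ)| ^ s * ‖c m‖ * (|((-m - l : ℤ) : ℝ)| ^ s * ‖c (-m - l)‖) *
          (|(l : ℝ)| * ‖c l‖)) := by
  have hweight := abs_pow_mul_add_pow_mul_le s (l : ℝ) ((-m - l : ℤ) : ℝ)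
  rw [← Int.cast_add, add_sub_cancel, Int.cast_neg, abs_neg] at hweight
  have hmultiplier := norm_multiplier_le ha m
  simp only [norm_mul, Complex.norm_I, one_mul, Complex.norm_real, Real.norm_eq_abs]
  rw [show ‖(1 / 2 : ℂ)‖ = 1 / 2 by norm_num]
  calc _ ≤ 1 / 2 * (2 * ‖c m‖ * ‖c (-m - l)‖ * ‖c l‖) * _ :=
        mul_le_mul (by gcongr) hweight (abs_nonneg _) (by positivity)
    _ = _ := by ring

theorem norm_sum_pow_mul_conj_mul_advection_le {a : ℝ} (ha : 0 < a) (hc : ∀ k ∉ S, c k = 0)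
    (hconj : ∀ k, conj (c k) = c (-k)) (s : ℕ) :
    ‖∑ k ∈ S, (k : ℂ) ^ (2 * s) * conj (c k) * advection a c k‖ ≤
      (3 * ((2 * s + 1 : ℕ) * 2 ^ s) : ℝ) * (∑ k ∈ S, |(k : ℝ)| * ‖c k‖) *
        ∑ k ∈ S, (|(k : ℝ)| ^ s * ‖c k‖) ^ 2 := by
  let w (k : ℤ) : ℝ := |(k : ℝ)| * ‖c k‖
  let v (k : ℤ) : ℝ := |(k : ℝ)| ^ s * ‖c k‖
  have hw (k : ℤ) : 0 ≤ w k := by positivity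
  have hwS : ∀ k ∉ S, w k = 0 := fun k hk => by simp [w, hc k hk]
  have hvS : ∀ k ∉ S, v k = 0 := fun k hk => by simp [v, hc k hk]
  rw [sum_pow_mul_conj_mul_advection_eq_symmetrized a hc hconj s]
  calc _ ≤ ∑ m ∈ S, ∑ l ∈ S, ((2 * s + 1 : ℕ) * 2 ^ s : ℝ) *
        (w m * v (-m - l) * v l + v m * w (-m - l) * v l + v m * v (-m - l) * w l) :=
        norm_sum_le_of_le _ fun m _ => norm_sum_le_of_le _ fun l _ =>
          norm_symmetrized_term_le ha c s m l
    _ = ((2 * s + 1 : ℕ) * 2 ^ s : ℝ) * (∑ m ∈ S, ∑ l ∈ S, w m * v (-m - l) * v l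
        + ∑ m ∈ S, ∑ l ∈ S, v m * w (-m - l) * v l
        + ∑ m ∈ S, ∑ l ∈ S, v m * v (-m - l) * w l) := by
        simp only [← Finset.mul_sum, Finset.sum_add_distrib]
    _ ≤ ((2 * s + 1 : ℕ) * 2 ^ s : ℝ) * (3 * ((∑ k ∈ S, w k) * ∑ k ∈ S, v k ^ 2)) := by
        have hleft := sum_trilinear_left_le hw hvS
        have hmid := sum_trilinear_mid_le (v := v) hw hwS
        have hright := sum_trilinear_right_le hw hvS
        gcongr
        linarith
    _ = _ := by ring

end EnergyEstimate

/-! ### Galerkin approximation -/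

section IntegralCurve

variable {E : Type*} [NormedAddCommGroup E] [NormedSpace ℝ E] {V : E → E} {τ : ℝ}

theorem mem_closedBall_of_hasDerivAt {L : ℝ} (hL : ∀ x, ‖V x‖ ≤ L) {γ : ℝ → E}
    (hγ : ∀ t ∈ Ioo (-τ) τ, HasDerivAt γ (V (γ t)) t) {t : ℝ} (ht : t ∈ Ioo (-τ) τ) :
    γ t ∈ Metric.closedBall (γ 0) (L * τ) := by
  have h0 : (0 : ℝ) ∈ Ioo (-τ) τ := by constructor <;> linarith [ht.1, ht.2]
  have hle := Convex.norm_image_sub_le_of_norm_hasDerivWithin_le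
    (fun s hs => (hγ s hs).hasDerivWithinAt) (fun s _ => hL (γ s)) (convex_Ioo _ _) h0 ht
  rw [mem_closedBall_iff_norm]
  refine hle.trans (mul_le_mul_of_nonneg_left ?_ ((norm_nonneg _).trans (hL (γ 0))))
  simpa using (abs_lt.2 ht).le

variable [ProperSpace E]

theorem exists_lipschitzOnWith_closedBall (hV : ContDiff ℝ 1 V) (x : E) (r : ℝ) :
    ∃ K, LipschitzOnWith K V (Metric.closedBall x r) := by
  obtain ⟨C, hC⟩ := (isCompact_closedBall x r).exists_bound_of_continuousOn
    (hV.continuous_fderiv one_ne_zero).continuousOn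
  refine ⟨C.toNNReal, (convex_closedBall x r).lipschitzOnWith_of_nnnorm_fderiv_le (𝕜 := ℝ)
    (fun y _ => hV.differentiable one_ne_zero y) fun y hy => ?_⟩
  rw [← NNReal.coe_le_coe, coe_nnnorm]
  exact (hC y hy).trans (Real.le_coe_toNNReal C)

theorem eqOn_of_hasDerivAt_of_norm_le (hV : ContDiff ℝ 1 V) {L : ℝ} (hL : ∀ x, ‖V x‖ ≤ L)
    {α β : ℝ → E} (hα : ∀ t ∈ Ioo (-τ) τ, HasDerivAt α (V (α t)) t)
    (hβ : ∀ t ∈ Ioo (-τ) τ, HasDerivAt β (V (β t)) t) (h : α 0 = β 0) :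
    EqOn α β (Ioo (-τ) τ) := by
  intro t ht
  have h0 : (0 : ℝ) ∈ Ioo (-τ) τ := by constructor <;> linarith [ht.1, ht.2]
  obtain ⟨K, hK⟩ := exists_lipschitzOnWith_closedBall hV (α 0) (L * τ)
  exact ODE_solution_unique_of_mem_Ioo (v := fun _ => V)
    (s := fun _ => Metric.closedBall (α 0) (L * τ)) (fun _ _ => hK) h0
    (fun s hs => ⟨hα s hs, mem_closedBall_of_hasDerivAt hL hα hs⟩)
    (fun s hs => ⟨hβ s hs, h ▸ mem_closedBall_of_hasDerivAt hL hβ hs⟩) h ht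

theorem exists_hasDerivAt_of_norm_le [CompleteSpace E] (hV : ContDiff ℝ 1 V) {L : ℝ}
    (hL : ∀ x, ‖V x‖ ≤ L) (x₀ : E) (hτ : 0 < τ) :
    ∃ α : ℝ → E, α 0 = x₀ ∧ ∀ t ∈ Ioo (-τ) τ, HasDerivAt α (V (α t)) t := by
  have hL₀ : 0 ≤ L := (norm_nonneg _).trans (hL x₀)
  obtain ⟨K, hK⟩ := exists_lipschitzOnWith_closedBall hV x₀ (L * τ)
  have h0 : (0 : ℝ) ∈ Icc (-τ) τ := ⟨by linarith, hτ.le⟩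
  have hpl : IsPicardLindelof (fun _ : ℝ => V) (⟨0, h0⟩ : Icc (-τ) τ) x₀
      ⟨L * τ, mul_nonneg hL₀ hτ.le⟩ 0 ⟨L, hL₀⟩ K :=
    { lipschitzOnWith := fun _ _ => hK
      continuousOn := fun _ _ => continuousOn_const
      norm_le := fun _ _ x _ => hL x
      mul_max_le := by
        change L * max (τ - 0) (0 - -τ) ≤ L * τ - 0
        simp }
  obtain ⟨α, hα0, hα⟩ := hpl.exists_eq_forall_mem_Icc_hasDerivWithinAt₀
  exact ⟨α, hα0, fun t ht => (hα t (Ioo_subset_Icc_self ht)).hasDerivAt (Icc_mem_nhds ht.1 ht.2)⟩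

end IntegralCurve

theorem norm_le_norm_mul_exp_of_norm_deriv_le {E : Type*} [NormedAddCommGroup E] [NormedSpace ℝ E]
    {f f' : ℝ → E} {τ κ : ℝ} (hf : ∀ t ∈ Ioo (-τ) τ, HasDerivAt f (f' t) t)
    (hf' : ∀ t ∈ Ioo (-τ) τ, ‖f' t‖ ≤ κ * ‖f t‖) {t : ℝ} (ht : t ∈ Ioo (-τ) τ) :
    ‖f t‖ ≤ ‖f 0‖ * Real.exp (κ * |t|) := by
  have forward {f f' : ℝ → E} (hf : ∀ t ∈ Ioo (-τ) τ, HasDerivAt f (f' t) t)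
      (hf' : ∀ t ∈ Ioo (-τ) τ, ‖f' t‖ ≤ κ * ‖f t‖) {t : ℝ} (ht₀ : 0 ≤ t) (ht : t < τ) :
      ‖f t‖ ≤ ‖f 0‖ * Real.exp (κ * t) := by
    have hmem (s : ℝ) (hs : s ∈ Icc 0 t) : s ∈ Ioo (-τ) τ := by
      constructor <;> linarith [hs.1, hs.2]
    have hle := norm_le_gronwallBound_of_norm_deriv_right_le (ε := 0)
      (fun s hs => (hf s (hmem s hs)).continuousAt.continuousWithinAt)
      (fun s hs => (hf s (hmem s (Ico_subset_Icc_self hs))).hasDerivWithinAt) le_rfl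
      (fun s hs => by simpa using hf' s (hmem s (Ico_subset_Icc_self hs))) t
      (right_mem_Icc.2 ht₀)
    rwa [gronwallBound_ε0, sub_zero] at hle
  rcases le_total 0 t with h | h
  · rw [abs_of_nonneg h]
    exact forward hf hf' h ht.2
  · have hmem (s : ℝ) (hs : s ∈ Ioo (-τ) τ) : -s ∈ Ioo (-τ) τ := by
      constructor <;> linarith [hs.1, hs.2]
    have hle := forward (f := fun s => f (-s)) (f' := fun s => -f' (-s))
      (fun s hs => ((hf _ (hmem s hs)).scomp s (hasDerivAt_neg s)).congr_deriv (by simp))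
      (fun s hs => by simpa using hf' _ (hmem s hs)) (neg_nonneg.2 h) (by linarith [ht.1])
    simpa [abs_of_nonpos h] using hle

/-- The squared homogeneous Sobolev norm of order `s` of the modes in `S`. -/
noncomputable def sobolevEnergy (S : Finset ℤ) (s : ℕ) (c : ℤ → ℂ) : ℝ :=
  ∑ k ∈ S, (|(k : ℝ)| ^ s * ‖c k‖) ^ 2

section SobolevEnergy

variable {S : Finset ℤ} {c : ℤ → ℂ}

theorem sobolevEnergy_nonneg (S : Finset ℤ) (s : ℕ) (c : ℤ → ℂ) : 0 ≤ sobolevEnergy S s c :=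
  Finset.sum_nonneg fun _ _ => sq_nonneg _

theorem sq_le_sobolevEnergy (hc : ∀ k ∉ S, c k = 0) (s : ℕ) (k : ℤ) :
    (|(k : ℝ)| ^ s * ‖c k‖) ^ 2 ≤ sobolevEnergy S s c := by
  by_cases hk : k ∈ S
  · exact Finset.single_le_sum (f := fun k : ℤ => (|(k : ℝ)| ^ s * ‖c k‖) ^ 2)
      (fun _ _ => sq_nonneg _) hk
  · simpa [hc k hk] using sobolevEnergy_nonneg S s c

theorem hasDerivAt_sobolevEnergy {c : ℝ → ℤ → ℂ} {c' : ℤ → ℂ} {t : ℝ}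
    (hc : ∀ k ∈ S, HasDerivAt (fun t => c t k) (c' k) t) (s : ℕ) :
    HasDerivAt (fun t => sobolevEnergy S s (c t))
      (2 * (∑ k ∈ S, (k : ℂ) ^ (2 * s) * conj (c t k) * c' k).re) t := by
  rw [Complex.re_sum, Finset.mul_sum]
  refine HasDerivAt.fun_sum fun k hk => ?_
  simp only [mul_pow]
  refine ((hc k hk).norm_sq.const_mul ((|(k : ℝ)| ^ s) ^ 2)).congr_deriv ?_
  rw [← pow_mul, mul_comm s 2, (even_two_mul s).pow_abs, mul_assoc ((k : ℂ) ^ (2 * s)),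
    ← Complex.ofReal_intCast, ← Complex.ofReal_pow, Complex.re_ofReal_mul, Complex.inner,
    mul_comm (c' k)]
  ring

theorem abs_intCast_le_sq (k : ℤ) : |(k : ℝ)| ≤ |(k : ℝ)| ^ 2 := by
  exact_mod_cast Int.le_self_sq |k|

theorem norm_multiplier_mul_le {a : ℝ} (ha : 0 < a) (m : ℤ) (z : ℂ) :
    ‖multiplier a m * z‖ ≤ 2 * (|(m : ℝ)| ^ 2 * ‖z‖) := by
  rcases eq_or_ne m 0 with rfl | hm
  · simp [multiplier_zero]
  · have hm_abs : (1 : ℝ) ≤ |(m : ℝ)| := by exact_mod_cast Int.one_le_abs hm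
    rw [norm_mul]
    exact mul_le_mul_of_nonneg (norm_multiplier_le ha m)
      (le_mul_of_one_le_left (norm_nonneg z) (one_le_pow₀ hm_abs)) (norm_nonneg _) (by positivity)

theorem norm_advection_le_of_sobolevEnergy_le {a Q : ℝ} (ha : 0 < a) (hc : ∀ k ∉ S, c k = 0)
    (hQ : sobolevEnergy S 2 c ≤ Q) (k : ℤ) : ‖advection a c k‖ ≤ S.card * (2 * Q) := by
  rw [advection_eq_sum a hc, ← nsmul_eq_mul]
  refine (norm_sum_le _ _).trans (Finset.sum_le_card_nsmul S _ _ fun m _ => ?_)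
  have hderiv : ‖Complex.I * ((k - m : ℤ) : ℂ) * c (k - m)‖ ≤
      |((k - m : ℤ) : ℝ)| ^ 2 * ‖c (k - m)‖ := by
    rw [norm_mul, norm_mul, Complex.norm_I, one_mul, Complex.norm_intCast]
    exact mul_le_mul_of_nonneg_right (abs_intCast_le_sq _) (norm_nonneg _)
  calc ‖multiplier a m * c m * (Complex.I * ((k - m : ℤ) : ℂ) * c (k - m))‖
      ≤ 2 * (|(m : ℝ)| ^ 2 * ‖c m‖) * (|((k - m : ℤ) : ℝ)| ^ 2 * ‖c (k - m)‖) := by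
        rw [norm_mul]
        exact mul_le_mul (norm_multiplier_mul_le ha m _) hderiv (norm_nonneg _) (by positivity)
    _ ≤ (|(m : ℝ)| ^ 2 * ‖c m‖) ^ 2 + (|((k - m : ℤ) : ℝ)| ^ 2 * ‖c (k - m)‖) ^ 2 :=
        two_mul_le_add_sq _ _
    _ ≤ 2 * Q := by linarith [sq_le_sobolevEnergy hc 2 m, sq_le_sobolevEnergy hc 2 (k - m)]

theorem abs_mul_norm_le_weight_add (k : ℤ) (z : ℂ) :
    |(k : ℝ)| * ‖z‖ ≤ weight k + (1 / 2) * (|(k : ℝ)| ^ 2 * ‖z‖) ^ 2 := by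
  rcases eq_or_ne k 0 with rfl | hk
  · simpa using (weight_pos 0).le
  · have hk_abs : (1 : ℝ) ≤ |(k : ℝ)| := by exact_mod_cast Int.one_le_abs hk
    have hweight : 1 / (2 * |(k : ℝ)| ^ 2) ≤ weight k := by
      rw [weight, ← sq_abs (k : ℝ)]
      exact one_div_le_one_div_of_le (by positivity) (by nlinarith)
    calc |(k : ℝ)| * ‖z‖ = 1 / |(k : ℝ)| * (|(k : ℝ)| ^ 2 * ‖z‖) := by field_simp
      _ ≤ (1 / 2) * (1 / |(k : ℝ)|) ^ 2 + (1 / 2) * (|(k : ℝ)| ^ 2 * ‖z‖) ^ 2 := by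
          linarith [two_mul_le_add_sq (1 / |(k : ℝ)|) (|(k : ℝ)| ^ 2 * ‖z‖)]
      _ = 1 / (2 * |(k : ℝ)| ^ 2) + (1 / 2) * (|(k : ℝ)| ^ 2 * ‖z‖) ^ 2 := by field_simp
      _ ≤ _ := by gcongr

theorem sum_abs_mul_norm_le (S : Finset ℤ) (c : ℤ → ℂ) :
    ∑ k ∈ S, |(k : ℝ)| * ‖c k‖ ≤ weightSum + (1 / 2) * sobolevEnergy S 2 c := by
  have hweight : ∑ k ∈ S, weight k ≤ weightSum :=
    summable_weight.sum_le_tsum S fun k _ => (weight_pos k).le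
  calc ∑ k ∈ S, |(k : ℝ)| * ‖c k‖
      ≤ ∑ k ∈ S, (weight k + (1 / 2) * (|(k : ℝ)| ^ 2 * ‖c k‖) ^ 2) :=
        Finset.sum_le_sum fun k _ => abs_mul_norm_le_weight_add k (c k)
    _ = ∑ k ∈ S, weight k + (1 / 2) * sobolevEnergy S 2 c := by
        rw [Finset.sum_add_distrib, ← Finset.mul_sum, sobolevEnergy]
    _ ≤ _ := by gcongr

end SobolevEnergy

/-- A smooth cutoff, equal to `1` on `(-∞, R]` and to `0` on `[2R, ∞)`. -/
noncomputable def cutoff (R y : ℝ) : ℝ := Real.smoothTransition (2 - y / R)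

theorem cutoff_nonneg (R y : ℝ) : 0 ≤ cutoff R y := Real.smoothTransition.nonneg _

theorem cutoff_le_one (R y : ℝ) : cutoff R y ≤ 1 := Real.smoothTransition.le_one _

theorem cutoff_eq_one {R y : ℝ} (hR : 0 < R) (h : y ≤ R) : cutoff R y = 1 :=
  Real.smoothTransition.one_of_one_le (by linarith [(div_le_one hR).2 h])

theorem cutoff_eq_zero {R y : ℝ} (hR : 0 < R) (h : 2 * R ≤ y) : cutoff R y = 0 :=
  Real.smoothTransition.zero_of_nonpos (by linarith [(le_div_iff₀ hR).2 h])

theorem contDiff_cutoff (R : ℝ) : ContDiff ℝ 1 (cutoff R) :=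
  Real.smoothTransition.contDiff.comp (contDiff_const.sub (contDiff_id.div_const R))

theorem cutoff_mul_sum_le {R : ℝ} (hR : 0 < R) (S : Finset ℤ) (c : ℤ → ℂ) :
    cutoff R (sobolevEnergy S 2 c) * ∑ k ∈ S, |(k : ℝ)| * ‖c k‖ ≤ weightSum + R := by
  rcases le_total (2 * R) (sobolevEnergy S 2 c) with h | h
  · rw [cutoff_eq_zero hR h, zero_mul]
    exact add_nonneg weightSum_nonneg hR.le
  · refine (mul_le_of_le_one_left (by positivity) (cutoff_le_one _ _)).trans ?_
    linarith [sum_abs_mul_norm_le S c]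

/-- Extension by zero of a family of coefficients. -/
noncomputable def extendCoef (S : Finset ℤ) (c : S → ℂ) (k : ℤ) : ℂ :=
  if h : k ∈ S then c ⟨k, h⟩ else 0

theorem extendCoef_of_notMem {S : Finset ℤ} (c : S → ℂ) {k : ℤ} (h : k ∉ S) :
    extendCoef S c k = 0 := dif_neg h

theorem extendCoef_coe {S : Finset ℤ} (c : S → ℂ) (k : S) : extendCoef S c k = c k :=
  dif_pos k.2

theorem contDiff_extendCoef (S : Finset ℤ) (k : ℤ) :
    ContDiff ℝ 1 fun c : S → ℂ => extendCoef S c k := by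
  unfold extendCoef
  split_ifs with h
  · exact contDiff_apply ℝ ℂ (⟨k, h⟩ : S)
  · exact contDiff_const

/-- The speed `g` of the advection term, cut off where the `H²` energy is large. -/
noncomputable def cutoffSpeed (g R : ℝ) (S : Finset ℤ) (c : ℤ → ℂ) : ℝ :=
  cutoff R (sobolevEnergy S 2 c) * g

/-- The vector field of the truncated system for the modes in `S`. The cutoff makes it bounded. -/
noncomputable def galerkinField (a g R : ℝ) (S : Finset ℤ) (c : S → ℂ) (k : S) : ℂ :=
  -(cutoffSpeed g R S (extendCoef S c) : ℂ) * advection a (extendCoef S c) k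

section GalerkinField

variable {a g R : ℝ} {S : Finset ℤ}

theorem contDiff_galerkinField (a g R : ℝ) (S : Finset ℤ) :
    ContDiff ℝ 1 (galerkinField a g R S) := by
  refine contDiff_pi.2 fun k => ?_
  have henergy : ContDiff ℝ 1 fun c => sobolevEnergy S 2 (extendCoef S c) := by
    simp only [sobolevEnergy, mul_pow]
    exact ContDiff.sum fun j _ => contDiff_const.mul ((contDiff_extendCoef S j).norm_sq ℝ)
  have hadvection : ContDiff ℝ 1 fun c => advection a (extendCoef S c) k := by
    simp only [fun c => advection_eq_sum a (fun _ => extendCoef_of_notMem (S := S) c) (k : ℤ)]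
    exact ContDiff.sum fun m _ => (contDiff_const.mul (contDiff_extendCoef S m)).mul
      (contDiff_const.mul (contDiff_extendCoef S _))
  exact (Complex.ofRealCLM.contDiff.comp
    (((contDiff_cutoff R).comp henergy).mul contDiff_const)).neg.mul hadvection

theorem norm_galerkinField_le (ha : 0 < a) (hR : 0 < R) (c : S → ℂ) :
    ‖galerkinField a g R S c‖ ≤ |g| * (S.card * (2 * (2 * R))) := by
  refine (pi_norm_le_iff_of_nonneg (by positivity)).2 fun k => ?_
  rcases le_total (2 * R) (sobolevEnergy S 2 (extendCoef S c)) with h | h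
  · rw [galerkinField, cutoffSpeed, cutoff_eq_zero hR h]
    simp only [zero_mul, Complex.ofReal_zero, neg_zero, norm_zero]
    positivity
  · rw [galerkinField, norm_mul, norm_neg, Complex.norm_real, Real.norm_eq_abs, cutoffSpeed,
      abs_mul, abs_of_nonneg (cutoff_nonneg _ _)]
    exact mul_le_mul (mul_le_of_le_one_left (abs_nonneg g) (cutoff_le_one _ _))
      (norm_advection_le_of_sobolevEnergy_le ha (fun _ => extendCoef_of_notMem c) h k)
      (norm_nonneg _) (abs_nonneg g)

/-- The action of complex conjugation of functions on the Fourier coefficients in a symmetric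
set `S` of modes. -/
noncomputable def reflectCoef (hS : ∀ k ∈ S, -k ∈ S) (c : S → ℂ) (k : S) : ℂ :=
  conj (c ⟨-k, hS k k.2⟩)

theorem extendCoef_reflectCoef (hS : ∀ k ∈ S, -k ∈ S) (c : S → ℂ) (k : ℤ) :
    extendCoef S (reflectCoef hS c) k = conj (extendCoef S c (-k)) := by
  by_cases hk : k ∈ S
  · exact (extendCoef_coe (reflectCoef hS c) ⟨k, hk⟩).trans
      (congrArg conj (extendCoef_coe c ⟨-k, hS k hk⟩).symm)
  · have hk' : -k ∉ S := fun h => hk (by simpa using hS _ h)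
    rw [extendCoef_of_notMem _ hk, extendCoef_of_notMem _ hk', map_zero]

theorem sobolevEnergy_conj_neg (hS : ∀ k ∈ S, -k ∈ S) (s : ℕ) (c : ℤ → ℂ) :
    sobolevEnergy S s (fun k => conj (c (-k))) = sobolevEnergy S s c := by
  refine Finset.sum_bij (fun k _ => -k) (fun k hk => hS k hk) (fun _ _ _ _ h => neg_inj.1 h)
    (fun k hk => ⟨-k, hS k hk, neg_neg k⟩) fun k _ => ?_
  rw [Complex.norm_conj, Int.cast_neg, abs_neg]

theorem galerkinField_reflectCoef (hS : ∀ k ∈ S, -k ∈ S) (c : S → ℂ) :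
    galerkinField a g R S (reflectCoef hS c) = reflectCoef hS (galerkinField a g R S c) := by
  have hextend : extendCoef S (reflectCoef hS c) = fun k => conj (extendCoef S c (-k)) :=
    funext (extendCoef_reflectCoef hS c)
  ext k
  rw [galerkinField, hextend, ← conj_advection_neg, cutoffSpeed, sobolevEnergy_conj_neg hS,
    reflectCoef, galerkinField, map_mul, map_neg, Complex.conj_ofReal, cutoffSpeed]

end GalerkinField

/-- `c` solves on `(-τ, τ)` the truncation of the equation to the modes in `S`, where the advection
term has the speed `v (c t)` at time `t`, and `c t` are the coefficients of a real function. -/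
structure IsGalerkinSolution (a : ℝ) (v : (ℤ → ℂ) → ℝ) (S : Finset ℤ) (τ : ℝ)
    (c : ℝ → ℤ → ℂ) : Prop where
  eq_zero : ∀ t, ∀ k ∉ S, c t k = 0
  conj_eq : ∀ t ∈ Ioo (-τ) τ, ∀ k, conj (c t k) = c t (-k)
  hasDerivAt : ∀ t ∈ Ioo (-τ) τ, ∀ k ∈ S,
    HasDerivAt (fun t => c t k) (-(v (c t) : ℂ) * advection a (c t) k) t

theorem exists_isGalerkinSolution_cutoffSpeed {a g R τ : ℝ} (ha : 0 < a) (hR : 0 < R) (hτ : 0 < τ)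
    {S : Finset ℤ} (hS : ∀ k ∈ S, -k ∈ S) {b : ℤ → ℂ} (hb : ∀ k, conj (b k) = b (-k)) :
    ∃ c, IsGalerkinSolution a (cutoffSpeed g R S) S τ c ∧ ∀ k ∈ S, c 0 k = b k := by
  obtain ⟨α, hα0, hα⟩ := exists_hasDerivAt_of_norm_le (contDiff_galerkinField a g R S)
    (norm_galerkinField_le ha hR) (fun k : S => b k) hτ
  have hreflect : EqOn α (fun t => reflectCoef hS (α t)) (Ioo (-τ) τ) := by
    refine eqOn_of_hasDerivAt_of_norm_le (contDiff_galerkinField a g R S)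
      (norm_galerkinField_le ha hR) hα (fun t ht => ?_) ?_
    · rw [galerkinField_reflectCoef]
      exact hasDerivAt_pi.2 fun k => (hasDerivAt_pi.1 (hα t ht) _).star
    · ext k
      simp only [hα0, reflectCoef, hb, neg_neg]
  refine ⟨fun t => extendCoef S (α t), ⟨fun t k => extendCoef_of_notMem _, fun t ht k => ?_,
    fun t ht k hk => ?_⟩, fun k hk => ?_⟩
  · have hα_reflect : α t = reflectCoef hS (α t) := hreflect ht
    have heq := extendCoef_reflectCoef hS (α t) (-k)
    rw [← hα_reflect, neg_neg] at heq
    exact heq.symm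
  · exact (hasDerivAt_pi.1 (hα t ht) ⟨k, hk⟩).congr_of_eventuallyEq
      (Eventually.of_forall fun t => extendCoef_coe (α t) ⟨k, hk⟩)
  · simpa only [hα0] using extendCoef_coe (fun k : S => b k) ⟨k, hk⟩

theorem IsGalerkinSolution.sobolevEnergy_le {a τ M : ℝ} (ha : 0 < a) {v : (ℤ → ℂ) → ℝ}
    {S : Finset ℤ} {c : ℝ → ℤ → ℂ} (hc : IsGalerkinSolution a v S τ c)
    (hM : ∀ t ∈ Ioo (-τ) τ, |v (c t)| * ∑ k ∈ S, |(k : ℝ)| * ‖c t k‖ ≤ M) (s : ℕ)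
    {t : ℝ} (ht : t ∈ Ioo (-τ) τ) :
    sobolevEnergy S s (c t) ≤
      sobolevEnergy S s (c 0) * Real.exp (2 * (3 * ((2 * s + 1 : ℕ) * 2 ^ s)) * M * |t|) := by
  have hnorm (t : ℝ) : ‖sobolevEnergy S s (c t)‖ = sobolevEnergy S s (c t) :=
    Real.norm_of_nonneg (sobolevEnergy_nonneg _ _ _)
  rw [← hnorm t, ← hnorm 0]
  refine norm_le_norm_mul_exp_of_norm_deriv_le (f := fun t => sobolevEnergy S s (c t))
    (fun t ht => hasDerivAt_sobolevEnergy (hc.hasDerivAt t ht) s) (fun t ht => ?_) ht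
  let G : ℂ := ∑ k ∈ S, (k : ℂ) ^ (2 * s) * conj (c t k) * advection a (c t) k
  have hsum : ∑ k ∈ S, (k : ℂ) ^ (2 * s) * conj (c t k) * (-(v (c t) : ℂ) * advection a (c t) k) =
      -(v (c t) : ℂ) * G := by
    rw [Finset.mul_sum]
    exact Finset.sum_congr rfl fun k _ => by ring
  have hG : ‖G‖ ≤ (3 * ((2 * s + 1 : ℕ) * 2 ^ s) : ℝ) * (∑ k ∈ S, |(k : ℝ)| * ‖c t k‖) *
      sobolevEnergy S s (c t) :=
    norm_sum_pow_mul_conj_mul_advection_le ha (hc.eq_zero t) (hc.conj_eq t ht) s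
  have henergy := sobolevEnergy_nonneg S s (c t)
  rw [hsum, hnorm, norm_mul, Real.norm_eq_abs, abs_two]
  calc 2 * |(-(v (c t) : ℂ) * G).re| ≤ 2 * (|v (c t)| * ‖G‖) := by
        refine mul_le_mul_of_nonneg_left ((Complex.abs_re_le_norm _).trans_eq ?_) two_pos.le
        rw [norm_mul, norm_neg, Complex.norm_real, Real.norm_eq_abs]
    _ ≤ 2 * (|v (c t)| * ((3 * ((2 * s + 1 : ℕ) * 2 ^ s) : ℝ) *
          (∑ k ∈ S, |(k : ℝ)| * ‖c t k‖) * sobolevEnergy S s (c t))) := by gcongr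
    _ = 2 * (3 * ((2 * s + 1 : ℕ) * 2 ^ s)) * (|v (c t)| * ∑ k ∈ S, |(k : ℝ)| * ‖c t k‖) *
          sobolevEnergy S s (c t) := by ring
    _ ≤ _ := by
        have := hM t ht
        gcongr

/-- The exponential growth rate of the Sobolev energy of order `s` under the truncated system with
cutoff at `R`. -/
noncomputable def growthRate (g R : ℝ) (s : ℕ) : ℝ :=
  2 * (3 * ((2 * s + 1 : ℕ) * 2 ^ s)) * (|g| * (weightSum + R))

theorem growthRate_nonneg {g R : ℝ} (hR : 0 < R) (s : ℕ) : 0 ≤ growthRate g R s := by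
  have := weightSum_nonneg
  unfold growthRate
  positivity

theorem exists_isGalerkinSolution {a g R τ : ℝ} (ha : 0 < a) (hR : 0 < R) (hτ : 0 < τ)
    (hτR : growthRate g R 2 * τ ≤ Real.log 2) {S : Finset ℤ} (hS : ∀ k ∈ S, -k ∈ S) {b : ℤ → ℂ}
    (hb : ∀ k, conj (b k) = b (-k)) (hbR : 2 * sobolevEnergy S 2 b ≤ R) :
    ∃ c, IsGalerkinSolution a (fun _ => g) S τ c ∧ (∀ k ∈ S, c 0 k = b k) ∧
      ∀ t ∈ Ioo (-τ) τ, ∀ s,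
        sobolevEnergy S s (c t) ≤ sobolevEnergy S s b * Real.exp (growthRate g R s * τ) := by
  obtain ⟨c, hc, hc0⟩ := exists_isGalerkinSolution_cutoffSpeed (g := g) ha hR hτ hS hb
  have hspeed (t : ℝ) :
      |cutoffSpeed g R S (c t)| * ∑ k ∈ S, |(k : ℝ)| * ‖c t k‖ ≤ |g| * (weightSum + R) := by
    rw [cutoffSpeed, abs_mul, abs_of_nonneg (cutoff_nonneg _ _), mul_comm (cutoff _ _), mul_assoc]
    exact mul_le_mul_of_nonneg_left (cutoff_mul_sum_le hR S (c t)) (abs_nonneg g)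
  have henergy (t : ℝ) (ht : t ∈ Ioo (-τ) τ) (s : ℕ) :
      sobolevEnergy S s (c t) ≤ sobolevEnergy S s b * Real.exp (growthRate g R s * τ) := by
    have hinit : sobolevEnergy S s (c 0) = sobolevEnergy S s b :=
      Finset.sum_congr rfl fun k hk => by rw [hc0 k hk]
    have hle := hc.sobolevEnergy_le ha (fun t _ => hspeed t) s ht
    rw [hinit] at hle
    refine hle.trans (mul_le_mul_of_nonneg_left (Real.exp_le_exp.2 ?_)
      (sobolevEnergy_nonneg _ _ _))
    exact mul_le_mul_of_nonneg_left (abs_lt.2 ht).le (growthRate_nonneg hR s)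
  refine ⟨c, ⟨hc.eq_zero, hc.conj_eq, fun t ht k hk => ?_⟩, hc0, henergy⟩
  have hbelow : sobolevEnergy S 2 (c t) ≤ R := by
    refine (henergy t ht 2).trans (le_trans ?_ hbR)
    rw [mul_comm]
    refine mul_le_mul_of_nonneg_right ?_ (sobolevEnergy_nonneg _ _ _)
    exact (Real.exp_le_exp.2 hτR).trans_eq (Real.exp_log two_pos)
  have hderiv := hc.hasDerivAt t ht k hk
  rwa [cutoffSpeed, cutoff_eq_one hR hbelow, one_mul] at hderiv

/-! ### Solving the equation for the Fourier coefficients -/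

section Lipschitz

variable {E : Type*} [NormedAddCommGroup E] [NormedSpace ℝ E] {J : Set ℝ} {K : NNReal}

theorem norm_sub_sub_smul_le_of_lipschitzOnWith (hJ : J.OrdConnected) {f f' : ℝ → E}
    (hf : ∀ t ∈ J, HasDerivAt f (f' t) t) (hK : LipschitzOnWith K f' J) {s t : ℝ} (hs : s ∈ J)
    (ht : t ∈ J) : ‖f t - f s - (t - s) • f' s‖ ≤ K * |t - s| * |t - s| := by
  have hst : uIcc s t ⊆ J := hJ.uIcc_subset hs ht
  have hmean := Convex.norm_image_sub_le_of_norm_hasDerivWithin_le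
    (f := fun r => f r - (r - s) • f' s) (f' := fun r => f' r - f' s) (C := K * |t - s|)
    (fun r hr => (((hf r (hst hr)).sub (((hasDerivAt_id r).sub_const s).smul_const
      (f' s))).congr_deriv (by rw [one_smul])).hasDerivWithinAt)
    (fun r hr => (hK.norm_sub_le (hst hr) hs).trans
      (mul_le_mul_of_nonneg_left (abs_sub_left_of_mem_uIcc hr) K.2))
    (convex_uIcc s t) left_mem_uIcc right_mem_uIcc
  simpa [sub_right_comm] using hmean

theorem hasDerivAt_of_tendsto_of_lipschitzOnWith (hJ : IsOpen J) (hJ' : J.OrdConnected)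
    {ι : Type*} {l : Filter ι} [l.NeBot] {f f' : ι → ℝ → E} {F F' : ℝ → E}
    (hf : ∀ᶠ i in l, ∀ t ∈ J, HasDerivAt (f i) (f' i t) t)
    (hK : ∀ i, LipschitzOnWith K (f' i) J)
    (hF : ∀ t ∈ J, Tendsto (fun i => f i t) l (𝓝 (F t)))
    (hF' : ∀ t ∈ J, Tendsto (fun i => f' i t) l (𝓝 (F' t))) {s : ℝ} (hs : s ∈ J) :
    HasDerivAt F (F' s) s := by
  rw [hasDerivAt_iff_isLittleO]
  have hquadratic : (fun t => F t - F s - (t - s) • F' s) =O[𝓝 s] fun t => (t - s) ^ 2 := by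
    refine Asymptotics.IsBigO.of_bound K ?_
    filter_upwards [hJ.mem_nhds hs] with t ht
    rw [Real.norm_eq_abs, abs_pow, sq, ← mul_assoc]
    refine le_of_tendsto (((hF t ht).sub (hF s hs)).sub ((hF' s hs).const_smul (t - s))).norm ?_
    filter_upwards [hf] with i hi
    exact norm_sub_sub_smul_le_of_lipschitzOnWith hJ' hi (hK i) hs ht
  refine hquadratic.trans_isLittleO ?_
  simpa using Asymptotics.isLittleO_pow_sub_sub s (m := 2) one_lt_two

end Lipschitz

theorem exists_tendsto_of_norm_le {E ι : Type*} [SeminormedAddCommGroup E] [ProperSpace E]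
    (U : Ultrafilter ι) {z : ι → E} {C : ℝ} (hz : ∀ i, ‖z i‖ ≤ C) :
    ∃ w, Tendsto z U (𝓝 w) := by
  obtain ⟨w, _, hw⟩ := (isCompact_closedBall (0 : E) C).ultrafilter_le_nhds (U.map z)
    (le_principal_iff.2 (mem_map.2 (Eventually.of_forall fun i =>
      mem_closedBall_zero_iff.2 (hz i))))
  exact ⟨w, hw⟩

section DecayAdvection

variable {a : ℝ} {B D : ℕ → ℝ} {b c d : ℤ → ℂ}

theorem Decay.advection (ha : 0 < a) (hc : Decay B c) :
    Decay (fun s => 2 ^ s * (((2 * B s + 2 * B (s + 2)) * weightSum) * B (0 + 1)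
      + ((2 * B 0 + 2 * B 2) * weightSum) * B (s + 1))) (advection a c) :=
  (hc.mul_left (norm_multiplier_le ha)).conv hc.deriv

theorem Decay.norm_mul_abs_sub_le (hd : Decay D d) (k m : ℤ) :
    ‖d m‖ * |((k - m : ℤ) : ℝ)| ≤ (|(k : ℝ)| * (D 0 + D 2) + (D 1 + D 3)) * weight m := by
  have htriangle : |((k - m : ℤ) : ℝ)| ≤ |(k : ℝ)| + |(m : ℝ)| := by
    push_cast
    exact abs_sub _ _
  have hderiv : |(m : ℝ)| * ‖d m‖ ≤ (D 1 + D 3) * weight m := by simpa using hd.le_weight 1 m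
  calc ‖d m‖ * |((k - m : ℤ) : ℝ)| ≤ |(k : ℝ)| * ‖d m‖ + |(m : ℝ)| * ‖d m‖ := by
        rw [← add_mul, mul_comm]
        exact mul_le_mul_of_nonneg_right htriangle (norm_nonneg _)
    _ ≤ |(k : ℝ)| * ((D 0 + D 2) * weight m) + (D 1 + D 3) * weight m :=
        add_le_add (mul_le_mul_of_nonneg_left (hd.norm_le_weight m) (abs_nonneg _)) hderiv
    _ = _ := by ring

theorem Decay.norm_advection_term_sub_le (ha : 0 < a) (hc : Decay D c) (hd : Decay D d) {ε : ℝ}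
    (hε : ∀ k, ‖c k - d k‖ ≤ ε) (k m : ℤ) :
    ‖multiplier a m * c m * (Complex.I * (k - m : ℤ) * c (k - m)) -
        multiplier a m * d m * (Complex.I * (k - m : ℤ) * d (k - m))‖ ≤
      2 * (ε * ((D 1 + D 3) * weight (k - m)) +
        ((|(k : ℝ)| * (D 0 + D 2) + (D 1 + D 3)) * weight m) * ε) := by
  have hsplit : multiplier a m * c m * (Complex.I * (k - m : ℤ) * c (k - m)) -
      multiplier a m * d m * (Complex.I * (k - m : ℤ) * d (k - m)) =
      multiplier a m * ((c m - d m) * (Complex.I * (k - m : ℤ) * c (k - m))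
        + d m * (Complex.I * (k - m : ℤ)) * (c (k - m) - d (k - m))) := by ring
  have hfreq : ‖Complex.I * (k - m : ℤ)‖ = |((k - m : ℤ) : ℝ)| := by
    rw [norm_mul, Complex.norm_I, one_mul, Complex.norm_intCast]
  have hderiv : |((k - m : ℤ) : ℝ)| * ‖c (k - m)‖ ≤ (D 1 + D 3) * weight (k - m) := by
    simpa using hc.le_weight 1 (k - m)
  have hd_le := hd.norm_mul_abs_sub_le k m
  have hε0 : 0 ≤ ε := (norm_nonneg _).trans (hε 0)
  rw [hsplit, norm_mul]
  refine mul_le_mul (norm_multiplier_le ha m) ((norm_add_le _ _).trans (add_le_add ?_ ?_))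
    (norm_nonneg _) zero_le_two
  · rw [norm_mul, norm_mul _ (c (k - m)), hfreq]
    exact mul_le_mul (hε m) hderiv (by positivity) hε0
  · rw [norm_mul, norm_mul (d m), hfreq]
    exact mul_le_mul hd_le (hε _) (norm_nonneg _) (le_trans (by positivity) hd_le)

theorem Decay.norm_advection_sub_le (ha : 0 < a) (hc : Decay D c) (hd : Decay D d) {ε : ℝ}
    (hε : ∀ k, ‖c k - d k‖ ≤ ε) (k : ℤ) :
    ‖IPM1D.advection a c k - IPM1D.advection a d k‖ ≤
      2 * (ε * ((D 1 + D 3) * weightSum) +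
        ((|(k : ℝ)| * (D 0 + D 2) + (D 1 + D 3)) * weightSum) * ε) := by
  have hc_summable := (hc.mul_left (norm_multiplier_le ha)).summable_conv hc.deriv k
  have hd_summable := (hd.mul_left (norm_multiplier_le ha)).summable_conv hd.deriv k
  have hw : HasSum weight weightSum := summable_weight.hasSum
  have hw_sub : HasSum (fun m => weight (k - m)) weightSum := (Equiv.subLeft k).hasSum_iff.2 hw
  rw [IPM1D.advection, IPM1D.advection, IPM1D.conv, IPM1D.conv,
    ← hc_summable.tsum_sub hd_summable]
  exact tsum_of_norm_bounded
    ((((hw_sub.mul_left _).mul_left ε).add ((hw.mul_left _).mul_right ε)).mul_left 2)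
    (hc.norm_advection_term_sub_le ha hd hε k)

theorem Decay.sobolevEnergy_le (hb : Decay B b) (S : Finset ℤ) (s : ℕ) :
    sobolevEnergy S s b ≤ B s * ((B s + B (s + 2)) * weightSum) := by
  have hB (r : ℕ) : 0 ≤ B r := le_trans (by positivity) (hb r 0)
  have hweight : ∑ k ∈ S, weight k ≤ weightSum :=
    summable_weight.sum_le_tsum S fun k _ => (weight_pos k).le
  calc sobolevEnergy S s b ≤ ∑ k ∈ S, B s * ((B s + B (s + 2)) * weight k) :=
        Finset.sum_le_sum fun k _ => by
          rw [sq]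
          exact mul_le_mul (hb s k) (hb.le_weight s k) (by positivity) (hB s)
    _ = B s * ((B s + B (s + 2)) * ∑ k ∈ S, weight k) := by
        rw [← Finset.mul_sum, ← Finset.mul_sum]
    _ ≤ _ := mul_le_mul_of_nonneg_left
        (mul_le_mul_of_nonneg_left hweight (add_nonneg (hB s) (hB _))) (hB s)

theorem abs_pow_mul_norm_le_one_add_sobolevEnergy {S : Finset ℤ} (hc : ∀ k ∉ S, c k = 0) (s : ℕ)
    (k : ℤ) : |(k : ℝ)| ^ s * ‖c k‖ ≤ 1 + sobolevEnergy S s c := by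
  have hsq := sq_le_sobolevEnergy hc s k
  nlinarith [sq_nonneg (|(k : ℝ)| ^ s * ‖c k‖ - 1)]

variable {ι : Type*} {l : Filter ι} {C : ι → ℤ → ℂ}

theorem Decay.of_tendsto [l.NeBot] (hC : ∀ i, Decay D (C i))
    (hlim : ∀ k, Tendsto (fun i => C i k) l (𝓝 (c k))) : Decay D c := fun s k =>
  le_of_tendsto ((hlim k).norm.const_mul _) (Eventually.of_forall fun i => hC i s k)

theorem tendsto_advection (ha : 0 < a) (hC : ∀ i, Decay D (C i))
    (hlim : ∀ k, Tendsto (fun i => C i k) l (𝓝 (c k))) (k : ℤ) :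
    Tendsto (fun i => advection a (C i) k) l (𝓝 (advection a c k)) :=
  tendsto_tsum_of_dominated_convergence
    ((summable_weight.mul_left (2 * D 0 + 2 * D 2)).mul_right (D (0 + 1)))
    (fun m => ((hlim m).const_mul _).mul ((hlim (k - m)).const_mul _))
    (Eventually.of_forall fun i m =>
      ((hC i).mul_left (norm_multiplier_le ha)).norm_conv_term_le (hC i).deriv k m)

end DecayAdvection

section GalerkinLimit

variable {a g R τ : ℝ} {B D : ℕ → ℝ} {b : ℤ → ℂ}

theorem exists_isGalerkinSolution_decay (ha : 0 < a) (hR : 0 < R) (hτ : 0 < τ)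
    (hτR : growthRate g R 2 * τ ≤ Real.log 2) (hB : Decay B b)
    (hb : ∀ k, conj (b k) = b (-k)) (hbR : ∀ S, 2 * sobolevEnergy S 2 b ≤ R) :
    ∃ D, ∀ S : Finset ℤ, (∀ k ∈ S, -k ∈ S) → ∃ c, IsGalerkinSolution a (fun _ => g) S τ c ∧
      (∀ k ∈ S, c 0 k = b k) ∧ ∀ t ∈ Ioo (-τ) τ, Decay D (c t) := by
  refine ⟨fun s => 1 + B s * ((B s + B (s + 2)) * weightSum) * Real.exp (growthRate g R s * τ),
    fun S hS => ?_⟩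
  obtain ⟨c, hc, hc0, hcE⟩ := exists_isGalerkinSolution ha hR hτ hτR hS hb (hbR S)
  refine ⟨c, hc, hc0, fun t ht s k => ?_⟩
  refine (abs_pow_mul_norm_le_one_add_sobolevEnergy (hc.eq_zero t) s k).trans
    (add_le_add_right ((hcE t ht s).trans ?_) 1)
  exact mul_le_mul_of_nonneg_right (hB.sobolevEnergy_le S s) (Real.exp_pos _).le

theorem norm_neg_ofReal_mul (g : ℝ) (z : ℂ) : ‖-(g : ℂ) * z‖ = |g| * ‖z‖ := by
  rw [norm_mul, norm_neg, Complex.norm_real, Real.norm_eq_abs]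

theorem exists_norm_isGalerkinSolution_sub_le (ha : 0 < a) (g τ : ℝ) (D : ℕ → ℝ) :
    ∃ P, ∀ S c, IsGalerkinSolution a (fun _ => g) S τ c → (∀ t ∈ Ioo (-τ) τ, Decay D (c t)) →
      ∀ t ∈ Ioo (-τ) τ, ∀ s ∈ Ioo (-τ) τ, ∀ k, ‖c t k - c s k‖ ≤ P * |t - s| := by
  obtain ⟨D', hD'⟩ : ∃ D', ∀ c, Decay D c → Decay D' (advection a c) :=
    ⟨_, fun c hc => hc.advection ha⟩
  refine ⟨|g| * D' 0, fun S c hc hcD t ht s hs k => ?_⟩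
  have hspeed (r : ℝ) (hr : r ∈ Ioo (-τ) τ) : ‖-(g : ℂ) * advection a (c r) k‖ ≤ |g| * D' 0 := by
    rw [norm_neg_ofReal_mul]
    exact mul_le_mul_of_nonneg_left ((hD' _ (hcD r hr)).norm_le k) (abs_nonneg g)
  by_cases hk : k ∈ S
  · exact Convex.norm_image_sub_le_of_norm_hasDerivWithin_le (f := fun t => c t k)
      (fun r hr => (hc.hasDerivAt r hr k hk).hasDerivWithinAt) hspeed (convex_Ioo _ _) hs ht
  · rw [hc.eq_zero t k hk, hc.eq_zero s k hk, sub_zero, norm_zero]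
    exact mul_nonneg ((norm_nonneg _).trans (hspeed t ht)) (abs_nonneg _)

theorem exists_lipschitzOnWith_advection (ha : 0 < a) (g τ : ℝ) (D : ℕ → ℝ) (k : ℤ) :
    ∃ K : NNReal, ∀ S c, IsGalerkinSolution a (fun _ => g) S τ c →
      (∀ t ∈ Ioo (-τ) τ, Decay D (c t)) →
      LipschitzOnWith K (fun t => -(g : ℂ) * advection a (c t) k) (Ioo (-τ) τ) := by
  obtain ⟨P, hP⟩ := exists_norm_isGalerkinSolution_sub_le ha g τ D
  refine ⟨(|g| * (2 * (P * ((D 1 + D 3) * weightSum) +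
    ((|(k : ℝ)| * (D 0 + D 2) + (D 1 + D 3)) * weightSum) * P))).toNNReal, fun S c hc hcD =>
    LipschitzOnWith.of_dist_le_mul fun t ht s hs => ?_⟩
  rw [dist_eq_norm, ← mul_sub, norm_neg_ofReal_mul, Real.dist_eq]
  refine le_trans ?_ (mul_le_mul_of_nonneg_right (Real.le_coe_toNNReal _) (abs_nonneg _))
  rw [mul_assoc]
  refine mul_le_mul_of_nonneg_left ?_ (abs_nonneg g)
  refine ((hcD t ht).norm_advection_sub_le ha (hcD s hs) (hP S c hc hcD t ht s hs) k).trans_eq ?_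
  ring

/-- Solutions on the time interval `J` of the equation satisfied by the Fourier coefficients of a
smooth solution of the model: `c t k` is the coefficient of `mode k` at time `t`. -/
structure IsCoefSolution (a g : ℝ) (J : Set ℝ) (c : ℝ → ℤ → ℂ) : Prop where
  exists_decay : ∃ D, ∀ t ∈ J, Decay D (c t)
  conj_eq : ∀ t ∈ J, ∀ k, conj (c t k) = c t (-k)
  hasDerivAt : ∀ t ∈ J, ∀ k, HasDerivAt (fun t => c t k) (-(g : ℂ) * advection a (c t) k) t

theorem isCoefSolution_of_tendsto (ha : 0 < a) {U : Filter ℕ} [U.NeBot] {S : ℕ → Finset ℤ}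
    (hS : ∀ k, ∀ᶠ N in U, k ∈ S N) {C : ℕ → ℝ → ℤ → ℂ} {c : ℝ → ℤ → ℂ}
    (hC : ∀ N, IsGalerkinSolution a (fun _ => g) (S N) τ (C N))
    (hCD : ∀ N, ∀ t ∈ Ioo (-τ) τ, Decay D (C N t))
    (hlim : ∀ t ∈ Ioo (-τ) τ, ∀ k, Tendsto (fun N => C N t k) U (𝓝 (c t k))) :
    IsCoefSolution a g (Ioo (-τ) τ) c where
  exists_decay := ⟨D, fun t ht => Decay.of_tendsto (fun N => hCD N t ht) (hlim t ht)⟩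
  conj_eq t ht k := by
    refine tendsto_nhds_unique ((Complex.continuous_conj.tendsto _).comp (hlim t ht k)) ?_
    exact (hlim t ht (-k)).congr fun N => ((hC N).conj_eq t ht k).symm
  hasDerivAt s hs k := by
    obtain ⟨K, hK⟩ := exists_lipschitzOnWith_advection ha g τ D k
    refine hasDerivAt_of_tendsto_of_lipschitzOnWith isOpen_Ioo ordConnected_Ioo
      (f' := fun N t => -(g : ℂ) * advection a (C N t) k)
      (F' := fun t => -(g : ℂ) * advection a (c t) k) ?_
      (fun N => hK (S N) (C N) (hC N) (hCD N)) (fun t ht => hlim t ht k)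
      (fun t ht => (tendsto_advection ha (fun N => hCD N t ht) (hlim t ht) k).const_mul _) hs
    filter_upwards [hS k] with N hN t ht
    exact (hC N).hasDerivAt t ht k hN

theorem exists_isCoefSolution (ha : 0 < a) (hR : 0 < R) (hτ : 0 < τ)
    (hτR : growthRate g R 2 * τ ≤ Real.log 2) (hB : Decay B b)
    (hb : ∀ k, conj (b k) = b (-k)) (hbR : ∀ S, 2 * sobolevEnergy S 2 b ≤ R) :
    ∃ c, IsCoefSolution a g (Ioo (-τ) τ) c ∧ ∀ k, c 0 k = b k := by
  obtain ⟨D, hD⟩ := exists_isGalerkinSolution_decay ha hR hτ hτR hB hb hbR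
  choose C hC hC0 hCD using fun N : ℕ => hD (Finset.Icc (-(N : ℤ)) N) fun k hk => by
    rw [Finset.mem_Icc] at hk ⊢
    lia
  let U : Ultrafilter ℕ := Ultrafilter.of atTop
  have hS (k : ℤ) : ∀ᶠ N : ℕ in (U : Filter ℕ), k ∈ Finset.Icc (-(N : ℤ)) N := by
    refine Ultrafilter.of_le atTop ?_
    filter_upwards [eventually_ge_atTop k.natAbs] with N hN
    rw [Finset.mem_Icc]
    lia
  have hlim (t : ℝ) (k : ℤ) :
      ∃ z, t ∈ Ioo (-τ) τ → Tendsto (fun N => C N t k) U (𝓝 z) := by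
    by_cases ht : t ∈ Ioo (-τ) τ
    · obtain ⟨z, hz⟩ := exists_tendsto_of_norm_le U fun N => (hCD N t ht).norm_le k
      exact ⟨z, fun _ => hz⟩
    · exact ⟨0, fun h => absurd h ht⟩
  choose c hc using hlim
  refine ⟨c, isCoefSolution_of_tendsto ha hS hC hCD fun t ht k => hc t k ht, fun k => ?_⟩
  refine tendsto_nhds_unique (hc 0 k ⟨neg_lt_zero.2 hτ, hτ⟩) (tendsto_const_nhds.congr' ?_)
  filter_upwards [hS k] with N hN
  exact (hC0 N k hN).symm

end GalerkinLimit

/-! ### Local existence -/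

/-- Joint smoothness of a function of space and time on the strip `ℝ × J`. -/
def SmoothOnStrip (J : Set ℝ) (F : ℝ → ℝ → ℝ) : Prop :=
  ContDiffOn ℝ ∞ (fun p : ℝ × ℝ => F p.1 p.2) (univ ×ˢ J)

/-- Smooth solutions of the model on an open set `J` of times, without initial condition. -/
structure IsSolutionOn (a g : ℝ) (J : Set ℝ) (ρ : ℝ → ℝ → ℝ) : Prop where
  smooth : SmoothOnStrip J ρ
  slice : ∀ t ∈ J, SmoothPeriodic fun x => ρ x t
  equation : ∀ t ∈ J, ∀ x, HasDerivAt (fun s => ρ x s)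
    (-((g * Ha a (fun y => ρ y t) x) * deriv (fun y => ρ y t) x)) t

theorem Decay.hasSum_re {B : ℕ → ℝ} {c : ℤ → ℂ} (hc : Decay B c)
    (hconj : ∀ k, conj (c k) = c (-k)) (x : ℝ) :
    HasSum (fun k => c k * mode k x) ((∑' k, c k * mode k x).re : ℂ) := by
  have hreal : conj (∑' k, c k * mode k x) = ∑' k, c k * mode k x := by
    rw [Complex.conj_tsum, ← (Equiv.neg ℤ).tsum_eq fun k => c k * mode k x]
    refine tsum_congr fun k => ?_
    rw [Equiv.neg_apply, map_mul, hconj, conj_mode]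
  rw [Complex.conj_eq_iff_re.1 hreal]
  exact (hc.summable_mode x).hasSum

section CoefSolution

variable {a g : ℝ} {J : Set ℝ} {c : ℝ → ℤ → ℂ}

theorem IsCoefSolution.timeContDiff (ha : 0 < a) (hc : IsCoefSolution a g J c) (hJ : IsOpen J)
    (hJ' : IsPreconnected J) (n : ℕ) : TimeContDiff J n fun k t => c t k := by
  induction n with
  | zero =>
    exact ⟨hc.exists_decay, fun k t ht => (hc.hasDerivAt t ht k).continuousAt.continuousWithinAt⟩
  | succ n ih =>
    have hadvection := (ih.mul_left (norm_multiplier_le ha)).conv hJ hJ' ih.deriv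
    exact ⟨hc.exists_decay, _, hadvection.mul_left (m := fun _ => -(g : ℂ)) (fun _ => le_rfl),
      fun k t ht => hc.hasDerivAt t ht k⟩

theorem Decay.hasSum_advection (ha : 0 < a) {B : ℕ → ℝ} {c : ℤ → ℂ} (hc : Decay B c) {f : ℝ → ℝ}
    (hf : ∀ x, HasSum (fun k => c k * mode k x) (f x : ℂ)) (x : ℝ) :
    HasSum (fun k => IPM1D.advection a c k * mode k x) (Ha a f x * _root_.deriv f x : ℝ) := by
  have h := (hc.mul_left (norm_multiplier_le ha)).hasSum_conv hc.deriv x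
  rwa [(hc.hasSum_Ha ha hf x).tsum_eq, (hc.hasSum_deriv hf x).tsum_eq, ← Complex.ofReal_mul] at h

theorem IsCoefSolution.isSolutionOn (ha : 0 < a) (hc : IsCoefSolution a g J c) (hJ : IsOpen J)
    (hJ' : IsPreconnected J) : IsSolutionOn a g J fun x t => (∑' k, c t k * mode k x).re := by
  obtain ⟨D, hD⟩ := hc.exists_decay
  have hsum (t : ℝ) (ht : t ∈ J) := (hD t ht).hasSum_re (hc.conj_eq t ht)
  refine ⟨?_, fun t ht => (hD t ht).smoothPeriodic_of_hasSum (hsum t ht), fun t ht x => ?_⟩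
  · exact Complex.reCLM.contDiff.comp_contDiffOn
      (contDiffOn_infty.2 fun n => (hc.timeContDiff ha hJ hJ' n).contDiffOn hJ hJ')
  · have hderiv := hasDerivAt_tsum_time hJ hJ' hD
      (fun t ht => ((hD t ht).advection ha).mul_left (m := fun _ => -(g : ℂ)) fun _ => le_rfl)
      (fun k t ht => hc.hasDerivAt t ht k) x ht
    have hvalue := (((hD t ht).hasSum_advection ha (hsum t ht) x).mul_left (-(g : ℂ))).tsum_eq
    simp only [← mul_assoc] at hvalue
    rw [hvalue, ← Complex.ofReal_neg, ← Complex.ofReal_mul] at hderiv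
    refine (Complex.reCLM.hasFDerivAt.comp_hasDerivAt t hderiv).congr_deriv ?_
    rw [Complex.reCLM_apply, Complex.ofReal_re]
    ring

end CoefSolution

theorem SmoothPeriodic.sobolevEnergy_coef_le {f : ℝ → ℝ} (hf : SmoothPeriodic f) (S : Finset ℤ) :
    sobolevEnergy S 2 (coef f) ≤
      (2 * π)⁻¹ * ∫ x in (0 : ℝ)..2 * π, _root_.deriv (_root_.deriv f) x ^ 2 := by
  refine le_trans (le_of_eq (Finset.sum_congr rfl fun k _ => ?_))
    (sum_le_hasSum S (fun k _ => sq_nonneg _) (hasSum_sq_coef hf.deriv.deriv.continuous))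
  rw [coef_deriv hf.deriv.contDiff_one hf.deriv.2, coef_deriv hf.contDiff_one hf.2, norm_mul,
    norm_mul, norm_mul, norm_mul, Complex.norm_I, one_mul, Complex.norm_intCast, ← mul_assoc, ← sq]

theorem exists_isSolutionOn_Ioo_neg {a g R : ℝ} (ha : 0 < a) (hR : 0 < R) :
    ∃ τ > 0, ∀ f, SmoothPeriodic f → ∫ x in (0 : ℝ)..2 * π, deriv (deriv f) x ^ 2 ≤ R →
      ∃ ρ, IsSolutionOn a g (Ioo (-τ) τ) ρ ∧ ∀ x, ρ x 0 = f x := by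
  let R' := 2 * ((2 * π)⁻¹ * R)
  have hR' : 0 < R' := by positivity
  have hrate : 0 ≤ growthRate g R' 2 := growthRate_nonneg hR' 2
  have hlog : 0 < Real.log 2 := Real.log_pos one_lt_two
  refine ⟨Real.log 2 / (growthRate g R' 2 + 1), by positivity, fun f hf hfR => ?_⟩
  obtain ⟨B, hB⟩ := hf.exists_decay
  obtain ⟨c, hc, hc0⟩ := exists_isCoefSolution (g := g) ha hR'
    (τ := Real.log 2 / (growthRate g R' 2 + 1)) (by positivity) (by
      rw [mul_div_left_comm]
      exact mul_le_of_le_one_right hlog.le ((div_le_one (by positivity)).2 (by linarith)))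
    hB (conj_coef f) (fun S => mul_le_mul_of_nonneg_left ((hf.sobolevEnergy_coef_le S).trans
      (mul_le_mul_of_nonneg_left hfR (by positivity))) zero_le_two)
  refine ⟨_, hc.isSolutionOn ha isOpen_Ioo isPreconnected_Ioo, fun x => ?_⟩
  simp only [hc0, (hf.hasSum_coef x).tsum_eq, Complex.ofReal_re]

theorem exists_isSolutionOn {a g R : ℝ} (ha : 0 < a) (hR : 0 < R) :
    ∃ τ > 0, ∀ (t₀ : ℝ) (f : ℝ → ℝ), SmoothPeriodic f →
      ∫ x in (0 : ℝ)..2 * π, deriv (deriv f) x ^ 2 ≤ R →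
      ∃ ρ, IsSolutionOn a g (Ioo (t₀ - τ) (t₀ + τ)) ρ ∧ ∀ x, ρ x t₀ = f x := by
  obtain ⟨τ, hτ, hexists⟩ := exists_isSolutionOn_Ioo_neg (g := g) ha hR
  refine ⟨τ, hτ, fun t₀ f hf hfR => ?_⟩
  obtain ⟨σ, hσ, hσ0⟩ := hexists f hf hfR
  have hmem (t : ℝ) (ht : t ∈ Ioo (t₀ - τ) (t₀ + τ)) : t - t₀ ∈ Ioo (-τ) τ :=
    ⟨by linarith [ht.1], by linarith [ht.2]⟩
  refine ⟨fun x t => σ x (t - t₀), ⟨?_, fun t ht => hσ.slice _ (hmem t ht), fun t ht x =>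
    (hσ.equation _ (hmem t ht) x).comp_sub_const t t₀⟩, fun x => by simp only [sub_self, hσ0]⟩
  have hshift : ContDiff ℝ ∞ fun p : ℝ × ℝ => (p.1, p.2 - t₀) := by fun_prop
  exact ContDiffOn.comp (f := fun p : ℝ × ℝ => (p.1, p.2 - t₀)) hσ.smooth hshift.contDiffOn
    fun p hp => ⟨mem_univ _, hmem _ hp.2⟩

/-! ### Energy identities and uniqueness -/

/-- The partial derivative in the space variable. -/
noncomputable def dx (F : ℝ → ℝ → ℝ) (x t : ℝ) : ℝ := deriv (fun y => F y t) x

/-- The partial derivative in the time variable. -/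
noncomputable def dt (F : ℝ → ℝ → ℝ) (x t : ℝ) : ℝ := deriv (fun s => F x s) t

section PartialDerivatives

variable {G : ℝ × ℝ → ℝ} {L : ℝ × ℝ →L[ℝ] ℝ} {x t : ℝ}

theorem hasDerivAt_comp_prodMk_right (h : HasFDerivAt G L (x, t)) :
    HasDerivAt (fun y => G (y, t)) (L (1, 0)) x :=
  HasFDerivAt.comp_hasDerivAt (f := fun y : ℝ => (y, t)) x h
    ((hasDerivAt_id x).prodMk (hasDerivAt_const x t))

theorem hasDerivAt_comp_prodMk_left (h : HasFDerivAt G L (x, t)) :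
    HasDerivAt (fun s => G (x, s)) (L (0, 1)) t :=
  HasFDerivAt.comp_hasDerivAt (f := fun s : ℝ => (x, s)) t h
    ((hasDerivAt_const t x).prodMk (hasDerivAt_id t))

end PartialDerivatives

namespace SmoothOnStrip

variable {J : Set ℝ} {F : ℝ → ℝ → ℝ} {x t : ℝ}

theorem contDiffAt (hJ : IsOpen J) (hF : SmoothOnStrip J F) (ht : t ∈ J) :
    ContDiffAt ℝ ∞ (fun p : ℝ × ℝ => F p.1 p.2) (x, t) :=
  ContDiffOn.contDiffAt hF ((isOpen_univ.prod hJ).mem_nhds ⟨mem_univ _, ht⟩)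

theorem hasFDerivAt (hJ : IsOpen J) (hF : SmoothOnStrip J F) (ht : t ∈ J) :
    HasFDerivAt (fun p : ℝ × ℝ => F p.1 p.2)
      (fderiv ℝ (fun p : ℝ × ℝ => F p.1 p.2) (x, t)) (x, t) :=
  ((hF.contDiffAt hJ ht).differentiableAt (by simp)).hasFDerivAt

theorem dx_eq (hJ : IsOpen J) (hF : SmoothOnStrip J F) (ht : t ∈ J) :
    dx F x t = fderiv ℝ (fun p : ℝ × ℝ => F p.1 p.2) (x, t) (1, 0) :=
  (hasDerivAt_comp_prodMk_right (hF.hasFDerivAt hJ ht)).deriv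

theorem dt_eq (hJ : IsOpen J) (hF : SmoothOnStrip J F) (ht : t ∈ J) :
    dt F x t = fderiv ℝ (fun p : ℝ × ℝ => F p.1 p.2) (x, t) (0, 1) :=
  (hasDerivAt_comp_prodMk_left (hF.hasFDerivAt hJ ht)).deriv

theorem hasDerivAt_dt (hJ : IsOpen J) (hF : SmoothOnStrip J F) (ht : t ∈ J) :
    HasDerivAt (fun s => F x s) (dt F x t) t := by
  rw [hF.dt_eq hJ ht]
  exact hasDerivAt_comp_prodMk_left (hF.hasFDerivAt hJ ht)

theorem contDiffOn_fderiv_apply (hJ : IsOpen J) (hF : SmoothOnStrip J F) (v : ℝ × ℝ) :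
    ContDiffOn ℝ ∞ (fun p => fderiv ℝ (fun p : ℝ × ℝ => F p.1 p.2) p v) (univ ×ˢ J) :=
  (ContDiffOn.fderiv_of_isOpen hF (isOpen_univ.prod hJ) (by simp)).clm_apply contDiffOn_const

theorem dx (hJ : IsOpen J) (hF : SmoothOnStrip J F) : SmoothOnStrip J (dx F) :=
  (hF.contDiffOn_fderiv_apply hJ (1, 0)).congr fun _ hp => hF.dx_eq hJ hp.2

theorem dt (hJ : IsOpen J) (hF : SmoothOnStrip J F) : SmoothOnStrip J (dt F) :=
  (hF.contDiffOn_fderiv_apply hJ (0, 1)).congr fun _ hp => hF.dt_eq hJ hp.2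

theorem dt_dx (hJ : IsOpen J) (hF : SmoothOnStrip J F) (ht : t ∈ J) :
    IPM1D.dt (IPM1D.dx F) x t = IPM1D.dx (IPM1D.dt F) x t := by
  let f (p : ℝ × ℝ) : ℝ := F p.1 p.2
  have hfderiv : HasFDerivAt (fderiv ℝ f) (fderiv ℝ (fderiv ℝ f) (x, t)) (x, t) :=
    (((hF.contDiffAt hJ ht).fderiv_right (m := 1)
      (WithTop.coe_le_coe.2 (le_top : (1 + 1 : ℕ∞) ≤ ⊤))).differentiableAt
      one_ne_zero).hasFDerivAt
  have hfderiv_apply (v : ℝ × ℝ) : HasFDerivAt (fun p => fderiv ℝ f p v)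
      ((fderiv ℝ (fderiv ℝ f) (x, t)).flip v) (x, t) :=
    (hfderiv.clm_apply (hasFDerivAt_const v (x, t))).congr_fderiv (by ext <;> simp)
  have hdt_dx : IPM1D.dt (IPM1D.dx F) x t = fderiv ℝ (fderiv ℝ f) (x, t) (0, 1) (1, 0) := by
    refine ((hasDerivAt_comp_prodMk_left (hfderiv_apply (1, 0))).congr_of_eventuallyEq ?_).deriv
    filter_upwards [hJ.mem_nhds ht] with s hs using hF.dx_eq hJ hs
  have hdx_dt : IPM1D.dx (IPM1D.dt F) x t = fderiv ℝ (fderiv ℝ f) (x, t) (1, 0) (0, 1) :=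
    ((hasDerivAt_comp_prodMk_right (hfderiv_apply (0, 1))).congr_of_eventuallyEq
      (Eventually.of_forall fun y => hF.dt_eq hJ ht)).deriv
  have hsymm : IsSymmSndFDerivAt ℝ f (x, t) := (hF.contDiffAt hJ ht).isSymmSndFDerivAt (by
    rw [minSmoothness_of_isRCLikeNormedField]
    exact ENat.LEInfty.out)
  rw [hdt_dx, hdx_dt, hsymm.eq]

theorem continuous_slice (hF : SmoothOnStrip J F) (ht : t ∈ J) : Continuous fun x => F x t := by
  rw [← continuousOn_univ]
  exact ContinuousOn.comp (f := fun x : ℝ => (x, t)) (ContDiffOn.continuousOn hF) (by fun_prop)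
    fun x _ => ⟨mem_univ _, ht⟩

theorem exists_abs_le (hF : SmoothOnStrip J F)
    (hp : ∀ t ∈ J, Function.Periodic (fun x => F x t) (2 * π)) {K : Set ℝ} (hK : IsCompact K)
    (hKJ : K ⊆ J) : ∃ M, 0 ≤ M ∧ ∀ t ∈ K, ∀ x, |F x t| ≤ M := by
  obtain ⟨M, hM⟩ := ((isCompact_Icc (a := (0 : ℝ)) (b := 2 * π)).prod
    hK).exists_bound_of_continuousOn (hF.continuousOn.mono (prod_mono (subset_univ _) hKJ))
  refine ⟨max M 0, le_max_right _ _, fun t ht x => ?_⟩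
  obtain ⟨w, hw, hxw⟩ := (hp t (hKJ ht)).exists_mem_Ico₀ Real.two_pi_pos x
  rw [show F x t = F w t from hxw]
  exact (hM (w, t) ⟨⟨hw.1, hw.2.le⟩, ht⟩).trans (le_max_left _ _)

theorem hasDerivAt_integral_sq (hJ : IsOpen J) (hF : SmoothOnStrip J F) (ht : t ∈ J) :
    HasDerivAt (fun t => ∫ x in (0 : ℝ)..2 * π, F x t ^ 2)
      (∫ x in (0 : ℝ)..2 * π, 2 * F x t * IPM1D.dt F x t) t := by
  obtain ⟨K, hK, htK, hKJ⟩ := exists_compact_subset hJ ht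
  have hFt := hF.dt hJ
  have hcont : ContinuousOn (fun p : ℝ × ℝ => 2 * F p.1 p.2 * IPM1D.dt F p.1 p.2) (univ ×ˢ J) :=
    (continuousOn_const.mul hF.continuousOn).mul hFt.continuousOn
  obtain ⟨M, hM⟩ := ((isCompact_Icc (a := (0 : ℝ)) (b := 2 * π)).prod
    hK).exists_bound_of_continuousOn (hcont.mono (prod_mono (subset_univ _) hKJ))
  refine (intervalIntegral.hasDerivAt_integral_of_dominated_loc_of_deriv_le (s := interior K)
    (F := fun t x => F x t ^ 2) (F' := fun t x => 2 * F x t * IPM1D.dt F x t)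
    (bound := fun _ => M) (isOpen_interior.mem_nhds htK) ?_
    (((hF.continuous_slice ht).pow 2).intervalIntegrable _ _)
    ((continuous_const.mul (hF.continuous_slice ht)).mul
      (hFt.continuous_slice ht)).aestronglyMeasurable
    (Eventually.of_forall fun x hx s hs => ?_) intervalIntegrable_const
    (Eventually.of_forall fun x _ s hs => ?_)).2
  · filter_upwards [hJ.mem_nhds ht] with s hs
    exact ((hF.continuous_slice hs).pow 2).aestronglyMeasurable
  · rw [uIoc_of_le Real.two_pi_pos.le] at hx
    exact hM (x, s) ⟨⟨hx.1.le, hx.2⟩, interior_subset hs⟩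
  · exact ((hF.hasDerivAt_dt hJ (hKJ (interior_subset hs))).pow 2).congr_deriv (by simp)

end SmoothOnStrip

namespace SmoothPeriodic

variable {f u : ℝ → ℝ}

theorem integral_deriv (hf : SmoothPeriodic f) :
    ∫ x in (0 : ℝ)..2 * π, _root_.deriv f x = 0 := by
  rw [intervalIntegral.integral_deriv_eq_sub' f rfl
    (fun x _ => (hf.hasDerivAt x).differentiableAt) hf.deriv.continuous.continuousOn, sub_eq_zero]
  simpa only [zero_add] using hf.2 0

theorem mul {h : ℝ → ℝ} (hf : SmoothPeriodic f) (hh : SmoothPeriodic h) :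
    SmoothPeriodic fun x => f x * h x :=
  ⟨hf.1.mul hh.1, fun x => by simp only [hf.2 x, hh.2 x]⟩

theorem const_mul (hf : SmoothPeriodic f) (c : ℝ) : SmoothPeriodic fun x => c * f x :=
  ⟨contDiff_const.mul hf.1, fun x => by simp only [hf.2 x]⟩

theorem integral_two_mul_neg_transport (hu : SmoothPeriodic u) (hf : SmoothPeriodic f)
    {G : ℝ → ℝ} (hG : Continuous G) :
    ∫ x in (0 : ℝ)..2 * π, 2 * f x * -(u x * _root_.deriv f x + G x) =
      ∫ x in (0 : ℝ)..2 * π, (_root_.deriv u x * f x ^ 2 - 2 * f x * G x) := by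
  have hderiv (x : ℝ) : _root_.deriv (fun x => u x * (f x * f x)) x =
      _root_.deriv u x * f x ^ 2 + 2 * f x * (u x * _root_.deriv f x) := by
    refine (((hu.hasDerivAt x).fun_mul ((hf.hasDerivAt x).fun_mul (hf.hasDerivAt x))).congr_deriv
      ?_).deriv
    ring
  have hu_cont := hu.continuous
  have hu'_cont := hu.deriv.continuous
  have hf_cont := hf.continuous
  have hf'_cont := hf.deriv.continuous
  rw [← sub_eq_zero, ← intervalIntegral.integral_sub]
  · rw [← neg_eq_zero, ← intervalIntegral.integral_neg]
    refine Eq.trans ?_ (hu.mul (hf.mul hf)).integral_deriv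
    refine intervalIntegral.integral_congr fun x _ => ?_
    simp only [hderiv]
    ring
  all_goals exact Continuous.intervalIntegrable (by fun_prop) _ _

theorem eq_zero_of_integral_sq (hf : SmoothPeriodic f)
    (h : ∫ x in (0 : ℝ)..2 * π, f x ^ 2 = 0) (x : ℝ) : f x = 0 := by
  have hparseval := hasSum_sq_coef hf.continuous
  rw [h, mul_zero, hasSum_zero_iff_of_nonneg fun k => sq_nonneg _] at hparseval
  have hcoef (k : ℤ) : coef f k = 0 := by simpa using congrFun hparseval k
  have hsum := hf.hasSum_coef x
  simp only [hcoef, zero_mul] at hsum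
  exact_mod_cast hsum.unique hasSum_zero

variable {a : ℝ}

theorem deriv_const_mul_Ha (ha : 0 < a) (hf : SmoothPeriodic f) (g x : ℝ) :
    _root_.deriv (fun x => g * IPM1D.Ha a f x) x = g * IPM1D.Ha a (_root_.deriv f) x := by
  rw [(((hf.Ha ha).hasDerivAt x).const_mul g).deriv, hf.deriv_Ha ha]

theorem abs_Ha_le_of_abs_deriv_le (ha : 0 < a) (hf : SmoothPeriodic f) {M N : ℝ}
    (hM : ∀ x, |f x| ≤ M) (hN : ∀ x, |_root_.deriv f x| ≤ N) (x : ℝ) :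
    |IPM1D.Ha a f x| ≤ 4 * N + M * ∫ y : ℝ, a ^ 2 / (y ^ 2 + a ^ 2) := by
  have hN0 : 0 ≤ N := (abs_nonneg _).trans (hN 0)
  have hholder (x y : ℝ) (hxy : |x - y| ≤ 2) : |f x - f y| ≤ 2 * N * √|x - y| := by
    have hlipschitz : |f x - f y| ≤ N * |x - y| :=
      Convex.norm_image_sub_le_of_norm_deriv_le (s := univ)
        (fun z _ => (hf.hasDerivAt z).differentiableAt) (fun z _ => hN z) convex_univ
        (mem_univ y) (mem_univ x)
    have hsqrt_le : √|x - y| ≤ 2 := Real.sqrt_le_iff.2 ⟨by norm_num, by linarith⟩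
    calc |f x - f y| ≤ N * (√|x - y| * √|x - y|) := by
          rwa [Real.mul_self_sqrt (abs_nonneg _)]
      _ ≤ N * (2 * √|x - y|) :=
          mul_le_mul_of_nonneg_left (mul_le_mul_of_nonneg_right hsqrt_le (Real.sqrt_nonneg _)) hN0
      _ = 2 * N * √|x - y| := by ring
  have hbound := hf.abs_Ha_le ha hM hholder one_pos le_rfl x
  rw [Real.sqrt_one, Real.log_one] at hbound
  linarith

theorem abs_integral_le_mul_integral_sq (ha : 0 < a) (hf : SmoothPeriodic f) {h : ℝ → ℝ}
    {g A b : ℝ} (hb : 0 ≤ b)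
    (hh : ∀ x, |h x| ≤ A * f x ^ 2 + b * (f x ^ 2 + (g * IPM1D.Ha a f x) ^ 2)) :
    |∫ x in (0 : ℝ)..2 * π, h x| ≤
      (A + b * (1 + 4 * g ^ 2)) * ∫ x in (0 : ℝ)..2 * π, f x ^ 2 := by
  have hf_int : IntervalIntegrable (fun x => f x ^ 2) volume 0 (2 * π) :=
    (hf.continuous.pow 2).intervalIntegrable _ _
  have hHa_int : IntervalIntegrable (fun x => IPM1D.Ha a f x ^ 2) volume 0 (2 * π) :=
    ((hf.Ha ha).continuous.pow 2).intervalIntegrable _ _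
  have hle : |∫ x in (0 : ℝ)..2 * π, h x| ≤
      ∫ x in (0 : ℝ)..2 * π, ((A + b) * f x ^ 2 + b * g ^ 2 * IPM1D.Ha a f x ^ 2) :=
    intervalIntegral.norm_integral_le_of_norm_le (f := h) Real.two_pi_pos.le
      (Eventually.of_forall fun x _ => (hh x).trans_eq (by ring))
      ((hf_int.const_mul _).add (hHa_int.const_mul _))
  rw [intervalIntegral.integral_add (hf_int.const_mul _) (hHa_int.const_mul _),
    intervalIntegral.integral_const_mul, intervalIntegral.integral_const_mul] at hle
  have hHa := mul_le_mul_of_nonneg_left (hf.integral_Ha_sq_le ha) (mul_nonneg hb (sq_nonneg g))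
  linarith

end SmoothPeriodic

theorem abs_mul_sq_sub_two_mul_le {d w v p A M : ℝ} (hd : |d| ≤ A) (hp : |p| ≤ M) :
    |d * w ^ 2 - 2 * w * (v * p)| ≤ A * w ^ 2 + M * (w ^ 2 + v ^ 2) := by
  have hquadratic : |d * w ^ 2| ≤ A * w ^ 2 := by
    rw [abs_mul, abs_of_nonneg (sq_nonneg w)]
    exact mul_le_mul_of_nonneg_right hd (sq_nonneg w)
  have hmixed : |2 * w * (v * p)| ≤ M * (w ^ 2 + v ^ 2) := by
    rw [show 2 * w * (v * p) = p * (2 * w * v) by ring, abs_mul]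
    refine mul_le_mul hp (abs_le.2 ⟨?_, two_mul_le_add_sq w v⟩) (abs_nonneg _)
      ((abs_nonneg p).trans hp)
    linarith [two_mul_le_add_sq w (-v), neg_sq v]
  exact (abs_sub _ _).trans (add_le_add hquadratic hmixed)

theorem SmoothOnStrip.hasDerivAt_integral_sq_of_transport {J : Set ℝ} {F : ℝ → ℝ → ℝ}
    (hJ : IsOpen J) (hF : SmoothOnStrip J F) {t : ℝ} (ht : t ∈ J)
    (hslice : SmoothPeriodic fun x => F x t) {u G : ℝ → ℝ} (hu : SmoothPeriodic u)
    (hG : Continuous G) (heq : ∀ x, IPM1D.dt F x t = -(u x * IPM1D.dx F x t + G x)) :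
    HasDerivAt (fun t => ∫ x in (0 : ℝ)..2 * π, F x t ^ 2)
      (∫ x in (0 : ℝ)..2 * π, (deriv u x * F x t ^ 2 - 2 * F x t * G x)) t := by
  refine (hF.hasDerivAt_integral_sq hJ ht).congr_deriv ?_
  rw [← hu.integral_two_mul_neg_transport hslice hG]
  exact intervalIntegral.integral_congr fun x _ => by
    simp only [heq x]
    rfl

namespace IsSolutionOn

variable {a g : ℝ} {J : Set ℝ} {ρ₁ ρ₂ : ℝ → ℝ → ℝ} {t₀ t₁ : ℝ}

theorem hasDerivAt_integral_sub_sq (ha : 0 < a) (hJ : IsOpen J) (h₁ : IsSolutionOn a g J ρ₁)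
    (h₂ : IsSolutionOn a g J ρ₂) {t : ℝ} (ht : t ∈ J) :
    HasDerivAt (fun t => ∫ x in (0 : ℝ)..2 * π, (ρ₁ x t - ρ₂ x t) ^ 2)
      (∫ x in (0 : ℝ)..2 * π, (deriv (fun x => g * Ha a (fun y => ρ₁ y t) x) x *
        (ρ₁ x t - ρ₂ x t) ^ 2 - 2 * (ρ₁ x t - ρ₂ x t) *
        ((g * Ha a (fun y => ρ₁ y t - ρ₂ y t) x) * deriv (fun y => ρ₂ y t) x))) t := by
  have hs₁ := h₁.slice t ht
  have hs₂ := h₂.slice t ht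
  have hs := hs₁.sub hs₂
  refine SmoothOnStrip.hasDerivAt_integral_sq_of_transport (F := fun x t => ρ₁ x t - ρ₂ x t) hJ
    (ContDiffOn.sub h₁.smooth h₂.smooth) ht hs ((hs₁.Ha ha).const_mul g)
    (((hs.Ha ha).const_mul g).continuous.mul hs₂.deriv.continuous) fun x => ?_
  have hdt : dt (fun x t => ρ₁ x t - ρ₂ x t) x t = _ :=
    ((h₁.equation t ht x).sub (h₂.equation t ht x)).deriv
  have hdx : dx (fun x t => ρ₁ x t - ρ₂ x t) x t = _ :=
    ((hs₁.hasDerivAt x).sub (hs₂.hasDerivAt x)).deriv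
  rw [hdt, hdx, hs₁.Ha_sub ha hs₂ x]
  ring

theorem exists_hasDerivAt_integral_sub_sq (ha : 0 < a) (hJ : IsOpen J)
    (h₁ : IsSolutionOn a g J ρ₁) (h₂ : IsSolutionOn a g J ρ₂) (hsub : Icc t₀ t₁ ⊆ J) :
    ∃ K, ∀ t ∈ Icc t₀ t₁, ∃ D,
      HasDerivAt (fun t => ∫ x in (0 : ℝ)..2 * π, (ρ₁ x t - ρ₂ x t) ^ 2) D t ∧
        |D| ≤ K * ∫ x in (0 : ℝ)..2 * π, (ρ₁ x t - ρ₂ x t) ^ 2 := by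
  obtain ⟨M₁, -, hM₁⟩ := (h₁.smooth.dx hJ).exists_abs_le
    (fun t ht => (h₁.slice t ht).deriv.2) isCompact_Icc hsub
  obtain ⟨N₁, -, hN₁⟩ := ((h₁.smooth.dx hJ).dx hJ).exists_abs_le
    (fun t ht => (h₁.slice t ht).deriv.deriv.2) isCompact_Icc hsub
  obtain ⟨M₂, hM₂_nonneg, hM₂⟩ := (h₂.smooth.dx hJ).exists_abs_le
    (fun t ht => (h₂.slice t ht).deriv.2) isCompact_Icc hsub
  refine ⟨|g| * (4 * N₁ + M₁ * ∫ y : ℝ, a ^ 2 / (y ^ 2 + a ^ 2)) + M₂ * (1 + 4 * g ^ 2),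
    fun t ht => ⟨_, h₁.hasDerivAt_integral_sub_sq ha hJ h₂ (hsub ht), ?_⟩⟩
  have hs₁ := h₁.slice t (hsub ht)
  refine (hs₁.sub (h₂.slice t (hsub ht))).abs_integral_le_mul_integral_sq ha hM₂_nonneg fun x =>
    abs_mul_sq_sub_two_mul_le ?_ (hM₂ t ht x)
  rw [hs₁.deriv_const_mul_Ha ha, abs_mul]
  exact mul_le_mul_of_nonneg_left
    (hs₁.deriv.abs_Ha_le_of_abs_deriv_le ha (hM₁ t ht) (hN₁ t ht) x) (abs_nonneg g)

theorem eq_of_eq_at (ha : 0 < a) (hJ : IsOpen J) (h₁ : IsSolutionOn a g J ρ₁)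
    (h₂ : IsSolutionOn a g J ρ₂) (hsub : Icc t₀ t₁ ⊆ J) (h₀ : ∀ x, ρ₁ x t₀ = ρ₂ x t₀) {t : ℝ}
    (ht : t ∈ Icc t₀ t₁) (x : ℝ) : ρ₁ x t = ρ₂ x t := by
  obtain ⟨K, hK⟩ := h₁.exists_hasDerivAt_integral_sub_sq ha hJ h₂ hsub
  choose! D hD hDK using hK
  have hzero := eq_zero_of_abs_deriv_le_mul_abs_self_of_eq_zero_right
    (fun t ht => (hD t ht).continuousAt.continuousWithinAt)
    (fun t ht => (hD t (Ico_subset_Icc_self ht)).hasDerivWithinAt) (by simp [h₀])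
    (fun t ht => (hDK t (Ico_subset_Icc_self ht)).trans_eq (by
      rw [Real.norm_eq_abs, abs_of_nonneg
        (intervalIntegral.integral_nonneg Real.two_pi_pos.le fun x _ => sq_nonneg _)])) t ht
  exact sub_eq_zero.1
    (((h₁.slice t (hsub ht)).sub (h₂.slice t (hsub ht))).eq_zero_of_integral_sq hzero x)

end IsSolutionOn

/-! ### The a priori estimate -/

theorem sq_intervalIntegral_le {f : ℝ → ℝ} (hf : Continuous f) {y x : ℝ} (hyx : y ≤ x) :
    (∫ z in y..x, f z) ^ 2 ≤ (x - y) * ∫ z in y..x, f z ^ 2 := by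
  have hquadratic (c : ℝ) :
      0 ≤ (x - y) * (c * c) + -2 * (∫ z in y..x, f z) * c + ∫ z in y..x, f z ^ 2 := by
    have hexpand : ∫ z in y..x, (f z - c) ^ 2 =
        ∫ z in y..x, (f z ^ 2 + (-2 * c * f z + c * c)) :=
      intervalIntegral.integral_congr fun z _ => by ring
    rw [intervalIntegral.integral_add, intervalIntegral.integral_add,
      intervalIntegral.integral_const_mul, intervalIntegral.integral_const, smul_eq_mul] at hexpand
    · have hnonneg : 0 ≤ ∫ z in y..x, (f z - c) ^ 2 :=
        intervalIntegral.integral_nonneg hyx fun z _ => sq_nonneg _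
      linarith
    all_goals exact Continuous.intervalIntegrable (by fun_prop) _ _
  have hdiscrim := discrim_le_zero hquadratic
  rw [discrim] at hdiscrim
  linarith

namespace SmoothPeriodic

variable {f : ℝ → ℝ}

theorem integral_deriv_sq_le_integral_period (hf : SmoothPeriodic f) {y x : ℝ} (hyx : y ≤ x)
    (hxy : x - y ≤ 2 * π) :
    ∫ z in y..x, _root_.deriv f z ^ 2 ≤ ∫ z in (0 : ℝ)..2 * π, _root_.deriv f z ^ 2 := by
  have hperiodic : Function.Periodic (fun z => _root_.deriv f z ^ 2) (2 * π) := fun z => by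
    simp only [hf.deriv.2 z]
  have hshift := hperiodic.intervalIntegral_add_eq y 0
  rw [zero_add] at hshift
  rw [← hshift]
  exact intervalIntegral.integral_mono_interval le_rfl hyx (by linarith)
    (Eventually.of_forall fun z => sq_nonneg _)
    ((hf.deriv.continuous.pow 2).intervalIntegrable _ _)

theorem abs_sub_le_sqrt (hf : SmoothPeriodic f) {E : ℝ}
    (hE : ∫ x in (0 : ℝ)..2 * π, _root_.deriv f x ^ 2 ≤ E) {x y : ℝ} (hxy : |x - y| ≤ 2 * π) :
    |f x - f y| ≤ √E * √|x - y| := by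
  wlog hyx : y ≤ x generalizing x y
  · rw [abs_sub_comm (f x), abs_sub_comm x]
    exact this (by rwa [abs_sub_comm]) (le_of_not_ge hyx)
  have hyx_nonneg : 0 ≤ x - y := sub_nonneg.2 hyx
  rw [abs_of_nonneg hyx_nonneg] at hxy ⊢
  rw [mul_comm, ← Real.sqrt_mul hyx_nonneg]
  refine Real.abs_le_sqrt ?_
  rw [← intervalIntegral.integral_deriv_eq_sub
    (fun z _ => (hf.hasDerivAt z).differentiableAt) (hf.deriv.continuous.intervalIntegrable _ _)]
  exact (sq_intervalIntegral_le hf.deriv.continuous hyx).trans (mul_le_mul_of_nonneg_left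
    ((hf.integral_deriv_sq_le_integral_period hyx hxy).trans hE) hyx_nonneg)

theorem abs_le_supNorm (hf : SmoothPeriodic f) (x : ℝ) : |f x| ≤ supNorm f := by
  obtain ⟨M, hM⟩ := hf.exists_abs_le
  exact le_ciSup (f := fun x => |f x|) ⟨M, by rintro _ ⟨y, rfl⟩; exact hM y⟩ x

theorem abs_Ha_le_log {a : ℝ} (ha : 0 < a) (hf : SmoothPeriodic f) {M E : ℝ}
    (hM : ∀ x, |f x| ≤ M) (hE : 1 ≤ E)
    (hfE : ∫ x in (0 : ℝ)..2 * π, _root_.deriv f x ^ 2 ≤ E) (x : ℝ) :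
    |IPM1D.Ha a f x| ≤ 2 + M * Real.log E + M * ∫ y : ℝ, a ^ 2 / (y ^ 2 + a ^ 2) := by
  have hE_pos : 0 < E := one_pos.trans_le hE
  have hbound := hf.abs_Ha_le ha hM
    (fun x y hxy => hf.abs_sub_le_sqrt hfE (hxy.trans (by linarith [Real.pi_gt_three])))
    (inv_pos.2 hE_pos) (inv_le_one_of_one_le₀ hE) x
  rwa [mul_assoc, Real.sqrt_inv, mul_inv_cancel₀ (Real.sqrt_pos.2 hE_pos).ne', Real.log_inv,
    neg_neg, mul_one] at hbound

end SmoothPeriodic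

namespace IsSolutionOn

variable {a g : ℝ} {J : Set ℝ} {ρ : ℝ → ℝ → ℝ} {t : ℝ}

theorem dt_dx (ha : 0 < a) (hJ : IsOpen J) (h : IsSolutionOn a g J ρ) (ht : t ∈ J) (x : ℝ) :
    dt (dx ρ) x t = -((g * Ha a (fun y => dx ρ y t) x) * dx ρ x t +
      (g * Ha a (fun y => ρ y t) x) * dx (dx ρ) x t) := by
  have hs := h.slice t ht
  have hu : HasDerivAt (Ha a fun y => ρ y t) (Ha a (fun y => dx ρ y t) x) x :=
    ((hs.Ha ha).hasDerivAt x).congr_deriv (by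
      rw [hs.deriv_Ha ha]
      rfl)
  have hrhs := ((hu.const_mul g).fun_mul (hs.deriv.hasDerivAt x)).fun_neg
  rw [h.smooth.dt_dx hJ ht]
  exact (hrhs.congr_of_eventuallyEq
    (Eventually.of_forall fun y => (h.equation t ht y).deriv)).deriv

theorem dt_dx_dx (ha : 0 < a) (hJ : IsOpen J) (h : IsSolutionOn a g J ρ) (ht : t ∈ J) (x : ℝ) :
    dt (dx (dx ρ)) x t = -((g * Ha a (fun y => ρ y t) x) * dx (dx (dx ρ)) x t +
      (2 * (g * Ha a (fun y => dx ρ y t) x) * dx (dx ρ) x t +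
        (g * Ha a (fun y => dx (dx ρ) y t) x) * dx ρ x t)) := by
  have hs := h.slice t ht
  have hu : HasDerivAt (Ha a fun y => ρ y t) (Ha a (fun y => dx ρ y t) x) x :=
    ((hs.Ha ha).hasDerivAt x).congr_deriv (by
      rw [hs.deriv_Ha ha]
      rfl)
  have hu' : HasDerivAt (Ha a fun y => dx ρ y t) (Ha a (fun y => dx (dx ρ) y t) x) x :=
    ((hs.deriv.Ha ha).hasDerivAt x).congr_deriv (by
      rw [hs.deriv.deriv_Ha ha]
      rfl)
  have hrhs := (((hu'.const_mul g).fun_mul (hs.deriv.hasDerivAt x)).fun_add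
    ((hu.const_mul g).fun_mul (hs.deriv.deriv.hasDerivAt x))).fun_neg
  rw [(h.smooth.dx hJ).dt_dx hJ ht]
  refine ((hrhs.congr_of_eventuallyEq
    (Eventually.of_forall (h.dt_dx ha hJ ht))).congr_deriv ?_).deriv
  change -((g * Ha a (fun y => dx (dx ρ) y t) x * dx ρ x t +
    g * Ha a (fun y => dx ρ y t) x * dx (dx ρ) x t) +
    (g * Ha a (fun y => dx ρ y t) x * dx (dx ρ) x t +
    g * Ha a (fun y => ρ y t) x * dx (dx (dx ρ)) x t)) = _
  ring

theorem exists_hasDerivAt_integral_dx_dx_sq (ha : 0 < a) (hJ : IsOpen J)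
    (h : IsSolutionOn a g J ρ) (ht : t ∈ J) {b : ℝ} (hb : ∀ x, |dx ρ x t| ≤ b) :
    ∃ D, HasDerivAt (fun t => ∫ x in (0 : ℝ)..2 * π, dx (dx ρ) x t ^ 2) D t ∧
      |D| ≤ (3 * (|g| * (2 + b * Real.log (1 + ∫ x in (0 : ℝ)..2 * π, dx (dx ρ) x t ^ 2) +
        b * ∫ y : ℝ, a ^ 2 / (y ^ 2 + a ^ 2))) + b * (1 + 4 * g ^ 2)) *
          ∫ x in (0 : ℝ)..2 * π, dx (dx ρ) x t ^ 2 := by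
  have hρ := h.slice t ht
  have hρ' : SmoothPeriodic fun x => dx ρ x t := hρ.deriv
  have hρ'' : SmoothPeriodic fun x => dx (dx ρ) x t := hρ'.deriv
  have hρ'_cont := hρ'.continuous
  have hρ''_cont := hρ''.continuous
  have hHa_cont := (hρ'.Ha ha).continuous
  have hHa'_cont := (hρ''.Ha ha).continuous
  have hnonneg : 0 ≤ ∫ x in (0 : ℝ)..2 * π, dx (dx ρ) x t ^ 2 :=
    intervalIntegral.integral_nonneg Real.two_pi_pos.le fun x _ => sq_nonneg _
  refine ⟨_, ((h.smooth.dx hJ).dx hJ).hasDerivAt_integral_sq_of_transport hJ ht hρ''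
    ((hρ.Ha ha).const_mul g) (by fun_prop) (h.dt_dx_dx ha hJ ht),
    hρ''.abs_integral_le_mul_integral_sq ha ((abs_nonneg _).trans (hb 0)) fun x => ?_⟩
  have hcoef : |-3 * (g * Ha a (fun y => dx ρ y t) x)| ≤
      3 * (|g| * (2 + b * Real.log (1 + ∫ x in (0 : ℝ)..2 * π, dx (dx ρ) x t ^ 2) +
        b * ∫ y : ℝ, a ^ 2 / (y ^ 2 + a ^ 2))) := by
    rw [abs_mul, abs_mul, abs_neg, abs_of_pos three_pos]
    gcongr
    exact hρ'.abs_Ha_le_log ha hb (le_add_of_nonneg_right hnonneg)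
      (le_add_of_nonneg_left one_pos.le) x
  refine (congrArg abs ?_).trans_le (abs_mul_sq_sub_two_mul_le hcoef (hb x))
  rw [hρ.deriv_const_mul_Ha ha]
  change g * Ha a (fun y => dx ρ y t) x * _ - _ = _
  ring

end IsSolutionOn

/-- The constant of the logarithmic Grönwall inequality for `∫ (∂ₓ² ρ)²`. -/
noncomputable def gronwallConst (a g : ℝ) : ℝ :=
  3 * (|g| * (3 + ∫ y : ℝ, a ^ 2 / (y ^ 2 + a ^ 2))) + (1 + 4 * g ^ 2)

theorem gronwallConst_nonneg (a g : ℝ) : 0 ≤ gronwallConst a g := by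
  unfold gronwallConst
  positivity

theorem rate_le_gronwallConst_mul (a g : ℝ) {b l : ℝ} (hb : 0 ≤ b) (hl : 0 ≤ l) :
    3 * (|g| * (2 + b * l + b * ∫ y : ℝ, a ^ 2 / (y ^ 2 + a ^ 2))) + b * (1 + 4 * g ^ 2) ≤
      gronwallConst a g * (1 + b) * (1 + l) := by
  have hbl : b ≤ (1 + b) * (1 + l) := by nlinarith [mul_nonneg hb hl]
  have hbl' : 2 + b * l ≤ 3 * ((1 + b) * (1 + l)) := by nlinarith [mul_nonneg hb hl]
  calc 3 * (|g| * (2 + b * l + b * ∫ y : ℝ, a ^ 2 / (y ^ 2 + a ^ 2))) + b * (1 + 4 * g ^ 2)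
      ≤ 3 * (|g| * (3 * ((1 + b) * (1 + l)) +
          (1 + b) * (1 + l) * ∫ y : ℝ, a ^ 2 / (y ^ 2 + a ^ 2))) +
          (1 + b) * (1 + l) * (1 + 4 * g ^ 2) := by gcongr
    _ = gronwallConst a g * (1 + b) * (1 + l) := by unfold gronwallConst; ring

theorem div_one_add_le_of_abs_le_mul {D I k c : ℝ} (hI : 0 ≤ I) (hD : |D| ≤ k * I)
    (hkc : k ≤ c) (hc : 0 ≤ c) : D / (1 + I) ≤ c := by
  rw [div_le_iff₀ (by linarith)]
  calc D ≤ k * I := (le_abs_self D).trans hD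
    _ ≤ c * I := mul_le_mul_of_nonneg_right hkc hI
    _ ≤ c * (1 + I) := mul_le_mul_of_nonneg_left (by linarith) hc

theorem gronwall_le_of_bounded_primitive {Z Z' b B : ℝ → ℝ} {C M t₀ T : ℝ} (hC : 0 ≤ C)
    (hZ₀ : 0 ≤ Z t₀) (hZ : ∀ t ∈ Ico t₀ T, HasDerivAt Z (Z' t) t)
    (hZ' : ∀ t ∈ Ico t₀ T, Z' t ≤ C * (1 + b t) * Z t)
    (hB : ∀ t ∈ Ico t₀ T, HasDerivAt B (b t) t) (hB₀ : 0 ≤ B t₀)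
    (hBM : ∀ t ∈ Ico t₀ T, B t ≤ M) {t : ℝ} (ht : t ∈ Ico t₀ T) :
    Z t ≤ Z t₀ * Real.exp (C * (T - t₀ + M)) := by
  let w (s : ℝ) : ℝ := Z s * Real.exp (-(C * (s + B s)))
  have hw (s : ℝ) (hs : s ∈ Ico t₀ T) : HasDerivAt w
      ((Z' s - C * (1 + b s) * Z s) * Real.exp (-(C * (s + B s)))) s := by
    have hexp := ((((hasDerivAt_id s).add (hB s hs)).const_mul C).fun_neg).exp
    exact ((hZ s hs).mul hexp).congr_deriv (by simp only [Pi.add_apply, id]; ring)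
  have hanti : AntitoneOn w (Ico t₀ T) := by
    refine antitoneOn_of_deriv_nonpos (convex_Ico _ _)
      (fun s hs => (hw s hs).continuousAt.continuousWithinAt)
      (fun s hs => (hw s (interior_subset hs)).differentiableAt.differentiableWithinAt)
      fun s hs => ?_
    rw [(hw s (interior_subset hs)).deriv]
    exact mul_nonpos_of_nonpos_of_nonneg (sub_nonpos.2 (hZ' s (interior_subset hs)))
      (Real.exp_pos _).le
  have ht₀ : t₀ ∈ Ico t₀ T := ⟨le_rfl, ht.1.trans_lt ht.2⟩
  calc Z t = w t * Real.exp (C * (t + B t)) := by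
        rw [mul_assoc, ← Real.exp_add, neg_add_cancel, Real.exp_zero, mul_one]
    _ ≤ w t₀ * Real.exp (C * (t + B t)) :=
        mul_le_mul_of_nonneg_right (hanti ht₀ ht ht.1) (Real.exp_pos _).le
    _ = Z t₀ * Real.exp (C * (t - t₀ + (B t - B t₀))) := by
        rw [mul_assoc, ← Real.exp_add]
        ring_nf
    _ ≤ Z t₀ * Real.exp (C * (T - t₀ + M)) := by
        refine mul_le_mul_of_nonneg_left (Real.exp_le_exp.2
          (mul_le_mul_of_nonneg_left ?_ hC)) hZ₀
        linarith [hBM t ht, ht.2]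

theorem IsSolutionOn.exists_integral_dx_dx_sq_le {a g : ℝ} (ha : 0 < a) {t₀ T M : ℝ}
    {ρ : ℝ → ℝ → ℝ} {J : Set ℝ} (hJ : IsOpen J) (hsub : Ico t₀ T ⊆ J)
    (h : IsSolutionOn a g J ρ) {b B : ℝ → ℝ} (hb : ∀ t ∈ Ico t₀ T, ∀ x, |dx ρ x t| ≤ b t)
    (hB : ∀ t ∈ Ico t₀ T, HasDerivAt B (b t) t) (hB₀ : 0 ≤ B t₀)
    (hBM : ∀ t ∈ Ico t₀ T, B t ≤ M) :
    ∃ R > 0, ∀ t ∈ Ico t₀ T, ∫ x in (0 : ℝ)..2 * π, dx (dx ρ) x t ^ 2 ≤ R := by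
  let I (t : ℝ) : ℝ := ∫ x in (0 : ℝ)..2 * π, dx (dx ρ) x t ^ 2
  have hI (t : ℝ) : 0 ≤ I t :=
    intervalIntegral.integral_nonneg Real.two_pi_pos.le fun x _ => sq_nonneg _
  have hlog (t : ℝ) : 0 ≤ Real.log (1 + I t) := Real.log_nonneg (by linarith [hI t])
  have hderiv : ∀ t ∈ Ico t₀ T, ∃ D, HasDerivAt (fun t => 1 + Real.log (1 + I t)) D t ∧
      D ≤ gronwallConst a g * (1 + b t) * (1 + Real.log (1 + I t)) := by
    intro t ht
    have hb_nonneg : 0 ≤ b t := (abs_nonneg _).trans (hb t ht 0)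
    obtain ⟨D, hD, hDle⟩ := h.exists_hasDerivAt_integral_dx_dx_sq ha hJ (hsub ht) (hb t ht)
    have hrate_nonneg : 0 ≤ gronwallConst a g * (1 + b t) * (1 + Real.log (1 + I t)) :=
      mul_nonneg (mul_nonneg (gronwallConst_nonneg a g) (by linarith)) (by linarith [hlog t])
    exact ⟨_, ((hD.const_add 1).log (by linarith [hI t])).const_add 1,
      div_one_add_le_of_abs_le_mul (hI t) hDle
        (rate_le_gronwallConst_mul a g hb_nonneg (hlog t)) hrate_nonneg⟩
  choose! Z' hZ hZ' using hderiv
  refine ⟨Real.exp ((1 + Real.log (1 + I t₀)) * Real.exp (gronwallConst a g * (T - t₀ + M))),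
    Real.exp_pos _, fun t ht => ?_⟩
  have hgronwall := gronwall_le_of_bounded_primitive (gronwallConst_nonneg a g)
    (by linarith [hlog t₀]) hZ hZ' hB hB₀ hBM ht
  have hle := (Real.log_le_iff_le_exp (by linarith [hI t])).1
    ((le_add_of_nonneg_left one_pos.le).trans hgronwall)
  exact (le_add_of_nonneg_left one_pos.le).trans hle

/-! ### Restarting and continuation -/

/-- The function equal to `ρ` before time `T` and to `σ` from time `T` on. -/
noncomputable def glue (T : ℝ) (ρ σ : ℝ → ℝ → ℝ) (x t : ℝ) : ℝ := if t < T then ρ x t else σ x t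

theorem glue_of_lt {T : ℝ} {ρ σ : ℝ → ℝ → ℝ} {t : ℝ} (ht : t < T) (x : ℝ) :
    glue T ρ σ x t = ρ x t := if_pos ht

theorem glue_of_eqOn {t₀ T : ℝ} {ρ σ : ℝ → ℝ → ℝ} (h : ∀ t ∈ Ioo t₀ T, ∀ x, ρ x t = σ x t)
    {t : ℝ} (ht : t₀ < t) (x : ℝ) : glue T ρ σ x t = σ x t := by
  by_cases htT : t < T
  · rw [glue_of_lt htT, h t ⟨ht, htT⟩]
  · exact if_neg htT

theorem IsSolutionOn.mono {a g : ℝ} {J J' : Set ℝ} {ρ : ℝ → ℝ → ℝ} (h : IsSolutionOn a g J ρ)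
    (hJ : J' ⊆ J) : IsSolutionOn a g J' ρ where
  smooth := ContDiffOn.mono h.smooth (prod_mono le_rfl hJ)
  slice t ht := h.slice t (hJ ht)
  equation t ht := h.equation t (hJ ht)

namespace IsSmoothSolution

variable {a g : ℝ} {ρ₀ : ℝ → ℝ} {t₀ T T' : ℝ} {ρ σ : ℝ → ℝ → ℝ}

theorem slice (h : IsSmoothSolution a g ρ₀ T ρ) {t : ℝ} (ht : t ∈ Ico 0 T) :
    SmoothPeriodic fun x => ρ x t := by
  refine ⟨?_, h.periodic t ht⟩
  rw [← contDiffOn_univ]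
  exact h.smooth.comp (f := fun x : ℝ => (x, t)) (ContDiff.contDiffOn (by fun_prop))
    fun x _ => ⟨mem_univ _, ht⟩

theorem isSolutionOn (h : IsSmoothSolution a g ρ₀ T ρ) : IsSolutionOn a g (Ioo 0 T) ρ where
  smooth := h.smooth.mono (prod_mono le_rfl Ioo_subset_Ico_self)
  slice t ht := h.slice (Ioo_subset_Ico_self ht)
  equation t ht x := by
    have hsmooth : SmoothOnStrip (Ioo 0 T) ρ :=
      h.smooth.mono (prod_mono le_rfl Ioo_subset_Ico_self)
    have heq := h.equation t (Ioo_subset_Ico_self ht) x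
    rw [derivWithin_of_mem_nhds (Ico_mem_nhds ht.1 ht.2)] at heq
    exact (hsmooth.hasDerivAt_dt isOpen_Ioo ht).congr_deriv (eq_neg_of_add_eq_zero_left heq)

theorem contDiffOn_glue (h : IsSmoothSolution a g ρ₀ T ρ) (ht₀ : t₀ < T)
    (hσ : IsSolutionOn a g (Ioo t₀ T') σ) (heq : ∀ t ∈ Ioo t₀ T, ∀ x, ρ x t = σ x t) :
    ContDiffOn ℝ ∞ (fun p : ℝ × ℝ => glue T ρ σ p.1 p.2) (univ ×ˢ Ico 0 T') := by
  rintro ⟨x, t⟩ ⟨-, ht⟩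
  rcases lt_or_ge t T with htT | htT
  · have hbefore : {p : ℝ × ℝ | p.2 < T} ∈ 𝓝 (x, t) :=
      (isOpen_lt continuous_snd continuous_const).mem_nhds htT
    have hstrip : (univ : Set ℝ) ×ˢ Ico 0 T ∈ 𝓝[univ ×ˢ Ico 0 T'] (x, t) := by
      filter_upwards [self_mem_nhdsWithin, mem_nhdsWithin_of_mem_nhds hbefore] with p hp hpT
      exact ⟨mem_univ _, hp.2.1, hpT⟩
    refine ((h.smooth (x, t) ⟨mem_univ _, ht.1, htT⟩).mono_of_mem_nhdsWithin
      hstrip).congr_of_eventuallyEq ?_ (glue_of_lt htT x)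
    filter_upwards [mem_nhdsWithin_of_mem_nhds hbefore] with p hp using glue_of_lt hp p.1
  · have ht₀t : t₀ < t := ht₀.trans_le htT
    refine ((hσ.smooth.contDiffAt isOpen_Ioo ⟨ht₀t, ht.2⟩).congr_of_eventuallyEq
      ?_).contDiffWithinAt
    filter_upwards [(isOpen_lt continuous_const continuous_snd).mem_nhds ht₀t] with p hp
      using glue_of_eqOn heq hp p.1

theorem equation_glue_of_lt (h : IsSmoothSolution a g ρ₀ T ρ) (hT' : T < T') {t : ℝ}
    (ht : 0 ≤ t) (htT : t < T) (x : ℝ) :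
    derivWithin (fun s => glue T ρ σ x s) (Ico 0 T') t +
      g * Ha a (fun y => glue T ρ σ y t) x * deriv (fun y => glue T ρ σ y t) x = 0 := by
  have heventually : (fun s => glue T ρ σ x s) =ᶠ[𝓝[Ico 0 T'] t] fun s => ρ x s := by
    filter_upwards [mem_nhdsWithin_of_mem_nhds (Iio_mem_nhds htT)] with s hs
      using glue_of_lt hs x
  have hIco : Ico 0 T' =ᶠ[𝓝 t] Ico 0 T := by
    filter_upwards [Iio_mem_nhds htT] with s hs
    exact propext ⟨fun h => ⟨h.1, hs⟩, fun h => ⟨h.1, h.2.trans hT'⟩⟩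
  rw [heventually.derivWithin_eq (glue_of_lt htT x), derivWithin_congr_set hIco]
  simp only [glue_of_lt htT]
  exact h.equation t ⟨ht, htT⟩ x

theorem canBeContinued_of_isSolutionOn (h : IsSmoothSolution a g ρ₀ T ρ) (hT : 0 < T)
    (ht₀ : t₀ < T) (hT' : T < T') (hσ : IsSolutionOn a g (Ioo t₀ T') σ)
    (heq : ∀ t ∈ Ioo t₀ T, ∀ x, ρ x t = σ x t) : CanBeContinued a g ρ₀ T ρ := by
  refine ⟨T', hT', glue T ρ σ, ⟨h.contDiffOn_glue ht₀ hσ heq, fun t ht => ?_, fun x => ?_,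
    fun t ht x => ?_⟩, fun t ht x => glue_of_lt ht.2 x⟩
  · rcases lt_or_ge t T with htT | htT
    · simpa only [glue_of_lt htT] using h.periodic t ⟨ht.1, htT⟩
    · simpa only [glue_of_eqOn heq (ht₀.trans_le htT)] using
        (hσ.slice t ⟨ht₀.trans_le htT, ht.2⟩).2
  · rw [glue_of_lt hT, h.initial]
  · rcases lt_or_ge t T with htT | htT
    · exact h.equation_glue_of_lt hT' ht.1 htT x
    · have ht₀t : t₀ < t := ht₀.trans_le htT
      have heventually : (fun s => glue T ρ σ x s) =ᶠ[𝓝 t] fun s => σ x s := by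
        filter_upwards [Ioi_mem_nhds ht₀t] with s hs using glue_of_eqOn heq hs x
      rw [derivWithin_of_mem_nhds (Ico_mem_nhds (hT.trans_le htT) ht.2),
        ((hσ.equation t ⟨ht₀t, ht.2⟩ x).congr_of_eventuallyEq heventually).deriv]
      simp only [glue_of_eqOn heq ht₀t]
      exact neg_add_cancel _

theorem canBeContinued_of_integral_sq_le (ha : 0 < a) (hT : 0 < T)
    (h : IsSmoothSolution a g ρ₀ T ρ) {R : ℝ} (hR : 0 < R)
    (hρR : ∀ t ∈ Ico (T / 2) T, ∫ x in (0 : ℝ)..2 * π, dx (dx ρ) x t ^ 2 ≤ R) :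
    CanBeContinued a g ρ₀ T ρ := by
  obtain ⟨τ, hτ, hlocal⟩ := exists_isSolutionOn (g := g) ha hR
  obtain ⟨t₀, ht₀, ht₀T⟩ := exists_between (max_lt (half_lt_self hT) (sub_lt_self T hτ))
  obtain ⟨hhalf, hτt₀⟩ := max_lt_iff.1 ht₀
  have ht₀_pos : 0 < t₀ := (half_pos hT).trans hhalf
  obtain ⟨σ, hσ, hσt₀⟩ := hlocal t₀ _ (h.slice ⟨ht₀_pos.le, ht₀T⟩) (hρR t₀ ⟨hhalf.le, ht₀T⟩)
  refine h.canBeContinued_of_isSolutionOn hT ht₀T (T' := t₀ + τ) (by linarith)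
    (hσ.mono (Ioo_subset_Ioo_left (by linarith))) fun t ht x => ?_
  have hlow : max 0 (t₀ - τ) < t₀ := max_lt ht₀_pos (by linarith)
  exact (h.isSolutionOn.mono (Ioo_subset_Ioo_left (le_max_left 0 (t₀ - τ)))).eq_of_eq_at ha
    isOpen_Ioo (hσ.mono (Ioo_subset_Ioo (le_max_right _ _) (by linarith)))
    (fun s hs => ⟨hlow.trans_le hs.1, hs.2.trans_lt ht.2⟩) (fun x => (hσt₀ x).symm)
    ⟨ht.1.le, le_rfl⟩ x

theorem continuousOn_dx (h : IsSmoothSolution a g ρ₀ T ρ) :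
    ContinuousOn (fun p : ℝ × ℝ => dx ρ p.1 p.2) (univ ×ˢ Ico 0 T) := by
  have hfderiv := h.smooth.continuousOn_fderivWithin
    (uniqueDiffOn_univ.prod (uniqueDiffOn_Ico 0 T)) (by simp)
  refine (hfderiv.clm_apply (continuousOn_const (c := ((1 : ℝ), (0 : ℝ))))).congr ?_
  rintro ⟨x, t⟩ ⟨-, ht⟩
  have hslice := (h.smooth.differentiableOn (by simp) (x, t)
    ⟨mem_univ _, ht⟩).hasFDerivWithinAt.comp_hasDerivWithinAt (f := fun y : ℝ => (y, t))
    (s := univ) x ((hasDerivAt_id x).prodMk (hasDerivAt_const x t)).hasDerivWithinAt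
    fun y _ => ⟨mem_univ _, ht⟩
  exact (hasDerivWithinAt_univ.1 hslice).deriv

end IsSmoothSolution

theorem continuousOn_supNorm {S : Set ℝ} {G : ℝ → ℝ → ℝ}
    (hG : ContinuousOn (fun p : ℝ × ℝ => G p.1 p.2) (univ ×ˢ S))
    (hp : ∀ t ∈ S, Function.Periodic (fun x => G x t) (2 * π)) :
    ContinuousOn (fun t => supNorm fun x => G x t) S := by
  rw [continuousOn_iff_continuous_domRestrict]
  have habs : Continuous (Function.uncurry fun (s : S) (x : ℝ) => |G x s|) :=
    (hG.comp_continuous (f := fun q : S × ℝ => (q.2, (q.1 : ℝ))) (by fun_prop)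
      fun q => ⟨mem_univ _, q.1.2⟩).abs
  refine (IsCompact.continuous_sSup (f := fun (s : S) (x : ℝ) => |G x s|)
    (isCompact_Icc (a := (0 : ℝ)) (b := 0 + 2 * π)) habs).congr fun s => ?_
  have hperiodic : Function.Periodic (fun x => |G x s|) (2 * π) := fun x =>
    congrArg abs (hp s s.2 x)
  rw [hperiodic.image_Icc Real.two_pi_pos]
  rfl

theorem intervalIntegrable_of_continuousOn_Ico {b : ℝ → ℝ} {T t : ℝ}
    (hb : ContinuousOn b (Ico 0 T)) (ht : t ∈ Ico 0 T) : IntervalIntegrable b volume 0 t :=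
  (hb.mono (by rw [uIcc_of_le ht.1]; exact Icc_subset_Ico_right ht.2)).intervalIntegrable

theorem tendsto_intervalIntegral_atTop {b : ℝ → ℝ} {T : ℝ} (hb : ContinuousOn b (Ico 0 T))
    (hb_nonneg : ∀ t ∈ Ico 0 T, 0 ≤ b t)
    (hunbounded : ∀ M, ∃ t ∈ Ico 0 T, M < ∫ s in (0 : ℝ)..t, b s) :
    Tendsto (fun t => ∫ s in (0 : ℝ)..t, b s) (𝓝[<] T) atTop := by
  refine tendsto_atTop.2 fun M => ?_
  obtain ⟨t, ht, hMt⟩ := hunbounded M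
  filter_upwards [Ioo_mem_nhdsLT ht.2] with s hs
  refine hMt.le.trans (intervalIntegral.integral_mono_interval le_rfl ht.1 hs.1.le
    (ae_restrict_of_forall_mem measurableSet_Ioc fun r hr =>
      hb_nonneg r ⟨hr.1.le, hr.2.trans_lt hs.2⟩)
    (intervalIntegrable_of_continuousOn_Ico hb ⟨ht.1.trans hs.1.le, hs.2⟩))

namespace IsSmoothSolution

variable {a g : ℝ} {ρ₀ : ℝ → ℝ} {T : ℝ} {ρ : ℝ → ℝ → ℝ}

theorem continuousOn_supNorm_deriv (h : IsSmoothSolution a g ρ₀ T ρ) :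
    ContinuousOn (fun t => supNorm (deriv fun x => ρ x t)) (Ico 0 T) :=
  continuousOn_supNorm h.continuousOn_dx fun _ ht => (h.slice ht).deriv.2

theorem supNorm_deriv_nonneg (h : IsSmoothSolution a g ρ₀ T ρ) {t : ℝ} (ht : t ∈ Ico 0 T) :
    0 ≤ supNorm (deriv fun x => ρ x t) :=
  (abs_nonneg _).trans ((h.slice ht).deriv.abs_le_supNorm 0)

theorem canBeContinued_of_integral_supNorm_le (ha : 0 < a) (hT : 0 < T)
    (h : IsSmoothSolution a g ρ₀ T ρ) {M : ℝ}
    (hM : ∀ t ∈ Ico 0 T, ∫ s in (0 : ℝ)..t, supNorm (deriv fun x => ρ x s) ≤ M) :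
    CanBeContinued a g ρ₀ T ρ := by
  have hcont := h.continuousOn_supNorm_deriv
  have hsub : Ico (T / 2) T ⊆ Ioo 0 T := fun t ht => ⟨(half_pos hT).trans_le ht.1, ht.2⟩
  have hsub' : Ico (T / 2) T ⊆ Ico 0 T := hsub.trans Ioo_subset_Ico_self
  obtain ⟨R, hR, hRle⟩ := h.isSolutionOn.exists_integral_dx_dx_sq_le ha isOpen_Ioo hsub
    (fun t ht x => (h.slice (hsub' ht)).deriv.abs_le_supNorm x)
    (fun t ht => intervalIntegral.integral_hasDerivAt_right
      (intervalIntegrable_of_continuousOn_Ico hcont (hsub' ht))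
      ((hcont.mono Ioo_subset_Ico_self).stronglyMeasurableAtFilter isOpen_Ioo t (hsub ht))
      (hcont.continuousAt (Ico_mem_nhds (hsub ht).1 ht.2)))
    (intervalIntegral.integral_nonneg (half_pos hT).le fun s hs =>
      h.supNorm_deriv_nonneg ⟨hs.1, hs.2.trans_lt (half_lt_self hT)⟩)
    (fun t ht => hM t (hsub' ht))
  exact h.canBeContinued_of_integral_sq_le ha hT hR hRle

end IsSmoothSolution

end IPM1D

theorem mainTheorem4_general (a g : ℝ) (ha : 0 < a) (ρ₀ : ℝ → ℝ) (T : ℝ) (hT : 0 < T)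
    (ρ : ℝ → ℝ → ℝ) (hρ : IPM1D.IsSmoothSolution a g ρ₀ T ρ)
    (hmax : ¬ IPM1D.CanBeContinued a g ρ₀ T ρ) :
    (∀ t ∈ Set.Ico 0 T, IntervalIntegrable
      (fun s => IPM1D.supNorm (deriv (fun x => ρ x s))) MeasureTheory.volume 0 t) ∧
    Filter.Tendsto (fun t => ∫ s in (0 : ℝ)..t, IPM1D.supNorm (deriv (fun x => ρ x s)))
      (nhdsWithin T (Set.Iio T)) Filter.atTop := by
  have hcont := hρ.continuousOn_supNorm_deriv
  refine ⟨fun t ht => IPM1D.intervalIntegrable_of_continuousOn_Ico hcont ht,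
    IPM1D.tendsto_intervalIntegral_atTop hcont (fun t ht => hρ.supNorm_deriv_nonneg ht) ?_⟩
  by_contra! hbounded
  obtain ⟨M, hM⟩ := hbounded
  exact hmax (hρ.canBeContinued_of_integral_supNorm_le ha hT hM)

theorem mainTheorem4 (a g : ℝ) (ha : 0 < a) (hg : 0 < g)
    (ρ₀ : ℝ → ℝ) (hρ₀ : IPM1D.SmoothPeriodic ρ₀)
    (T : ℝ) (hT : 0 < T)
    (ρ : ℝ → ℝ → ℝ) (hρ : IPM1D.IsSmoothSolution a g ρ₀ T ρ)
    (hmax : ¬ IPM1D.CanBeContinued a g ρ₀ T ρ) :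
    (∀ t ∈ Set.Ico 0 T, IntervalIntegrable
      (fun s => IPM1D.supNorm (deriv (fun x => ρ x s))) MeasureTheory.volume 0 t) ∧
    Filter.Tendsto (fun t => ∫ s in (0 : ℝ)..t, IPM1D.supNorm (deriv (fun x => ρ x s)))
      (nhdsWithin T (Set.Iio T)) Filter.atTop :=
  mainTheorem4_general a g ha ρ₀ T hT ρ hρ hmax
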